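/- Let $c_0,c_1,z_{int}>0$ and $\mathbf k_0\in\mathbb R^2$ with $c_j|\mathbf k_0|<1$ for $j=0,1$. Put $$\mathfrak s_j=\frac{\sqrt{1-c_j^2|\mathbf k_0|^2}}{c_j},\quad \mathcal R=\frac{\mathfrak s_0-\mathfrak s_1}{\mathfrak s_0+\mathfrak s_1},\quad A_0=\frac{1}{c_0^3\mathfrak s_0^3}\big(\mathbf I_2-c_0^2\,\mathbf k_0^\perp\otimes\mathbf k_0^\perp\big),\quad \hat{\mathcal U}_0(\omega,\mathbf q,z)=e^{-i\omega zc_0\mathbf q^TA_0\mathbf q/2},$$ $$\mathbf x_{int}=\frac{z_{int}}{\mathfrak s_0}\mathbf k_0,\qquad \mathbf x_{obs}=2\mathbf x_{int},\qquad t_{obs}=\frac{2z_{int}}{c_0^2\mathfrak s_0},$$ where $\mathbf k_0^\perp=(-\mathbf k_{0,2},\mathbf k_{0,1})^T$. Let $\Psi:\mathbb R\times\mathbb R^2\to\mathbb R$ be continuous and integrable and assume that $\hat\Psi(\omega,\mathbf k)=\iint\Psi(t,\mathbf x)e^{i\omega(t-\mathbf k\cdot\mathbf x)}\,dt\,d\mathbf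 x$ is compactly supported in $(\omega,\mathbf k)$ and vanishes for $|\omega|$ smaller than some $a>0$. Let $V$ be a continuous, mean-zero, strictly stationary random field on $\mathbb R^2$ such that $V(0)$ has a probability density $f_V$ and whose $\alpha$-mixing coefficient $$\alpha(r)=\sup_{S,S'\neq\emptyset,\ d(S,S')>r}\ \ \sup_{A\in\sigma(V|_S),\,B\in\sigma(V|_{S'})}|\mathbb P(A\cap B)-\mathbb P(A)\mathbb P(B)|$$ tends to $0$ as $r\to\infty$. Let $\phi_V(u)=\mathbb E[e^{iuV(0)}]$. Let $\gamma>1/2$. For $\varepsilon>0$ the (leading-order) reflected wave in the source plane is $$u^{\varepsilon,ref}(t,\mathbf x)=\frac{\mathcal R}{2(2\pi)^3}\iiint e^{-i\omega(t-2\mathfrak s_0z_{int}-\mathbf x\cdot\mathbf k_0)/\varepsilon}e^{i\omega\mathbf q\cdot(\mathbf x-\mathbf x_{obs})/\sqrt\varepsilon}K^\varepsilon(\omega,\mathbf q,\mathbf q')\,\hat{\mathcal U}_0(\omega,\mathbf q,z_{int})\,\hat{\mathcal U}_0(\omega,\mathbf q',z_{int})\,\hat\Psi(\omega,\mathbf q')\,\omega^2\,d\omega\,d\mathbf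 q'\,d\mathbf q,$$ $$K^\varepsilon(\omega,\mathbf q,\mathbf q')=\frac{\omega^2}{\varepsilon(2\pi)^2}\int e^{i\omega(\mathbf q'-\mathbf q)\cdot(\mathbf x'-\mathbf x_{int})/\sqrt\varepsilon}\,e^{2i\omega\mathfrak s_0V(\mathbf x'/\varepsilon^\gamma)}\,d\mathbf x',$$ and the observed wave front, for $(s,\mathbf y,\widetilde{\mathbf y})\in\mathbb X=\mathbb R\times\mathbb R^2\times\mathbb R^2$, is $$U^{\varepsilon,ref}(s,\mathbf y,\widetilde{\mathbf y})=u^{\varepsilon,ref}\big(t_{obs}+\sqrt\varepsilon\,\mathbf k_0\cdot\mathbf y+\varepsilon^\gamma\mathbf k_0\cdot\widetilde{\mathbf y}+\varepsilon s,\ \mathbf x_{obs}+\sqrt\varepsilon\,\mathbf y+\varepsilon^\gamma\widetilde{\mathbf y}\big).$$ Both are understood in the sense of distributions: in the pairing of $U^{\varepsilon,ref}$ with $\varphi\in\mathcal S(\mathbb X)$ one integrates first over $(s,\mathbf y,\widetilde{\mathbf y})$, then over $\mathbf q$ and $\mathbf q'$, then over $\mathbf x'$, and finally over $\omega$. 1.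 For every $\varepsilon>0$, $U^{\varepsilon,ref}$ is a random tempered distribution on $\mathbb X$, and as $\varepsilon\to0$ the family $(U^{\varepsilon,ref})_\varepsilon$ converges in probability in $\mathcal S'(\mathbb X)$ (with the topology of convergence on each test function) to the deterministic profile, independent of $\widetilde{\mathbf y}$, given by the absolutely convergent integral $$U^{ref}(s,\mathbf y)=\frac{\mathcal R}{2(2\pi)^3}\iint e^{-i\omega(s-\mathbf q\cdot\mathbf y)}\,\hat{\mathcal U}_0(\omega,\mathbf q,2z_{int})\,\phi_V(2\omega\mathfrak s_0)\,\hat\Psi(\omega,\mathbf q)\,\omega^2\,d\omega\,d\mathbf q .$$ 2. Let $\Phi(s)=\frac1{2\mathfrak s_0}f_V\big(\frac{s}{2\mathfrak s_0}\big)$ and $\Phi\ast_s\Psi(s,\mathbf y)=\int\Phi(s')\Psi(s-s',\mathbf y)\,ds'$, which converges absolutely for all $(s,\mathbf y)$ and is integrable on $\mathbb R\times\mathbb R^2$. Then $U^{ref}(s,\mathbf y)=\mathcal R\,\widetilde{\mathcal U}_0(s,\mathbf y,2z_{int})$ for all $(s,\mathbf y)$, where $$\widetilde{\mathcal U}_0(s,\mathbf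 y,z)=\frac1{2(2\pi)^3}\iint e^{-i\omega(s-\mathbf y\cdot\mathbf q)}\,\hat{\mathcal U}_0(\omega,\mathbf q,z)\,\widehat{\Phi\ast_s\Psi}(\omega,\mathbf q)\,\omega^2\,d\omega\,d\mathbf q$$ is a smooth solution of the paraxial wave equation $$\partial^2_{sz}\widetilde{\mathcal U}_0-\frac{c_0}2\nabla_{\mathbf y}\cdot\big(A_0\nabla_{\mathbf y}\widetilde{\mathcal U}_0\big)=0,\qquad \widetilde{\mathcal U}_0(s,\mathbf y,0)=\frac12\,\Phi\ast_s\Psi(s,\mathbf y).$$ 3. $\Phi(s)=\frac1{2\pi}\int e^{-i\omega s}\phi_V(2\omega\mathfrak s_0)\,d\omega$ in the sense of tempered distributions on $\mathbb R$, and for almost every $s$ if $\phi_V$ is integrable. -/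

import Mathlib

open MeasureTheory ProbabilityTheory Filter Topology
open scoped SchwartzMap

noncomputable section

namespace RoughInterface

/-- The transverse plane `ℝ²`. -/
abbrev Plane := EuclideanSpace ℝ (Fin 2)

/-- The space `ℝ × ℝ² × ℝ²` of the variables `(s, y, ỹ)`. -/
abbrev ObsSpace := ℝ × Plane × Plane

/-! ### The medium and the geometry of specular reflection -/

/-- Two homogeneous half-spaces with speeds `c₀` (source side) and `c₁`, the mean height `zint` of
the interface, and the lateral slowness vector `k₀` of the source. The wave propagates (is not
evanescent) on both sides; the bound for `c₁` follows from the one for `c₀` when `c₁ < c₀`. -/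
structure Medium where
  c₀ : ℝ
  c₁ : ℝ
  zint : ℝ
  k₀ : Plane
  c₀_pos : 0 < c₀
  c₁_pos : 0 < c₁
  zint_pos : 0 < zint
  propagating₀ : c₀ * ‖k₀‖ < 1
  propagating₁ : c₁ * ‖k₀‖ < 1

/-- Vertical slowness `√(1 - c²|k|²) / c`. -/
def slowness (c : ℝ) (k : Plane) : ℝ := √(1 - c ^ 2 * ‖k‖ ^ 2) / c

namespace Medium

variable (M : Medium)

/-- Vertical slowness on the source side. -/
def s₀ : ℝ := slowness M.c₀ M.k₀

/-- Vertical slowness beyond the interface. -/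
def s₁ : ℝ := slowness M.c₁ M.k₀

/-- Reflection coefficient. -/
def reflCoef : ℝ := (M.s₀ - M.s₁) / (M.s₀ + M.s₁)

/-- `A₀ = (c₀ s₀)⁻³ (I - c₀² k₀^⊥ ⊗ k₀^⊥)` with `k₀^⊥ = (-k₀₂, k₀₁)`. -/
def A₀ : Matrix (Fin 2) (Fin 2) ℝ :=
  (1 / (M.c₀ ^ 3 * M.s₀ ^ 3)) •
    (1 - M.c₀ ^ 2 • Matrix.vecMulVec ![-M.k₀ 1, M.k₀ 0] ![-M.k₀ 1, M.k₀ 0])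

/-- The quadratic form `qᵀ A₀ q`. -/
def quadForm (q : Plane) : ℝ := ∑ i, ∑ j, q i * M.A₀ i j * q j

/-- The paraxial propagator `exp(-i ω z c₀ qᵀA₀q / 2)` in the Fourier domain. -/
def hatU₀ (ω : ℝ) (q : Plane) (z : ℝ) : ℂ :=
  Complex.exp (-Complex.I * ((ω * z * M.c₀ * M.quadForm q / 2 : ℝ) : ℂ))

/-- Lateral position at which the pulse hits the interface. -/
def xint : Plane := (M.zint / M.s₀) • M.k₀

/-- Lateral position at which the specular reflection returns to the source plane. -/
def xobs : Plane := (2 * M.zint / M.s₀) • M.k₀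

/-- Arrival time of the specular reflection in the source plane. -/
def tobs : ℝ := 2 * M.zint / (M.c₀ ^ 2 * M.s₀)

/-- Observation position `x_obs + √ε y + ε^γ ỹ`. -/
def obsPos (γ ε : ℝ) (p : ObsSpace) : Plane :=
  M.xobs + √ε • p.2.1 + (ε ^ γ) • p.2.2

/-- Observation time `t_obs + √ε k₀·y + ε^γ k₀·ỹ + ε s`. -/
def obsTime (γ ε : ℝ) (p : ObsSpace) : ℝ :=
  M.tobs + √ε * inner ℝ M.k₀ p.2.1 + ε ^ γ * inner ℝ M.k₀ p.2.2 + ε * p.1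

end Medium

/-! ### The source profile -/

/-- `Ψ̂(ω, k) = ∬ Ψ(t, x) exp(iω(t - k·x)) dt dx`. -/
def sourceHat (Ψ : ℝ × Plane → ℝ) (ω : ℝ) (k : Plane) : ℂ :=
  ∫ p : ℝ × Plane, (Ψ p : ℂ) * Complex.exp (Complex.I * ((ω * (p.1 - inner ℝ k p.2) : ℝ) : ℂ))

/-- Admissible source profiles: `Ψ̂` is compactly supported in both variables, with frequencies
bounded away from zero. -/
structure IsSource (Ψ : ℝ × Plane → ℝ) : Prop where
  continuous : Continuous Ψ
  integrable : Integrable Ψ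
  compactSupport : HasCompactSupport (fun p : ℝ × Plane => sourceHat Ψ p.1 p.2)
  noLowFreq : ∃ a > 0, ∀ ω k, |ω| < a → sourceHat Ψ ω k = 0

/-! ### The random interface fluctuations -/

section Random

variable {Ω : Type*} [MeasurableSpace Ω]

/-- The σ-field generated by `V(x)`, `x ∈ S`. -/
abbrev fieldSigma (V : Plane → Ω → ℝ) (S : Set Plane) : MeasurableSpace Ω :=
  ⨆ x ∈ S, MeasurableSpace.comap (V x) (borel ℝ)

/-- `d(S, S') = inf |s - s'|`. -/
def setDist (S S' : Set Plane) : ℝ := sInf {d | ∃ s ∈ S, ∃ s' ∈ S', d = dist s s'}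

/-- The `α`-mixing coefficient: the supremum of `|P(A ∩ B) - P(A) P(B)|` over events `A`, `B`
generated by `V` on nonempty sets at distance more than `r`. -/
def alphaMix (μ : Measure Ω) (V : Plane → Ω → ℝ) (r : ℝ) : ℝ :=
  sSup {a | ∃ S S' : Set Plane, S.Nonempty ∧ S'.Nonempty ∧ r < setDist S S' ∧
    ∃ A B : Set Ω, MeasurableSet[fieldSigma V S] A ∧ MeasurableSet[fieldSigma V S'] B ∧
      a = |μ.real (A ∩ B) - μ.real A * μ.real B|}

/-- A continuous, mean-zero, (strictly) stationary, `α`-mixing random field on the plane. -/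
structure IsInterfaceField (μ : Measure Ω) (V : Plane → Ω → ℝ) : Prop where
  measurable : ∀ x, Measurable (V x)
  continuous : ∀ w, Continuous (fun x => V x w)
  integrable : ∀ x, Integrable (V x) μ
  mean_zero : ∀ x, ∫ w, V x w ∂μ = 0
  stationary : ∀ (n : ℕ) (x : Fin n → Plane) (h : Plane),
    μ.map (fun w i => V (x i + h) w) = μ.map (fun w i => V (x i) w)
  mixing : Tendsto (alphaMix μ V) atTop (𝓝 0)

/-- The characteristic function `φ_V(u) = E[exp(iuV(0))]`. -/
def phiV (μ : Measure Ω) (V : Plane → Ω → ℝ) (u : ℝ) : ℂ :=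
  ∫ w, Complex.exp (Complex.I * ((u * V 0 w : ℝ) : ℂ)) ∂μ

/-- Convergence in probability, as `ε ↓ 0`, of a family of random elements of a topological group:
for every neighbourhood `N` of `0`, the probability that `U ε - u ∉ N` tends to `0`. -/
def TendstoInProbability {T : Type*} [TopologicalSpace T] [AddGroup T] (μ : Measure Ω)
    (U : ℝ → Ω → T) (u : T) : Prop :=
  ∀ N ∈ 𝓝 (0 : T), Tendsto (fun ε => μ {w | U ε w - u ∉ N}) (𝓝[>] 0) (𝓝 0)

end Random

/-! ### The reflected wave front -/

/-- The scattering operator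
`K^ε(τ,ω,q,q') = ω²/(ε(2π)²) ∫ exp(iω(q'-q)·(x'-x_int)/√ε) exp(iωτ v(x'/ε^γ)) dx'`
is a distribution in `(q, q')`; this is its pairing `∬ K^ε(τ,ω,q,q') f(q) g(q') dq dq'`. Here `v` is
one realization of the interface fluctuations. -/
def scatteringForm (M : Medium) (v : Plane → ℝ) (γ ε τ ω : ℝ) (f g : Plane → ℂ) : ℂ :=
  ((ω ^ 2 / (ε * (2 * Real.pi) ^ 2) : ℝ) : ℂ) *
    ∫ x' : Plane, Complex.exp (Complex.I * ((ω * τ * v ((ε ^ γ)⁻¹ • x') : ℝ) : ℂ)) *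
      (∫ q : Plane, f q *
        Complex.exp (-Complex.I * ((ω * inner ℝ q (x' - M.xint) / √ε : ℝ) : ℂ))) *
      (∫ q' : Plane, g q' *
        Complex.exp (Complex.I * ((ω * inner ℝ q' (x' - M.xint) / √ε : ℝ) : ℂ)))

/-- The test function `φ` integrated over `(s, y, ỹ)` against the factor
`exp(-iω(t - 2s₀z_int - x·k₀)/ε) exp(iωq·(x - x_obs)/√ε)`, which is the part of the integrand of the
reflected wave that depends on the observation point, taken at the time `t` and the position `x` of
the observed wave front. -/
def testAmplitude (M : Medium) (γ ε : ℝ) (φ : ObsSpace → ℂ) (ω : ℝ) (q : Plane) : ℂ :=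
  ∫ p : ObsSpace, φ p *
    Complex.exp (-Complex.I * (((ω * (M.obsTime γ ε p - 2 * M.s₀ * M.zint
      - inner ℝ (M.obsPos γ ε p) M.k₀) / ε : ℝ)) : ℂ)) *
    Complex.exp (Complex.I * ((ω * inner ℝ q (M.obsPos γ ε p - M.xobs) / √ε : ℝ) : ℂ))

/-- The pairing `⟨U^{ε,ref}, φ⟩` of the reflected wave front
`U^{ε,ref}(s,y,ỹ) = u^{ε,ref}(t_obs + √ε k₀·y + ε^γ k₀·ỹ + εs, x_obs + √ε y + ε^γ ỹ, z = 0)`, where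
`u^{ε,ref}(t,x,0) = R/(2(2π)³) ∭ exp(-iω(t - 2s₀z_int - x·k₀)/ε) exp(iωq·(x - x_obs)/√ε)`
`  K^ε(2s₀,ω,q,q') Û₀(ω,q,z_int) Û₀(ω,q',z_int) Ψ̂(ω,q') ω² dω dq' dq`. -/
def wavePairing (M : Medium) (Ψ : ℝ × Plane → ℝ) (v : Plane → ℝ) (γ ε : ℝ)
    (φ : ObsSpace → ℂ) : ℂ :=
  ((M.reflCoef / (2 * (2 * Real.pi) ^ 3) : ℝ) : ℂ) *
    ∫ ω : ℝ, ((ω ^ 2 : ℝ) : ℂ) *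
      scatteringForm M v γ ε (2 * M.s₀) ω
        (fun q => testAmplitude M γ ε φ ω q * M.hatU₀ ω q M.zint)
        (fun q' => M.hatU₀ ω q' M.zint * sourceHat Ψ ω q')

/-! ### The limit profile -/

/-- The integrand `exp(-iω(s - q·y)) Û₀(ω,q,2z_int) φ_V(2ωs₀) Ψ̂(ω,q) ω²` of the limit profile. -/
def profileIntegrand (M : Medium) (Ψ : ℝ × Plane → ℝ) (φV : ℝ → ℂ) (s : ℝ) (y : Plane)
    (p : ℝ × Plane) : ℂ :=
  Complex.exp (-Complex.I * ((p.1 * (s - inner ℝ p.2 y) : ℝ) : ℂ)) *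
    M.hatU₀ p.1 p.2 (2 * M.zint) * φV (2 * p.1 * M.s₀) * sourceHat Ψ p.1 p.2 *
    ((p.1 ^ 2 : ℝ) : ℂ)

/-- The homogenized reflected pulse `U^ref(s, y)`. -/
def homogenizedProfile (M : Medium) (Ψ : ℝ × Plane → ℝ) (φV : ℝ → ℂ) (s : ℝ) (y : Plane) : ℂ :=
  ((M.reflCoef / (2 * (2 * Real.pi) ^ 3) : ℝ) : ℂ) *
    ∫ p : ℝ × Plane, profileIntegrand M Ψ φV s y p

/-- The paraxial pulse `𝒰₀(s,y,z) = 1/(2(2π)³) ∫ exp(-iω(s - y·q)) Û₀(ω,q,z) Ψ̂(ω,q) ω² dω dq`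
emitted by the source profile `Ψ`. -/
def paraxialPulse (M : Medium) (Ψ : ℝ × Plane → ℝ) (s : ℝ) (y : Plane) (z : ℝ) : ℂ :=
  ((1 / (2 * (2 * Real.pi) ^ 3) : ℝ) : ℂ) *
    ∫ p : ℝ × Plane, Complex.exp (-Complex.I * ((p.1 * (s - inner ℝ y p.2) : ℝ) : ℂ)) *
      M.hatU₀ p.1 p.2 z * sourceHat Ψ p.1 p.2 * ((p.1 ^ 2 : ℝ) : ℂ)

/-- The partial derivative `∂_{y_i}`. -/
def partialY (i : Fin 2) (f : Plane → ℂ) (y : Plane) : ℂ :=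
  lineDeriv ℝ f y (EuclideanSpace.single i (1 : ℝ))

/-- `U` is a smooth solution of the paraxial wave equation `∂²_{sz} U - (c₀/2) ∇_y·(A₀ ∇_y U) = 0`
with `U(·,·,0) = U₀`. -/
structure SolvesParaxial (M : Medium) (U : ℝ → Plane → ℝ → ℂ) (U₀ : ℝ → Plane → ℂ) : Prop where
  smooth : ContDiff ℝ (⊤ : ℕ∞) (fun p : ℝ × Plane × ℝ => U p.1 p.2.1 p.2.2)
  equation : ∀ s y z,
    deriv (fun s' => deriv (fun z' => U s' y z') z) s
      - ((M.c₀ / 2 : ℝ) : ℂ) *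
        ∑ i, partialY i (fun y' => ∑ j, (M.A₀ i j : ℂ) * partialY j (fun y'' => U s y'' z) y') y
      = 0
  initial : ∀ s y, U s y 0 = U₀ s y

/-- The scaled density `Φ(s) = f_V(s/(2s₀)) / (2s₀)`. -/
def scaledDensity (M : Medium) (fV : ℝ → ℝ) (s : ℝ) : ℝ :=
  1 / (2 * M.s₀) * fV (s / (2 * M.s₀))

/-- Convolution in time `(Φ *ₛ Ψ)(s, y) = ∫ Φ(s') Ψ(s - s', y) ds'`. -/
def timeConv (Φ : ℝ → ℝ) (Ψ : ℝ × Plane → ℝ) (p : ℝ × Plane) : ℝ :=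
  ∫ s' : ℝ, Φ s' * Ψ (p.1 - s', p.2)

end RoughInterface

end

open RoughInterface

/-!
The frequency, slowness and position integrals of the reflected wave are rearranged until the random
medium enters through a single bounded factor, which is then averaged.

*Reduction.* The travel time and the arrival point are those of the geometrical-optics ray, so the
fast phases in `testAmplitude` cancel exactly (`Medium.obsTime_sub`), and what is left is a Fourier
transform of the test function, `obsAmplitude`, in which `δ = ε^(γ - 1/2)` multiplies `ỹ`. The
substitution `x' = x_int + √ε x` absorbs the factor `1/ε` of the scattering operator. The pairing
becomes `∬ e^{2iωs₀V(⋯)} D_δ(ω, x) dω dx`, with `D_δ` the product of two superpositions of plane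
waves, one for the incident wave and one for the test function (`interfaceDensity`,
`wavePairing_eq`).

*Energy estimate.* By Cauchy–Schwarz and Plancherel, the `L¹` norm of `D_δ` is bounded by the `L²`
norm of the amplitude on the frequency band of the source
(`exists_lintegral_interfaceDensity_le`), hence by a Schwartz seminorm of the test function,
uniformly in `δ`. This gives a tempered distribution for each realization, and `D_δ → D_0` in `L¹`
as `δ → 0`, which is where the dependence on `ỹ` is lost.

*Averaging.* In the variable `x` the field `V(x'/ε^γ)` fluctuates on the length `ε^(γ - 1/2) → 0`.
The second moment of `∬ (e^{2iωs₀V} - φ_V(2ωs₀)) D_0` is a double integral of covariances at two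
points. By mixing these vanish in the limit off the diagonal, which is a null set
(`norm_cov_phase_le`, `tendsto_integral_norm_sq_centeredPhase`). So the phase may be replaced by
`φ_V`. Parseval's identity then matches the incident and the reflected plane waves
(`integral_mul_interfaceDensity`), and the homogenized profile appears. Chebyshev's inequality turns
the second moment bound into convergence in probability.

*The profile.* The Fourier transform of the scaled density `Φ` is `φ_V(2ωs₀)`, so multiplication by
it is a convolution of the source in time (`sourceHat_timeConv`). This convolution is again an
admissible source. The source is recovered from its spectrum in frequency and slowness with the
Jacobian `ω²/(2π)³` (`IsSource.inversion`). This inversion gives the initial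
condition of the paraxial equation, which each plane wave in the superposition satisfies
(`paraxialWave_equation`). Fourier inversion of test functions gives the last two claims.
-/

/-! ### Plancherel's theorem for integrable, square integrable functions -/

section Plancherel

open FourierTransform ComplexConjugate

variable {E : Type*} [NormedAddCommGroup E] [InnerProductSpace ℝ E] [FiniteDimensional ℝ E]
  [MeasurableSpace E] [BorelSpace E]

/-- The Fourier transform of an integrable function is continuous. -/
lemma continuous_fourier_of_integrable {f : E → ℂ} (hf : Integrable f) :
    Continuous (𝓕 f) :=
  VectorFourier.fourierIntegral_continuous Real.continuous_fourierChar
    (by exact continuous_inner) hf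

/-- The `L²` Fourier transform, defined by density, agrees with the Fourier integral where the
latter is defined. Both represent the same tempered distribution. -/
lemma fourier_toLp_ae_eq {f : E → ℂ} (hf : Integrable f) (hf2 : MemLp f 2) :
    (𝓕 (hf2.toLp f) : Lp ℂ 2 (volume : Measure E)) =ᵐ[volume] 𝓕 f := by
  apply ae_eq_of_integral_contDiff_smul_eq
  · exact (Lp.memLp _).locallyIntegrable (by norm_num)
  · exact (continuous_fourier_of_integrable hf).locallyIntegrable
  · intro g hg hgc
    have h1 : HasCompactSupport (Complex.ofRealCLM ∘ g) := hgc.comp_left rfl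
    have h2 : ContDiff ℝ (⊤ : ℕ∞) (Complex.ofRealCLM ∘ g) := by fun_prop
    set χ : 𝓢(E, ℂ) := h1.toSchwartzMap h2 with hχ
    have hχg : ∀ x, χ x = (g x : ℂ) := fun x => rfl
    have key := congrArg (fun T : 𝓢'(E, ℂ) => T χ)
      (Lp.fourier_toTemperedDistribution_eq (hf2.toLp f))
    simp only [TemperedDistribution.fourier_apply, Lp.toTemperedDistribution_apply] at key
    have e1 : ∫ x, (𝓕 χ) x • (hf2.toLp f) x = ∫ x, (𝓕 (χ : E → ℂ)) x • f x := by
      apply integral_congr_ae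
      filter_upwards [hf2.coeFn_toLp] with x hx
      rw [hx, SchwartzMap.fourier_coe]
    have e2 : ∫ x, (𝓕 (χ : E → ℂ)) x • f x = ∫ x, χ x • 𝓕 f x := by
      have := VectorFourier.integral_fourierIntegral_smul_eq_flip (L := innerₗ E)
        (μ := volume) (ν := volume) Real.continuous_fourierChar (by exact continuous_inner)
        χ.integrable hf
      simpa using! this
    rw [e1, e2] at key
    simp only [hχg] at key
    simpa using key.symm

lemma eLpNorm_two_fourier {f : E → ℂ} (hf : Integrable f) (hf2 : MemLp f 2) :
    eLpNorm (𝓕 f) 2 = eLpNorm f 2 := by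
  rw [← eLpNorm_congr_ae (fourier_toLp_ae_eq hf hf2), ← eLpNorm_congr_ae hf2.coeFn_toLp,
    ← Lp.enorm_def, ← Lp.enorm_def, ← ofReal_norm, ← ofReal_norm, Lp.norm_fourier_eq]

/-- The bilinear Parseval identity. -/
lemma integral_fourier_mul_fourierInv {f g : E → ℂ} (hf : Integrable f) (hf2 : MemLp f 2)
    (hg : Integrable g) (hg2 : MemLp g 2) :
    ∫ x, 𝓕 f x * 𝓕⁻ g x = ∫ x, f x * g x := by
  have hg' : Integrable (fun x => conj (g x)) :=
    Complex.conjLIE.toContinuousLinearEquiv.toContinuousLinearMap.integrable_comp hg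
  have hg2' : MemLp (fun x => conj (g x)) 2 := hg2.star
  have key := Lp.inner_fourier_eq (hg2'.toLp _) (hf2.toLp _)
  simp only [L2.inner_def] at key
  have hconj : ∀ x, 𝓕⁻ g x = conj (𝓕 (fun y => conj (g y)) x) := by
    intro x
    rw [Real.fourierInv_eq, Real.fourier_eq, ← integral_conj]
    congr 1; ext v
    simp [Circle.smul_def, Real.fourierChar_apply, ← Complex.exp_conj, map_ofNat]
  have e1 : ∫ x, 𝓕 f x * 𝓕⁻ g x =
      ∫ x, inner ℂ ((𝓕 (hg2'.toLp _) : Lp ℂ 2 (volume : Measure E)) x)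
        ((𝓕 (hf2.toLp f) : Lp ℂ 2 (volume : Measure E)) x) := by
    apply integral_congr_ae
    filter_upwards [fourier_toLp_ae_eq hf hf2, fourier_toLp_ae_eq hg' hg2'] with x h1 h2
    rw [h1, h2, hconj]
    simp
  rw [e1, key]
  apply integral_congr_ae
  filter_upwards [hf2.coeFn_toLp, hg2'.coeFn_toLp] with x h1 h2
  rw [h1, h2]
  simp

end Plancherel

namespace RoughInterface

/-! ### Superpositions of plane waves -/

/-- The superposition `∫ a(q) e^{-iω q·x} dq` of plane waves of frequency `ω`. -/
noncomputable def planeWaves (ω : ℝ) (a : Plane → ℂ) (x : Plane) : ℂ :=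
  ∫ q : Plane, a q * Complex.exp (-Complex.I * ((ω * inner ℝ q x : ℝ) : ℂ))

open FourierTransform in
lemma planeWaves_eq_fourier (ω : ℝ) (a : Plane → ℂ) (x : Plane) :
    planeWaves ω a x = 𝓕 a ((ω / (2 * Real.pi)) • x) := by
  rw [planeWaves, Real.fourier_eq']
  congr 1; ext q
  rw [smul_eq_mul, mul_comm, inner_smul_right]
  congr 2
  push_cast
  field_simp

open FourierTransform in
lemma planeWaves_neg_eq_fourierInv (ω : ℝ) (a : Plane → ℂ) (x : Plane) :
    planeWaves (-ω) a x = 𝓕⁻ a ((ω / (2 * Real.pi)) • x) := by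
  rw [planeWaves_eq_fourier, Real.fourierInv_eq_fourier_neg, neg_div, neg_smul]

lemma lintegral_comp_smul_plane {f : Plane → ENNReal} {c : ℝ} (hc : c ≠ 0) :
    ∫⁻ x, f (c • x) = ENNReal.ofReal ((c⁻¹) ^ 2) * ∫⁻ x, f x := by
  have h1 := Measure.map_addHaar_smul (volume : Measure Plane) hc
  have h2 : ∫⁻ x, f (c • x) = ∫⁻ x, f x ∂(Measure.map (c • ·) (volume : Measure Plane)) := by
    exact (lintegral_map_equiv f (Homeomorph.smulOfNeZero c hc (α := Plane)).toMeasurableEquiv).symm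
  rw [h2, h1, lintegral_smul_measure, smul_eq_mul]
  congr 2
  rw [finrank_euclideanSpace_fin, abs_of_nonneg (by positivity), inv_pow]

/-- Plancherel's theorem in the semiclassical scaling. -/
lemma lintegral_enorm_sq_planeWaves {ω : ℝ} (hω : ω ≠ 0) {a : Plane → ℂ}
    (ha : Integrable a) (ha2 : MemLp a 2) :
    ∫⁻ x, ‖planeWaves ω a x‖ₑ ^ 2 =
      ENNReal.ofReal ((2 * Real.pi / ω) ^ 2) * ∫⁻ q, ‖a q‖ₑ ^ 2 := by
  simp_rw [planeWaves_eq_fourier]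
  rw [lintegral_comp_smul_plane (f := fun x => ‖_‖ₑ ^ 2)
    (div_ne_zero hω (by positivity : 2 * Real.pi ≠ 0)), inv_div]
  congr 1
  have := congrArg (· ^ 2) (eLpNorm_two_fourier ha ha2)
  simp only [eLpNorm_eq_lintegral_rpow_enorm_toReal (p := 2) (by norm_num) (by norm_num)] at this
  have h2 : ∀ t : ENNReal, (t ^ (1 / (2 : ℝ))) ^ 2 = t := fun t => by
    rw [← ENNReal.rpow_natCast, ← ENNReal.rpow_mul]; norm_num
  simpa only [ENNReal.toReal_ofNat, ENNReal.rpow_ofNat, h2] using this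

/-- Parseval's identity in the semiclassical scaling. -/
lemma integral_planeWaves_mul_planeWaves_neg {ω : ℝ} {a b : Plane → ℂ}
    (ha : Integrable a) (ha2 : MemLp a 2) (hb : Integrable b) (hb2 : MemLp b 2) :
    ∫ x, planeWaves ω a x * planeWaves (-ω) b x =
      (((2 * Real.pi / ω) ^ 2 : ℝ) : ℂ) * ∫ q, a q * b q := by
  simp_rw [planeWaves_neg_eq_fourierInv, planeWaves_eq_fourier]
  have := Measure.integral_comp_smul (volume : Measure Plane)
    (fun x => FourierTransform.fourier a x * FourierTransform.fourierInv b x) (ω / (2 * Real.pi))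
  rw [this, integral_fourier_mul_fourierInv ha ha2 hb hb2, finrank_euclideanSpace_fin,
    abs_of_nonneg (by positivity), ← inv_pow, inv_div, Complex.real_smul]

instance isAddHaarMeasure_volume_plane_prod :
    (volume : Measure (Plane × Plane)).IsAddHaarMeasure :=
  Measure.prod.instIsAddHaarMeasure _ _

instance isAddHaarMeasure_volume_obsSpace : (volume : Measure ObsSpace).IsAddHaarMeasure :=
  Measure.prod.instIsAddHaarMeasure (volume : Measure ℝ) (volume : Measure (Plane × Plane))

/-! ### Geometry of the specular reflection and the amplitude of a test function -/

lemma slowness_pos {c : ℝ} {k : Plane} (hc : 0 < c) (hk : c * ‖k‖ < 1) : 0 < slowness c k := by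
  have h0 : 0 ≤ c * ‖k‖ := by positivity
  have : 0 < 1 - c ^ 2 * ‖k‖ ^ 2 := by nlinarith
  exact div_pos (Real.sqrt_pos.mpr this) hc

lemma Medium.s₀_pos (M : Medium) : 0 < M.s₀ := slowness_pos M.c₀_pos M.propagating₀

lemma Medium.s₀_sq (M : Medium) : M.s₀ ^ 2 = 1 / M.c₀ ^ 2 - ‖M.k₀‖ ^ 2 := by
  have hc := M.c₀_pos
  have h0 : 0 ≤ M.c₀ * ‖M.k₀‖ := by positivity
  have hk := M.propagating₀
  have : 0 ≤ 1 - M.c₀ ^ 2 * ‖M.k₀‖ ^ 2 := by nlinarith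
  rw [Medium.s₀, slowness, div_pow, Real.sq_sqrt this]
  field_simp

/-- The amplitude `∫ φ(s, y, ỹ) e^{-iω(s - q·(y + δỹ))}` of a test function. For `δ = ε^{γ - 1/2}`
this is `testAmplitude`: at the observation point the fast phase cancels. -/
noncomputable def obsAmplitude (δ : ℝ) (φ : ObsSpace → ℂ) (ω : ℝ) (q : Plane) : ℂ :=
  ∫ p : ObsSpace, φ p *
    Complex.exp (-Complex.I * ((ω * (p.1 - inner ℝ q (p.2.1 + δ • p.2.2)) : ℝ) : ℂ))

/-- The time of arrival is exactly the one of the geometrical-optics ray, so that only the fine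
scale `s` is left of the phase in time. -/
lemma Medium.obsTime_sub (M : Medium) (γ ε : ℝ) (p : ObsSpace) :
    M.obsTime γ ε p - 2 * M.s₀ * M.zint - inner ℝ (M.obsPos γ ε p) M.k₀ = ε * p.1 := by
  have hs := M.s₀_pos
  have hc := M.c₀_pos
  have h : M.tobs - 2 * M.s₀ * M.zint = 2 * M.zint / M.s₀ * ‖M.k₀‖ ^ 2 := by
    have := M.s₀_sq
    have h2 : ‖M.k₀‖ ^ 2 = 1 / M.c₀ ^ 2 - M.s₀ ^ 2 := by linarith
    rw [h2, Medium.tobs]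
    field_simp
  rw [Medium.obsTime, Medium.obsPos, Medium.xobs, inner_add_left, inner_add_left,
    real_inner_smul_left, real_inner_smul_left, real_inner_smul_left, real_inner_self_eq_norm_sq,
    real_inner_comm M.k₀ p.2.1, real_inner_comm M.k₀ p.2.2]
  linarith

lemma testAmplitude_eq_obsAmplitude (M : Medium) {γ ε : ℝ} (hε : 0 < ε) (φ : ObsSpace → ℂ) (ω : ℝ)
    (q : Plane) :
    testAmplitude M γ ε φ ω q = obsAmplitude (ε ^ (γ - 1 / 2)) φ ω q := by
  rw [testAmplitude, obsAmplitude]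
  congr 1; ext p
  rw [mul_assoc, ← Complex.exp_add, M.obsTime_sub]
  have h1 : M.obsPos γ ε p - M.xobs = √ε • (p.2.1 + (ε ^ (γ - 1 / 2)) • p.2.2) := by
    rw [Medium.obsPos, smul_add, smul_smul, Real.sqrt_eq_rpow, ← Real.rpow_add hε]
    rw [add_sub_cancel]
    abel
  have h2 : √ε ≠ 0 := (Real.sqrt_pos.mpr hε).ne'
  rw [h1, inner_smul_right]
  congr 2
  have h3 : ω * (ε * p.1) / ε = ω * p.1 := by field_simp
  have h4 : ∀ r : ℝ, ω * (√ε * r) / √ε = ω * r := fun r => by field_simp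
  rw [h3, h4]
  push_cast
  ring

lemma norm_exp_neg_I_mul_ofReal (t : ℝ) : ‖Complex.exp (-Complex.I * (t : ℂ))‖ = 1 := by
  rw [show -Complex.I * (t : ℂ) = ((-t : ℝ) : ℂ) * Complex.I by push_cast; ring,
    Complex.norm_exp_ofReal_mul_I]

lemma norm_obsAmplitude_le (δ : ℝ) (φ : ObsSpace → ℂ) (ω : ℝ) (q : Plane) :
    ‖obsAmplitude δ φ ω q‖ ≤ ∫ p, ‖φ p‖ := by
  refine (norm_integral_le_integral_norm _).trans_eq ?_
  simp_rw [norm_mul, norm_exp_neg_I_mul_ofReal, mul_one]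

lemma continuous_obsAmplitude {φ : ObsSpace → ℂ} (hφ : Integrable φ) :
    Continuous (fun x : ℝ × ℝ × Plane => obsAmplitude x.1 φ x.2.1 x.2.2) := by
  unfold obsAmplitude
  refine continuous_of_dominated (bound := fun p => ‖φ p‖) ?_ ?_ hφ.norm ?_
  · intro x
    refine hφ.1.mul (Continuous.aestronglyMeasurable ?_)
    fun_prop
  · intro x
    filter_upwards with p
    rw [norm_mul, norm_exp_neg_I_mul_ofReal, mul_one]
  · filter_upwards with p
    fun_prop

/-- The wave covector `(ω/2π) (1, -q, -δq)` of the plane wave `e^{-iω(s - q·(y + δỹ))}`. -/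
noncomputable def obsCovector (δ ω : ℝ) (q : Plane) : ObsSpace →L[ℝ] ℝ :=
  (ω / (2 * Real.pi)) • (ContinuousLinearMap.fst ℝ ℝ (Plane × Plane) -
    (innerSL ℝ q).comp ((ContinuousLinearMap.fst ℝ Plane Plane +
      δ • ContinuousLinearMap.snd ℝ Plane Plane).comp
        (ContinuousLinearMap.snd ℝ ℝ (Plane × Plane))))

lemma obsCovector_apply (δ ω : ℝ) (q : Plane) (p : ObsSpace) :
    obsCovector δ ω q p = ω / (2 * Real.pi) * (p.1 - inner ℝ q (p.2.1 + δ • p.2.2)) := by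
  simp [obsCovector, inner_add_right, inner_smul_right]

lemma obsAmplitude_eq_fourierIntegral (δ : ℝ) (φ : ObsSpace → ℂ) (ω : ℝ) (q : Plane) :
    obsAmplitude δ φ ω q = VectorFourier.fourierIntegral Real.fourierChar volume
      (ContinuousLinearMap.toLinearMap₁₂
        (ContinuousLinearMap.apply ℝ ℝ : ObsSpace →L[ℝ] (ObsSpace →L[ℝ] ℝ) →L[ℝ] ℝ)) φ
      (obsCovector δ ω q) := by
  rw [obsAmplitude, VectorFourier.fourierIntegral]
  congr 1; ext p
  have : (ContinuousLinearMap.toLinearMap₁₂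
        (ContinuousLinearMap.apply ℝ ℝ : ObsSpace →L[ℝ] (ObsSpace →L[ℝ] ℝ) →L[ℝ] ℝ)) p
        (obsCovector δ ω q) = obsCovector δ ω q p := rfl
  rw [this, obsCovector_apply, Circle.smul_def, Real.fourierChar_apply, smul_eq_mul, mul_comm]
  congr 2
  push_cast
  field_simp

/-- The amplitude of a Schwartz function decays like `(|ω||q|)⁻⁴`, uniformly in `δ`: integrate by
parts four times in the direction `(0, q, 0)`. -/
lemma exists_obsAmplitude_bound : ∃ (s : Finset (ℕ × ℕ)) (C : ℝ), 0 ≤ C ∧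
    ∀ (φ : 𝓢(ObsSpace, ℂ)) (δ ω : ℝ) (q : Plane),
      (1 + (|ω| * ‖q‖) ^ 4) * ‖obsAmplitude δ φ ω q‖ ≤
        C * (s.sup (schwartzSeminormFamily ℂ ObsSpace ℂ)) φ := by
  set N := (volume : Measure ObsSpace).integrablePower with hN
  set C0 : ℝ := 2 ^ N * ∫ x : ObsSpace, (1 + ‖x‖) ^ (-(N : ℝ)) with hC0
  have hC0n : 0 ≤ C0 := by
    have : 0 ≤ ∫ x : ObsSpace, (1 + ‖x‖) ^ (-(N : ℝ)) :=
      integral_nonneg fun x => by positivity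
    positivity
  set s : Finset (ℕ × ℕ) := {0, N} ×ˢ Finset.range 5 with hs
  have hsem : ∀ (φ : 𝓢(ObsSpace, ℂ)) (k n : ℕ), (k = 0 ∨ k = N) → n < 5 →
      SchwartzMap.seminorm ℂ k n φ ≤ (s.sup (schwartzSeminormFamily ℂ ObsSpace ℂ)) φ := by
    intro φ k n hk hn
    have hmem : (k, n) ∈ s := by
      simp only [hs, Finset.mem_product, Finset.mem_insert, Finset.mem_singleton, Finset.mem_range]
      exact ⟨hk, hn⟩
    have := Finset.le_sup (f := schwartzSeminormFamily ℂ ObsSpace ℂ) hmem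
    exact this φ
  have hint : ∀ (φ : 𝓢(ObsSpace, ℂ)) (n : ℕ), n < 5 →
      ∫ x : ObsSpace, ‖x‖ ^ 0 * ‖iteratedFDeriv ℝ n φ x‖ ≤
        C0 * (2 * (s.sup (schwartzSeminormFamily ℂ ObsSpace ℂ)) φ) := by
    intro φ n hn
    refine (SchwartzMap.integral_pow_mul_iteratedFDeriv_le ℂ volume φ 0 n).trans ?_
    refine mul_le_mul_of_nonneg_left ?_ hC0n
    have h1 := hsem φ 0 n (Or.inl rfl) hn
    have h2 := hsem φ (0 + N) n (Or.inr (zero_add _)) hn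
    linarith
  refine ⟨s, 2 * C0 + (2 * Real.pi) ^ 4 * (2 ^ 4 * (5 * (2 * C0))), by positivity, ?_⟩
  intro φ δ ω q
  set P := (s.sup (schwartzSeminormFamily ℂ ObsSpace ℂ)) φ with hP
  have hPn : 0 ≤ P := apply_nonneg _ _
  have h0 : ‖obsAmplitude δ φ ω q‖ ≤ 2 * C0 * P := by
    refine (norm_obsAmplitude_le δ φ ω q).trans ?_
    have := hint φ 0 (by norm_num)
    simp only [pow_zero, one_mul, norm_iteratedFDeriv_zero] at this
    linarith
  have h4 : (|ω| * ‖q‖) ^ 4 * ‖obsAmplitude δ φ ω q‖ ≤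
      (2 * Real.pi) ^ 4 * (2 ^ 4 * (5 * (2 * C0))) * P := by
    by_cases hq : q = 0
    · subst hq
      simp only [norm_zero, mul_zero, ne_eq, OfNat.ofNat_ne_zero, not_false_eq_true, zero_pow,
        zero_mul]
      positivity
    have hqn : 0 < ‖q‖ := norm_pos_iff.mpr hq
    have key := VectorFourier.pow_mul_norm_iteratedFDeriv_fourierIntegral_le
      (ContinuousLinearMap.apply ℝ ℝ : ObsSpace →L[ℝ] (ObsSpace →L[ℝ] ℝ) →L[ℝ] ℝ)
      (μ := volume) (K := ⊤) (N := ⊤) (f := φ) (φ.smooth ⊤)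
      (fun k n _ _ => φ.integrable_pow_mul_iteratedFDeriv volume k n) (k := 0) (n := 4)
      le_top le_top (0, q, 0) (obsCovector δ ω q)
    rw [norm_iteratedFDeriv_zero, ← obsAmplitude_eq_fourierIntegral] at key
    have hL : (ContinuousLinearMap.apply ℝ ℝ : ObsSpace →L[ℝ] (ObsSpace →L[ℝ] ℝ) →L[ℝ] ℝ)
        (0, q, 0) (obsCovector δ ω q) = - (ω / (2 * Real.pi) * ‖q‖ ^ 2) := by
      change obsCovector δ ω q (0, q, 0) = _
      rw [obsCovector_apply]
      simp
    have hv : ‖((0, q, 0) : ObsSpace)‖ = ‖q‖ := by simp [Prod.norm_def]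
    have hsum : ∑ p ∈ Finset.range (0 + 1) ×ˢ Finset.range (4 + 1),
        ∫ v : ObsSpace, ‖v‖ ^ p.1 * ‖iteratedFDeriv ℝ p.2 φ v‖ ≤ 5 * (2 * C0) * P := by
      have : ∀ p ∈ Finset.range (0 + 1) ×ˢ Finset.range (4 + 1),
          ∫ v : ObsSpace, ‖v‖ ^ p.1 * ‖iteratedFDeriv ℝ p.2 φ v‖ ≤ 2 * C0 * P := by
        intro p hp
        simp only [Finset.mem_product, Finset.mem_range] at hp
        obtain ⟨k, n⟩ := p
        have hk : k = 0 := by simp at hp; omega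
        subst hk
        have := hint φ n (by simp at hp; omega)
        simp only at this ⊢
        linarith
      refine (Finset.sum_le_card_nsmul _ _ _ this).trans_eq ?_
      simp
      ring
    rw [hL, hv, abs_neg] at key
    have e1 : |ω / (2 * Real.pi) * ‖q‖ ^ 2| = |ω| * ‖q‖ ^ 2 / (2 * Real.pi) := by
      rw [abs_mul, abs_div, abs_of_pos (by positivity : 0 < 2 * Real.pi),
        abs_of_nonneg (by positivity : 0 ≤ ‖q‖ ^ 2)]
      ring
    rw [e1] at key
    have key2 : (|ω| * ‖q‖ ^ 2 / (2 * Real.pi)) ^ 4 * ‖obsAmplitude δ φ ω q‖ ≤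
        ‖q‖ ^ 4 * (2 ^ 4 * (5 * (2 * C0) * P)) := by
      refine key.trans ?_
      rw [pow_zero, mul_one, mul_assoc]
      gcongr
      norm_num
    have e2 : (|ω| * ‖q‖ ^ 2 / (2 * Real.pi)) ^ 4 =
        ‖q‖ ^ 4 * ((|ω| * ‖q‖) ^ 4 / (2 * Real.pi) ^ 4) := by
      rw [div_pow]; ring
    rw [e2, mul_assoc] at key2
    have key3 := le_of_mul_le_mul_left key2 (by positivity)
    rw [div_mul_eq_mul_div, div_le_iff₀ (by positivity)] at key3
    linarith
  linarith

/-! ### The spectrum of the source -/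

lemma continuous_sourceHat {Ψ : ℝ × Plane → ℝ} (hΨ : Integrable Ψ) :
    Continuous (fun p : ℝ × Plane => sourceHat Ψ p.1 p.2) := by
  unfold sourceHat
  refine continuous_of_dominated (bound := fun p => ‖Ψ p‖) ?_ ?_ hΨ.norm ?_
  · intro x
    refine hΨ.ofReal.1.mul (Continuous.aestronglyMeasurable ?_)
    fun_prop
  · intro x
    filter_upwards with p
    rw [norm_mul, Complex.norm_exp_I_mul_ofReal, mul_one, Complex.norm_real]
  · filter_upwards with p
    fun_prop

/-- The spectrum of an admissible source lies in a band `a ≤ |ω| ≤ b` and in a ball of slowness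
vectors. -/
lemma IsSource.exists_band {Ψ : ℝ × Plane → ℝ} (hΨ : IsSource Ψ) : ∃ a b : ℝ, 0 < a ∧ 0 < b ∧
    ∀ ω q, sourceHat Ψ ω q ≠ 0 → a ≤ |ω| ∧ |ω| ≤ b ∧ ‖q‖ ≤ b := by
  obtain ⟨a, ha, h⟩ := hΨ.noLowFreq
  obtain ⟨b, hb⟩ := hΨ.compactSupport.isCompact.isBounded.exists_norm_le
  refine ⟨a, max b 1, ha, by positivity, fun ω q hne => ⟨?_, ?_⟩⟩
  · by_contra hlt
    exact hne (h ω q (not_le.mp hlt))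
  · have : ((ω, q) : ℝ × Plane) ∈ tsupport (fun p : ℝ × Plane => sourceHat Ψ p.1 p.2) :=
      subset_tsupport _ hne
    have h2 := hb _ this
    rw [Prod.norm_def] at h2
    exact ⟨(le_max_left _ _).trans (h2.trans (le_max_left _ _)),
      (le_max_right _ _).trans (h2.trans (le_max_left _ _))⟩

lemma Medium.continuous_quadForm (M : Medium) : Continuous M.quadForm := by
  unfold Medium.quadForm
  fun_prop

lemma Medium.continuous_hatU₀ (M : Medium) :
    Continuous (fun p : ℝ × Plane × ℝ => M.hatU₀ p.1 p.2.1 p.2.2) := by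
  have := M.continuous_quadForm
  unfold Medium.hatU₀
  fun_prop

lemma Medium.norm_hatU₀ (M : Medium) (ω : ℝ) (q : Plane) (z : ℝ) : ‖M.hatU₀ ω q z‖ = 1 :=
  norm_exp_neg_I_mul_ofReal _

/-- The amplitude `Û₀ Ψ̂` of the wave that reaches the interface. -/
noncomputable def incidentAmplitude (M : Medium) (Ψ : ℝ × Plane → ℝ) (ω : ℝ) (q : Plane) : ℂ :=
  M.hatU₀ ω q M.zint * sourceHat Ψ ω q

lemma continuous_incidentAmplitude (M : Medium) {Ψ : ℝ × Plane → ℝ} (hΨ : Integrable Ψ) :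
    Continuous (fun p : ℝ × Plane => incidentAmplitude M Ψ p.1 p.2) := by
  have h1 := continuous_sourceHat hΨ
  have h2 : Continuous (fun p : ℝ × Plane => M.hatU₀ p.1 p.2 M.zint) :=
    M.continuous_hatU₀.comp (by fun_prop : Continuous fun p : ℝ × Plane => (p.1, p.2, M.zint))
  exact h2.mul h1

/-! ### Decaying amplitudes and the energy estimate at the interface -/

/-- The frequency band `a ≤ |ω| ≤ b`. -/
def band (a b : ℝ) : Set ℝ := {ω | a ≤ |ω| ∧ |ω| ≤ b}

lemma measurableSet_band (a b : ℝ) : MeasurableSet (band a b) :=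
  measurableSet_Icc.preimage (continuous_abs (G := ℝ)).measurable

lemma volume_band_lt_top (a b : ℝ) : volume (band a b) < ⊤ := by
  refine (measure_mono (t := Set.Icc (-b) b) fun ω hω => abs_le.mp hω.2).trans_lt ?_
  exact measure_Icc_lt_top

/-- Lebesgue measure on the frequencies of the band and all of the plane. -/
noncomputable def bandMeasure (a b : ℝ) : Measure (ℝ × Plane) :=
  ((volume : Measure ℝ).restrict (band a b)).prod volume

/-- An integrable and square integrable weight on the plane. -/
noncomputable def decay (a : ℝ) (q : Plane) : ℝ := (1 + (a * ‖q‖) ^ 4)⁻¹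

lemma decay_nonneg (a : ℝ) (q : Plane) : 0 ≤ decay a q := by unfold decay; positivity

lemma decay_le_one (a : ℝ) (q : Plane) : decay a q ≤ 1 := by
  refine inv_le_one_of_one_le₀ ?_
  have : 0 ≤ (a * ‖q‖) ^ 4 := by positivity
  linarith

lemma continuous_decay (a : ℝ) : Continuous (decay a) := by
  unfold decay
  refine Continuous.inv₀ (by fun_prop) fun q => ?_
  positivity

lemma integrable_decay {a : ℝ} (ha : 0 < a) : Integrable (decay a) := by
  have h1 : Integrable (fun q : Plane => (1 + ‖q‖) ^ (-(4 : ℝ))) :=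
    integrable_one_add_norm (by rw [finrank_euclideanSpace_fin]; norm_num)
  have h2 := (h1.comp_smul ha.ne').const_mul 8
  refine h2.mono' (continuous_decay a).aestronglyMeasurable ?_
  filter_upwards with q
  rw [Real.norm_of_nonneg (decay_nonneg a q), norm_smul, Real.norm_of_nonneg ha.le, decay,
    Real.rpow_neg (by positivity), show (4 : ℝ) = ((4 : ℕ) : ℝ) by norm_num, Real.rpow_natCast]
  have ht : 0 ≤ a * ‖q‖ := by positivity
  set t := a * ‖q‖
  rw [inv_eq_one_div, ← div_eq_mul_inv, div_le_div_iff₀ (by positivity) (by positivity)]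
  nlinarith [sq_nonneg (t ^ 2 - 1), sq_nonneg (t - 1), sq_nonneg (t ^ 2 - t),
    sq_nonneg (t ^ 2 - 2 * t + 1), mul_nonneg ht (sq_nonneg (t - 1))]

lemma lintegral_decay_lt_top {a : ℝ} (ha : 0 < a) :
    ∫⁻ q, ENNReal.ofReal (decay a q) < ⊤ := by
  have := (integrable_decay ha).2
  rw [hasFiniteIntegral_iff_ofReal (Eventually.of_forall (decay_nonneg a))] at this
  exact this

/-- Amplitudes `A(ω, q)` that are jointly measurable and, for `|ω| ≥ a`, bounded by `K` times the
weight `decay a`. -/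
structure IsDecaying (a K : ℝ) (A : ℝ → Plane → ℂ) : Prop where
  measurable : Measurable (fun p : ℝ × Plane => A p.1 p.2)
  bound : ∀ ω q, a ≤ |ω| → ‖A ω q‖ ≤ K * decay a q

namespace IsDecaying

variable {a b K : ℝ} {A : ℝ → Plane → ℂ}

lemma measurable_apply (hA : IsDecaying a K A) (ω : ℝ) : Measurable (A ω) :=
  hA.measurable.comp (by fun_prop : Measurable fun q : Plane => (ω, q))

lemma integrable (hA : IsDecaying a K A) (ha : 0 < a) {ω : ℝ} (hω : a ≤ |ω|) :
    Integrable (A ω) := by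
  refine ((integrable_decay ha).const_mul K).mono' (hA.measurable_apply ω).aestronglyMeasurable ?_
  filter_upwards with q using hA.bound ω q hω

lemma nonneg (hA : IsDecaying a K A) : 0 ≤ K := by
  have h := (norm_nonneg _).trans (hA.bound |a| 0 (by rw [abs_abs]; exact le_abs_self a))
  simpa [decay] using h

lemma norm_sq_le (hA : IsDecaying a K A) {ω : ℝ} (hω : a ≤ |ω|) (q : Plane) :
    ‖A ω q‖ ^ 2 ≤ K ^ 2 * decay a q := by
  have h0 := decay_nonneg a q
  have h1 := decay_le_one a q
  have hK := hA.nonneg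
  calc ‖A ω q‖ ^ 2 ≤ (K * decay a q) ^ 2 := by gcongr; exact hA.bound ω q hω
    _ = K ^ 2 * (decay a q * decay a q) := by ring
    _ ≤ K ^ 2 * decay a q := by gcongr; nlinarith

lemma memLp_two (hA : IsDecaying a K A) (ha : 0 < a) {ω : ℝ} (hω : a ≤ |ω|) :
    MemLp (A ω) 2 := by
  rw [memLp_two_iff_integrable_sq_norm (hA.measurable_apply ω).aestronglyMeasurable]
  refine ((integrable_decay ha).const_mul (K ^ 2)).mono'
    ((hA.measurable_apply ω).norm.pow_const 2).aestronglyMeasurable ?_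
  filter_upwards with q
  rw [Real.norm_of_nonneg (by positivity)]
  exact hA.norm_sq_le hω q

lemma sub {K' : ℝ} {B : ℝ → Plane → ℂ} (hA : IsDecaying a K A) (hB : IsDecaying a K' B) :
    IsDecaying a (K + K') (fun ω q => A ω q - B ω q) where
  measurable := hA.measurable.sub hB.measurable
  bound ω q hω := by
    refine (norm_sub_le _ _).trans ?_
    rw [add_mul]
    exact add_le_add (hA.bound ω q hω) (hB.bound ω q hω)

/-- Multiplication by the propagator preserves decaying amplitudes. -/
lemma mul_hatU₀ (hA : IsDecaying a K A) (M : Medium) (z : ℝ) :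
    IsDecaying a K (fun ω q => A ω q * M.hatU₀ ω q z) where
  measurable := hA.measurable.mul
    (M.continuous_hatU₀.comp
      (by fun_prop : Continuous fun p : ℝ × Plane => (p.1, p.2, z))).measurable
  bound ω q hω := by
    rw [norm_mul, M.norm_hatU₀, mul_one]
    exact hA.bound ω q hω

/-- The energy of a decaying amplitude in the band, as a bound by `K²`. -/
lemma lintegral_sq_le (hA : IsDecaying a K A) (b : ℝ) :
    ∫⁻ p, ‖A p.1 p.2‖ₑ ^ 2 ∂(bandMeasure a b) ≤
      ENNReal.ofReal (K ^ 2) * (volume (band a b) * ∫⁻ q, ENNReal.ofReal (decay a q)) := by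
  have h1 : ∫⁻ p, ‖A p.1 p.2‖ₑ ^ 2 ∂(bandMeasure a b) =
      ∫⁻ ω in band a b, ∫⁻ q, ‖A ω q‖ₑ ^ 2 :=
    lintegral_prod _ (hA.measurable.enorm.pow_const 2).aemeasurable
  have h2 : ∀ ω ∈ band a b, ∫⁻ q, ‖A ω q‖ₑ ^ 2 ≤
      ENNReal.ofReal (K ^ 2) * ∫⁻ q, ENNReal.ofReal (decay a q) := by
    intro ω hω
    rw [← lintegral_const_mul' _ _ ENNReal.ofReal_ne_top]
    refine lintegral_mono fun q => ?_
    rw [← ENNReal.ofReal_mul (by positivity), ← ofReal_norm, ← ENNReal.ofReal_pow (norm_nonneg _)]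
    exact ENNReal.ofReal_le_ofReal (hA.norm_sq_le hω.1 q)
  rw [h1]
  refine (setLIntegral_mono' (measurableSet_band a b) h2).trans_eq ?_
  rw [setLIntegral_const]
  ring

lemma lintegral_sq_lt_top (hA : IsDecaying a K A) (ha : 0 < a) (b : ℝ) :
    ∫⁻ p, ‖A p.1 p.2‖ₑ ^ 2 ∂(bandMeasure a b) < ⊤ :=
  (hA.lintegral_sq_le b).trans_lt <| ENNReal.mul_lt_top ENNReal.ofReal_lt_top <|
    ENNReal.mul_lt_top (volume_band_lt_top a b) (lintegral_decay_lt_top ha)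

lemma measurable_planeWaves (hA : IsDecaying a K A) (σ : ℝ) :
    Measurable (fun p : ℝ × Plane => planeWaves (σ * p.1) (A p.1) p.2) := by
  unfold planeWaves
  refine StronglyMeasurable.measurable ?_
  refine StronglyMeasurable.integral_prod_right
    (f := fun (p : ℝ × Plane) (q : Plane) => A p.1 q *
      Complex.exp (-Complex.I * ((σ * p.1 * inner ℝ q p.2 : ℝ) : ℂ))) ?_
  refine Measurable.stronglyMeasurable (Measurable.mul ?_ (Continuous.measurable ?_))
  · exact hA.measurable.comp
      (by fun_prop : Measurable fun x : (ℝ × Plane) × Plane => (x.1.1, x.2))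
  · fun_prop

/-- By Plancherel's theorem, the energy of the wave at the interface is controlled by the energy of
the amplitude. -/
lemma lintegral_planeWaves_sq_le (hA : IsDecaying a K A) (ha : 0 < a) (b : ℝ) {σ : ℝ}
    (hσ : σ ^ 2 = 1) :
    ∫⁻ p, ‖planeWaves (σ * p.1) (A p.1) p.2‖ₑ ^ 2 ∂(bandMeasure a b) ≤
      ENNReal.ofReal ((2 * Real.pi / a) ^ 2) * ∫⁻ p, ‖A p.1 p.2‖ₑ ^ 2 ∂(bandMeasure a b) := by
  have h1 : ∫⁻ p, ‖A p.1 p.2‖ₑ ^ 2 ∂(bandMeasure a b) =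
      ∫⁻ ω in band a b, ∫⁻ q, ‖A ω q‖ₑ ^ 2 :=
    lintegral_prod _ (hA.measurable.enorm.pow_const 2).aemeasurable
  have h2 : ∫⁻ p, ‖planeWaves (σ * p.1) (A p.1) p.2‖ₑ ^ 2 ∂(bandMeasure a b) =
      ∫⁻ ω in band a b, ∫⁻ x, ‖planeWaves (σ * ω) (A ω) x‖ₑ ^ 2 :=
    lintegral_prod _ ((hA.measurable_planeWaves σ).enorm.pow_const 2).aemeasurable
  rw [h1, h2, ← lintegral_const_mul' _ _ ENNReal.ofReal_ne_top]
  refine setLIntegral_mono' (measurableSet_band a b) fun ω hω => ?_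
  have hσ0 : σ ≠ 0 := by rintro rfl; norm_num at hσ
  have hω0 : ω ≠ 0 := by
    rintro rfl
    have := hω.1
    rw [abs_zero] at this
    linarith
  rw [lintegral_enorm_sq_planeWaves (mul_ne_zero hσ0 hω0) (hA.integrable ha hω.1)
    (hA.memLp_two ha hω.1)]
  gcongr ENNReal.ofReal ?_ * _
  rw [div_pow, div_pow, mul_pow σ, hσ, one_mul]
  have : a ^ 2 ≤ ω ^ 2 := by rw [← sq_abs ω]; exact pow_le_pow_left₀ ha.le hω.1 2
  gcongr

end IsDecaying

lemma IsSource.incidentAmplitude_isDecaying {Ψ : ℝ × Plane → ℝ} (hΨ : IsSource Ψ) (M : Medium)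
    {a : ℝ} : ∃ K, IsDecaying a K (incidentAmplitude M Ψ) := by
  have hc := continuous_incidentAmplitude M hΨ.integrable
  have hs0 : HasCompactSupport (fun p : ℝ × Plane => incidentAmplitude M Ψ p.1 p.2) :=
    hΨ.compactSupport.mono fun p hp => right_ne_zero_of_mul hp
  have hs : HasCompactSupport (fun p : ℝ × Plane =>
      (1 + (a * ‖p.2‖) ^ 4 : ℝ) • incidentAmplitude M Ψ p.1 p.2) :=
    hs0.mono fun p hp => right_ne_zero_of_smul hp
  obtain ⟨K, hK⟩ := hs.exists_bound_of_continuous (by fun_prop)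
  refine ⟨K, hc.measurable, fun ω q _ => ?_⟩
  have := hK (ω, q)
  rw [norm_smul, Real.norm_of_nonneg (by positivity)] at this
  rw [decay, ← div_eq_mul_inv, le_div_iff₀ (by positivity)]
  linarith

/-- The density `ω⁴/(2π)² T_A(ω, x) I(ω, x)` in frequency and position at the interface, where `T_A`
is the plane wave superposition of the amplitude `A` of the observation and `I` the incident wave.
The pairing of the reflected wave is the integral of this density against the phase of the rough
interface. -/
noncomputable def interfaceDensity (M : Medium) (Ψ : ℝ × Plane → ℝ) (A : ℝ → Plane → ℂ)
    (p : ℝ × Plane) : ℂ :=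
  ((p.1 ^ 4 / (2 * Real.pi) ^ 2 : ℝ) : ℂ) * planeWaves p.1 (A p.1) p.2 *
    planeWaves (-p.1) (incidentAmplitude M Ψ p.1) p.2

lemma interfaceDensity_eq_zero {M : Medium} {Ψ : ℝ × Plane → ℝ} {A : ℝ → Plane → ℂ} {a b : ℝ}
    (hab : ∀ ω q, sourceHat Ψ ω q ≠ 0 → a ≤ |ω| ∧ |ω| ≤ b ∧ ‖q‖ ≤ b) {p : ℝ × Plane}
    (hp : p.1 ∉ band a b) : interfaceDensity M Ψ A p = 0 := by
  have h : ∀ q, incidentAmplitude M Ψ p.1 q = 0 := by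
    intro q
    by_contra hne
    have h2 := hab p.1 q (right_ne_zero_of_mul hne)
    exact hp ⟨h2.1, h2.2.1⟩
  simp [interfaceDensity, planeWaves, h]

lemma measurable_interfaceDensity (M : Medium) {Ψ : ℝ × Plane → ℝ} (hΨ : IsSource Ψ)
    {A : ℝ → Plane → ℂ} {a K : ℝ} (hA : IsDecaying a K A) :
    Measurable (interfaceDensity M Ψ A) := by
  obtain ⟨K', hI⟩ := hΨ.incidentAmplitude_isDecaying M (a := a)
  have h1 := hA.measurable_planeWaves 1
  have h2 := hI.measurable_planeWaves (-1)
  simp only [one_mul, neg_one_mul] at h1 h2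
  exact ((by fun_prop : Measurable fun p : ℝ × Plane =>
    ((p.1 ^ 4 / (2 * Real.pi) ^ 2 : ℝ) : ℂ)).mul h1).mul h2

/-- The energy estimate: the `L¹` norm of the interface density is bounded by the `L²` norm of the
amplitude in the band. This is the Cauchy–Schwarz inequality for the two wave fields, followed by
Plancherel's theorem for each of them. -/
lemma exists_lintegral_interfaceDensity_le (M : Medium) {Ψ : ℝ × Plane → ℝ} (hΨ : IsSource Ψ)
    {a b : ℝ} (ha : 0 < a)
    (hab : ∀ ω q, sourceHat Ψ ω q ≠ 0 → a ≤ |ω| ∧ |ω| ≤ b ∧ ‖q‖ ≤ b) :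
    ∃ C : ENNReal, C < ⊤ ∧ ∀ (K : ℝ) (A : ℝ → Plane → ℂ), IsDecaying a K A →
      ∫⁻ p, ‖interfaceDensity M Ψ A p‖ₑ ≤
        C * (∫⁻ p, ‖A p.1 p.2‖ₑ ^ 2 ∂(bandMeasure a b)) ^ (1 / 2 : ℝ) := by
  obtain ⟨K', hI⟩ := hΨ.incidentAmplitude_isDecaying M (a := a)
  set c : ENNReal := ENNReal.ofReal ((2 * Real.pi / a) ^ 2) with hc
  set c2 : ENNReal := ENNReal.ofReal (b ^ 4 / (2 * Real.pi) ^ 2) with hc2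
  set G : ENNReal := ∫⁻ p, ‖incidentAmplitude M Ψ p.1 p.2‖ₑ ^ 2 ∂(bandMeasure a b) with hG
  have hGt : G < ⊤ := hI.lintegral_sq_lt_top ha b
  refine ⟨c2 * (c ^ (1 / 2 : ℝ) * (c * G) ^ (1 / 2 : ℝ)), ?_, fun K A hA => ?_⟩
  · refine ENNReal.mul_lt_top ENNReal.ofReal_lt_top (ENNReal.mul_lt_top ?_ ?_)
    · exact ENNReal.rpow_lt_top_of_nonneg (by norm_num) ENNReal.ofReal_ne_top
    · exact ENNReal.rpow_lt_top_of_nonneg (by norm_num)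
        (ENNReal.mul_lt_top ENNReal.ofReal_lt_top hGt).ne
  · set E : ENNReal := ∫⁻ p, ‖A p.1 p.2‖ₑ ^ 2 ∂(bandMeasure a b) with hE
    have hA1 := hA.measurable_planeWaves 1
    have hI1 := hI.measurable_planeWaves (-1)
    have hA2 := hA.lintegral_planeWaves_sq_le ha b (σ := 1) (by norm_num)
    have hI2 := hI.lintegral_planeWaves_sq_le ha b (σ := -1) (by norm_num)
    have h1 : ∫⁻ p, ‖interfaceDensity M Ψ A p‖ₑ =
        ∫⁻ p, ‖interfaceDensity M Ψ A p‖ₑ ∂(bandMeasure a b) := by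
      have : bandMeasure a b = (volume : Measure (ℝ × Plane)).restrict (band a b ×ˢ Set.univ) := by
        have h := Measure.prod_restrict (μ := (volume : Measure ℝ)) (ν := (volume : Measure Plane))
          (band a b) Set.univ
        rw [Measure.restrict_univ] at h
        exact h
      rw [this, ← lintegral_indicator ((measurableSet_band a b).prod MeasurableSet.univ)]
      refine lintegral_congr fun p => ?_
      by_cases hp : p.1 ∈ band a b
      · rw [Set.indicator_of_mem (by exact ⟨hp, trivial⟩)]
      · rw [Set.indicator_of_notMem (fun h => hp h.1), interfaceDensity_eq_zero hab hp, enorm_zero]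
    have h2 : ∫⁻ p, ‖interfaceDensity M Ψ A p‖ₑ ∂(bandMeasure a b) ≤
        c2 * ∫⁻ p, ((fun p : ℝ × Plane => ‖planeWaves (1 * p.1) (A p.1) p.2‖ₑ) *
          (fun p : ℝ × Plane => ‖planeWaves (-1 * p.1) (incidentAmplitude M Ψ p.1) p.2‖ₑ)) p
            ∂(bandMeasure a b) := by
      rw [← lintegral_const_mul' _ _ ENNReal.ofReal_ne_top]
      have hae : ∀ᵐ p ∂(bandMeasure a b), p.1 ∈ band a b := by
        have := (Measure.quasiMeasurePreserving_fst (μ := volume.restrict (band a b))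
          (ν := (volume : Measure Plane))).ae (ae_restrict_mem (measurableSet_band a b))
        exact this
      refine lintegral_mono_ae ?_
      filter_upwards [hae] with p hp
      simp only [interfaceDensity, Pi.mul_apply, one_mul, neg_one_mul, enorm_mul, mul_assoc]
      gcongr
      rw [← ofReal_norm, Complex.norm_real, Real.norm_of_nonneg (by positivity)]
      refine ENNReal.ofReal_le_ofReal ?_
      have : p.1 ^ 4 ≤ b ^ 4 := by
        rw [← (by norm_num : Even 4).pow_abs p.1]
        exact pow_le_pow_left₀ (abs_nonneg _) hp.2 4
      gcongr
    rw [h1]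
    refine h2.trans ?_
    rw [mul_assoc]
    gcongr
    refine (ENNReal.lintegral_mul_le_Lp_mul_Lq _ Real.HolderConjugate.two_two
      hA1.enorm.aemeasurable hI1.enorm.aemeasurable).trans ?_
    simp only [ENNReal.rpow_ofNat]
    calc _ ≤ (c * E) ^ (1 / 2 : ℝ) * (c * G) ^ (1 / 2 : ℝ) := by gcongr
      _ = _ := by
        rw [ENNReal.mul_rpow_of_nonneg c E (by norm_num)]
        ring

/-! ### The density of the reflected wave at the interface -/

lemma IsSource.hasCompactSupport_incidentAmplitude {Ψ : ℝ × Plane → ℝ} (hΨ : IsSource Ψ)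
    (M : Medium) : HasCompactSupport (fun p : ℝ × Plane => incidentAmplitude M Ψ p.1 p.2) :=
  hΨ.compactSupport.mono fun _ hp => right_ne_zero_of_mul hp

section Density

variable {M : Medium} {Ψ : ℝ × Plane → ℝ} {a b K K' : ℝ} {A B : ℝ → Plane → ℂ}

lemma integrable_interfaceDensity (hΨ : IsSource Ψ) (ha : 0 < a)
    (hab : ∀ ω q, sourceHat Ψ ω q ≠ 0 → a ≤ |ω| ∧ |ω| ≤ b ∧ ‖q‖ ≤ b) (hA : IsDecaying a K A) :
    Integrable (interfaceDensity M Ψ A) := by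
  obtain ⟨C, hC, h⟩ := exists_lintegral_interfaceDensity_le M hΨ ha hab
  refine ⟨(measurable_interfaceDensity M hΨ hA).aestronglyMeasurable, (h K A hA).trans_lt ?_⟩
  exact ENNReal.mul_lt_top hC (ENNReal.rpow_lt_top_of_nonneg (by norm_num)
    (hA.lintegral_sq_lt_top ha b).ne)

/-- The `L¹` norm of the interface density is at most a constant times the decay constant of the
amplitude. -/
lemma exists_integral_norm_interfaceDensity_le (M : Medium) (hΨ : IsSource Ψ) (ha : 0 < a)
    (hab : ∀ ω q, sourceHat Ψ ω q ≠ 0 → a ≤ |ω| ∧ |ω| ≤ b ∧ ‖q‖ ≤ b) :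
    ∃ C : ℝ, 0 ≤ C ∧ ∀ (K : ℝ) (A : ℝ → Plane → ℂ), IsDecaying a K A →
      ∫ p, ‖interfaceDensity M Ψ A p‖ ≤ C * K := by
  obtain ⟨C, hC, h⟩ := exists_lintegral_interfaceDensity_le M hΨ ha hab
  set D := volume (band a b) * ∫⁻ q, ENNReal.ofReal (decay a q) with hD
  have hDt : D < ⊤ := ENNReal.mul_lt_top (volume_band_lt_top a b) (lintegral_decay_lt_top ha)
  have hD2 : D ^ (1 / 2 : ℝ) < ⊤ := ENNReal.rpow_lt_top_of_nonneg (by norm_num) hDt.ne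
  refine ⟨(C * D ^ (1 / 2 : ℝ)).toReal, ENNReal.toReal_nonneg, fun K A hA => ?_⟩
  have hK := hA.nonneg
  rw [integral_norm_eq_lintegral_enorm (measurable_interfaceDensity M hΨ hA).aestronglyMeasurable]
  refine ENNReal.toReal_le_of_le_ofReal (by positivity) ((h K A hA).trans ?_)
  rw [ENNReal.ofReal_mul ENNReal.toReal_nonneg,
    ENNReal.ofReal_toReal (ENNReal.mul_lt_top hC hD2).ne, mul_assoc]
  gcongr
  calc _ ≤ (ENNReal.ofReal (K ^ 2) * D) ^ (1 / 2 : ℝ) := by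
        gcongr; exact hA.lintegral_sq_le b
    _ = D ^ (1 / 2 : ℝ) * ENNReal.ofReal K := by
        rw [ENNReal.mul_rpow_of_nonneg _ _ (by norm_num),
          ENNReal.ofReal_rpow_of_nonneg (by positivity) (by norm_num), ← Real.sqrt_eq_rpow,
          Real.sqrt_sq hK, mul_comm]

lemma interfaceDensity_sub (ha : 0 < a)
    (hab : ∀ ω q, sourceHat Ψ ω q ≠ 0 → a ≤ |ω| ∧ |ω| ≤ b ∧ ‖q‖ ≤ b) (hA : IsDecaying a K A)
    (hB : IsDecaying a K' B) (p : ℝ × Plane) :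
    interfaceDensity M Ψ (fun ω q => A ω q - B ω q) p =
      interfaceDensity M Ψ A p - interfaceDensity M Ψ B p := by
  by_cases hp : p.1 ∈ band a b
  · have hpw : planeWaves p.1 (fun q => A p.1 q - B p.1 q) p.2 =
        planeWaves p.1 (A p.1) p.2 - planeWaves p.1 (B p.1) p.2 := by
      unfold planeWaves
      have hi : ∀ {f : Plane → ℂ}, Integrable f → Integrable (fun q => f q *
          Complex.exp (-Complex.I * ((p.1 * inner ℝ q p.2 : ℝ) : ℂ))) := by
        intro f hf
        refine hf.mul_bdd (c := 1) (Continuous.aestronglyMeasurable (by fun_prop)) ?_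
        filter_upwards with q
        rw [norm_exp_neg_I_mul_ofReal]
      rw [← integral_sub (hi (hA.integrable ha hp.1)) (hi (hB.integrable ha hp.1))]
      simp_rw [sub_mul]
    rw [interfaceDensity, interfaceDensity, interfaceDensity, hpw]
    ring
  · simp [interfaceDensity_eq_zero hab hp]

lemma interfaceDensity_const_mul (c : ℂ) (p : ℝ × Plane) :
    interfaceDensity M Ψ (fun ω q => c * A ω q) p = c * interfaceDensity M Ψ A p := by
  have hpw : planeWaves p.1 (fun q => c * A p.1 q) p.2 = c * planeWaves p.1 (A p.1) p.2 := by
    unfold planeWaves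
    simp_rw [mul_assoc]
    rw [integral_const_mul]
  rw [interfaceDensity, interfaceDensity, hpw]
  ring

/-- The interface density depends continuously, in `L¹`, on the amplitude: pointwise convergence of
uniformly decaying amplitudes suffices. -/
lemma tendsto_integral_norm_interfaceDensity_sub (hΨ : IsSource Ψ) (ha : 0 < a)
    (hab : ∀ ω q, sourceHat Ψ ω q ≠ 0 → a ≤ |ω| ∧ |ω| ≤ b ∧ ‖q‖ ≤ b)
    {ι : Type*} {l : Filter ι} [l.IsCountablyGenerated] {An : ι → ℝ → Plane → ℂ}
    (hAn : ∀ n, IsDecaying a K (An n)) (hA : IsDecaying a K A)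
    (hlim : ∀ ω q, Tendsto (fun n => An n ω q) l (𝓝 (A ω q))) :
    Tendsto (fun n => ∫ p, ‖interfaceDensity M Ψ (An n) p - interfaceDensity M Ψ A p‖) l
      (𝓝 0) := by
  obtain ⟨C, hC, h⟩ := exists_lintegral_interfaceDensity_le M hΨ ha hab
  have hd : ∀ n, IsDecaying a (K + K) (fun ω q => An n ω q - A ω q) := fun n => (hAn n).sub hA
  have h1 : Tendsto (fun n => ∫⁻ p, ‖An n p.1 p.2 - A p.1 p.2‖ₑ ^ 2 ∂(bandMeasure a b)) l
      (𝓝 0) := by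
    have h0 : ∫⁻ p : ℝ × Plane, (0 : ENNReal) ∂(bandMeasure a b) = 0 := by simp
    rw [← h0]
    refine tendsto_lintegral_filter_of_dominated_convergence
      (fun p => ENNReal.ofReal ((K + K) ^ 2 * decay a p.2)) ?_ ?_ ?_ ?_
    · exact Eventually.of_forall fun n => (hd n).measurable.enorm.pow_const 2
    · refine Eventually.of_forall fun n => ?_
      have hae : ∀ᵐ p ∂(bandMeasure a b), p.1 ∈ band a b :=
        (Measure.quasiMeasurePreserving_fst (μ := volume.restrict (band a b))
          (ν := (volume : Measure Plane))).ae (ae_restrict_mem (measurableSet_band a b))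
      filter_upwards [hae] with p hp
      rw [← ofReal_norm, ← ENNReal.ofReal_pow (norm_nonneg _)]
      exact ENNReal.ofReal_le_ofReal ((hd n).norm_sq_le hp.1 p.2)
    · have hK := hA.nonneg
      rw [bandMeasure, lintegral_prod _ (Continuous.aemeasurable ?_)]
      · simp only [ENNReal.ofReal_mul (sq_nonneg (K + K))]
        rw [lintegral_const_mul' _ _ ENNReal.ofReal_ne_top, setLIntegral_const]
        exact (ENNReal.mul_lt_top (ENNReal.mul_lt_top ENNReal.ofReal_lt_top
          (lintegral_decay_lt_top ha)) (volume_band_lt_top a b)).ne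
      · have := continuous_decay a
        exact ENNReal.continuous_ofReal.comp (by fun_prop)
    · filter_upwards with p
      have : Tendsto (fun n => An n p.1 p.2 - A p.1 p.2) l (𝓝 0) := by
        simpa using (hlim p.1 p.2).sub_const (A p.1 p.2)
      have h2 := (ENNReal.continuous_pow 2).tendsto 0 |>.comp
        ((continuous_enorm.tendsto (0 : ℂ)).comp this |>.trans (by simp))
      simpa [Function.comp_def] using h2
  have h2 : Tendsto (fun n => C * (∫⁻ p, ‖An n p.1 p.2 - A p.1 p.2‖ₑ ^ 2
      ∂(bandMeasure a b)) ^ (1 / 2 : ℝ)) l (𝓝 0) := by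
    have := ENNReal.Tendsto.const_mul ((ENNReal.continuous_rpow_const (y := (1 / 2 : ℝ))).tendsto 0
      |>.comp h1) (Or.inr hC.ne)
    simpa using this
  have h3 : Tendsto (fun n => ∫⁻ p, ‖interfaceDensity M Ψ (fun ω q => An n ω q - A ω q) p‖ₑ) l
      (𝓝 0) :=
    tendsto_of_tendsto_of_tendsto_of_le_of_le tendsto_const_nhds h2 (fun _ => zero_le)
      (fun n => h _ _ (hd n))
  have h4 := (ENNReal.tendsto_toReal ENNReal.zero_ne_top).comp h3
  refine (h4.congr fun n => ?_)
  rw [Function.comp_apply, ← integral_norm_eq_lintegral_enorm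
    (measurable_interfaceDensity M hΨ (hd n)).aestronglyMeasurable]
  simp_rw [interfaceDensity_sub ha hab (hAn n) hA]

lemma integrable_mul_incidentAmplitude (hΨ : IsSource Ψ)
    (hab : ∀ ω q, sourceHat Ψ ω q ≠ 0 → a ≤ |ω| ∧ |ω| ≤ b ∧ ‖q‖ ≤ b) (hA : IsDecaying a K A)
    {m : ℝ → ℂ} (hm : Measurable m) {c : ℝ} (hmc : ∀ ω, ‖m ω‖ ≤ c) :
    Integrable (fun p : ℝ × Plane => m p.1 * ((p.1 ^ 2 : ℝ) : ℂ) *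
      (A p.1 p.2 * incidentAmplitude M Ψ p.1 p.2)) := by
  have hc := continuous_incidentAmplitude M hΨ.integrable
  have hi : Integrable (fun p : ℝ × Plane =>
      ((p.1 ^ 2 : ℝ) : ℂ) * incidentAmplitude M Ψ p.1 p.2) :=
    Continuous.integrable_of_hasCompactSupport (by fun_prop)
      ((hΨ.hasCompactSupport_incidentAmplitude M).mono fun p hp => right_ne_zero_of_mul hp)
  refine (hi.norm.const_mul (c * K)).mono' ?_ ?_
  · exact (((hm.comp measurable_fst).mul (by fun_prop)).mul
      (hA.measurable.mul hc.measurable)).aestronglyMeasurable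
  · filter_upwards with p
    by_cases hz : incidentAmplitude M Ψ p.1 p.2 = 0
    · simp [hz]
    · have hω := (hab p.1 p.2 (right_ne_zero_of_mul hz)).1
      have hK := hA.nonneg
      have h1 : ‖A p.1 p.2‖ ≤ K := (hA.bound p.1 p.2 hω).trans
        (mul_le_of_le_one_right hK (decay_le_one a p.2))
      have hc0 : 0 ≤ c := (norm_nonneg _).trans (hmc p.1)
      rw [norm_mul, norm_mul, norm_mul, norm_mul]
      calc _ = (‖m p.1‖ * ‖A p.1 p.2‖) *
            (‖((p.1 ^ 2 : ℝ) : ℂ)‖ * ‖incidentAmplitude M Ψ p.1 p.2‖) := by ring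
        _ ≤ _ := by gcongr; exact hmc p.1

/-- Against a phase that does not depend on the position, the interface density acts like a mirror:
by Parseval's identity the two wave fields are matched slowness by slowness. -/
lemma integral_mul_interfaceDensity (hΨ : IsSource Ψ) (ha : 0 < a)
    (hab : ∀ ω q, sourceHat Ψ ω q ≠ 0 → a ≤ |ω| ∧ |ω| ≤ b ∧ ‖q‖ ≤ b) (hA : IsDecaying a K A)
    {m : ℝ → ℂ} (hm : Measurable m) {c : ℝ} (hmc : ∀ ω, ‖m ω‖ ≤ c) :
    ∫ p, m p.1 * interfaceDensity M Ψ A p =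
      ∫ p : ℝ × Plane, m p.1 * ((p.1 ^ 2 : ℝ) : ℂ) *
        (A p.1 p.2 * incidentAmplitude M Ψ p.1 p.2) := by
  have hi1 : Integrable (fun p : ℝ × Plane => m p.1 * interfaceDensity M Ψ A p) :=
    (integrable_interfaceDensity hΨ ha hab hA).bdd_mul (c := c)
      (hm.comp measurable_fst).aestronglyMeasurable (Eventually.of_forall fun p => hmc p.1)
  have hi2 := integrable_mul_incidentAmplitude (M := M) hΨ hab hA hm hmc
  rw [show (volume : Measure (ℝ × Plane)) = (volume : Measure ℝ).prod volume from rfl,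
    integral_prod _ hi1, integral_prod _ hi2]
  congr 1
  ext ω
  simp only
  rw [integral_const_mul, integral_const_mul, mul_assoc]
  congr 1
  obtain ⟨K', hI⟩ := hΨ.incidentAmplitude_isDecaying M (a := a)
  by_cases hω : ω ∈ band a b
  · have hω0 : ω ≠ 0 := by
      rintro rfl
      have := hω.1
      rw [abs_zero] at this
      linarith
    simp only [interfaceDensity, mul_assoc]
    rw [integral_const_mul, integral_planeWaves_mul_planeWaves_neg (hA.integrable ha hω.1)
      (hA.memLp_two ha hω.1) (hI.integrable ha hω.1) (hI.memLp_two ha hω.1), ← mul_assoc,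
      ← Complex.ofReal_mul]
    congr 2
    field_simp
  · have h : ∀ q, incidentAmplitude M Ψ ω q = 0 := by
      intro q
      by_contra hne
      have h2 := hab ω q (right_ne_zero_of_mul hne)
      exact hω ⟨h2.1, h2.2.1⟩
    have h2 : ∀ x, interfaceDensity M Ψ A (ω, x) = 0 := fun x =>
      interfaceDensity_eq_zero hab (p := (ω, x)) hω
    simp [h, h2]

end Density

/-! ### The wave pairing as an integral over the interface -/

/-- The amplitude of a test function, propagated from the interface. -/
noncomputable def waveAmplitude (M : Medium) (δ : ℝ) (φ : ObsSpace → ℂ) (ω : ℝ) (q : Plane) : ℂ :=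
  obsAmplitude δ φ ω q * M.hatU₀ ω q M.zint

/-- The wave amplitude decays, with a constant that is a continuous seminorm of the test function
and does not depend on `δ`. -/
lemma exists_waveAmplitude_isDecaying (M : Medium) {a : ℝ} (ha : 0 < a) :
    ∃ (s : Finset (ℕ × ℕ)) (C : ℝ), 0 ≤ C ∧ ∀ (φ : 𝓢(ObsSpace, ℂ)) (δ : ℝ),
      IsDecaying a (C * (s.sup (schwartzSeminormFamily ℂ ObsSpace ℂ)) φ)
        (waveAmplitude M δ φ) := by
  obtain ⟨s, C, hC, h⟩ := exists_obsAmplitude_bound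
  refine ⟨s, C, hC, fun φ δ => IsDecaying.mul_hatU₀ ⟨?_, ?_⟩ M M.zint⟩
  · exact ((continuous_obsAmplitude φ.integrable).comp
      (by fun_prop : Continuous fun p : ℝ × Plane => (δ, p.1, p.2))).measurable
  · intro ω q hω
    rw [decay, ← div_eq_mul_inv, le_div_iff₀ (by positivity)]
    refine le_trans ?_ (h φ δ ω q)
    rw [mul_comm]
    gcongr

lemma tendsto_waveAmplitude (M : Medium) (φ : 𝓢(ObsSpace, ℂ)) (ω : ℝ) (q : Plane)
    {ι : Type*} {l : Filter ι} {δ : ι → ℝ} (hδ : Tendsto δ l (𝓝 0)) :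
    Tendsto (fun n => waveAmplitude M (δ n) φ ω q) l (𝓝 (waveAmplitude M 0 φ ω q)) := by
  have h := ((continuous_obsAmplitude φ.integrable).comp
      (by fun_prop : Continuous fun d : ℝ => (d, ω, q))).tendsto 0
  exact (h.comp hδ).mul_const _

/-- The phase of the wave reflected by the rough interface, in the variable
`x = (x' - x_int)/√ε`. -/
noncomputable def roughPhase (M : Medium) (v : Plane → ℝ) (γ ε : ℝ) (p : ℝ × Plane) : ℂ :=
  Complex.exp (Complex.I *
    ((p.1 * (2 * M.s₀) * v ((ε ^ γ)⁻¹ • (M.xint + √ε • p.2)) : ℝ) : ℂ))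

lemma norm_roughPhase (M : Medium) (v : Plane → ℝ) (γ ε : ℝ) (p : ℝ × Plane) :
    ‖roughPhase M v γ ε p‖ = 1 := Complex.norm_exp_I_mul_ofReal _

/-- In the variable `x = (x' - x_int)/√ε` the Jacobian `ε` cancels the prefactor `1/ε`. -/
lemma scatteringForm_eq (M : Medium) (v : Plane → ℝ) (γ : ℝ) {ε : ℝ} (hε : 0 < ε) (ω : ℝ)
    (f g : Plane → ℂ) :
    scatteringForm M v γ ε (2 * M.s₀) ω f g =
      ((ω ^ 2 / (2 * Real.pi) ^ 2 : ℝ) : ℂ) *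
        ∫ x, roughPhase M v γ ε (ω, x) * (planeWaves ω f x * planeWaves (-ω) g x) := by
  have hs : √ε ≠ 0 := (Real.sqrt_pos.mpr hε).ne'
  set F : Plane → ℂ := fun x' =>
    Complex.exp (Complex.I * ((ω * (2 * M.s₀) * v ((ε ^ γ)⁻¹ • x') : ℝ) : ℂ)) *
      (∫ q : Plane, f q *
        Complex.exp (-Complex.I * ((ω * inner ℝ q (x' - M.xint) / √ε : ℝ) : ℂ))) *
      (∫ q' : Plane, g q' *
        Complex.exp (Complex.I * ((ω * inner ℝ q' (x' - M.xint) / √ε : ℝ) : ℂ))) with hF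
  have h1 : ∀ x, roughPhase M v γ ε (ω, x) * (planeWaves ω f x * planeWaves (-ω) g x) =
      F (M.xint + √ε • x) := by
    intro x
    have h4 : ∀ q : Plane, ω * inner ℝ q (√ε • x) / √ε = ω * inner ℝ q x := fun q => by
      rw [inner_smul_right]
      field_simp
    simp only [hF, roughPhase, planeWaves, add_sub_cancel_left, h4, mul_assoc]
    congr 3
    ext q
    congr 2
    push_cast
    ring
  have h2 : ∫ x, F (M.xint + √ε • x) = ((ε⁻¹ : ℝ) : ℂ) * ∫ x, F x := by
    have h3 := Measure.integral_comp_smul (volume : Measure Plane) (fun x => F (M.xint + x)) √ε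
    rw [integral_add_left_eq_self F M.xint, finrank_euclideanSpace_fin, Real.sq_sqrt hε.le,
      abs_of_pos (by positivity), Complex.real_smul] at h3
    exact h3
  simp_rw [h1]
  rw [h2]
  change ((ω ^ 2 / (ε * (2 * Real.pi) ^ 2) : ℝ) : ℂ) * ∫ x, F x = _
  rw [← mul_assoc, ← Complex.ofReal_mul]
  congr 2
  field_simp

lemma measurable_roughPhase (M : Medium) {v : Plane → ℝ} (hv : Continuous v) (γ ε : ℝ) :
    Measurable (roughPhase M v γ ε) := by
  unfold roughPhase
  exact Continuous.measurable (by fun_prop)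

/-- The rough interface enters the pairing only through a bounded phase. -/
lemma wavePairing_eq (M : Medium) {Ψ : ℝ × Plane → ℝ} (hΨ : IsSource Ψ) {v : Plane → ℝ}
    (hv : Continuous v) (γ : ℝ) {ε : ℝ} (hε : 0 < ε) (φ : 𝓢(ObsSpace, ℂ)) :
    wavePairing M Ψ v γ ε φ = ((M.reflCoef / (2 * (2 * Real.pi) ^ 3) : ℝ) : ℂ) *
      ∫ p, roughPhase M v γ ε p *
        interfaceDensity M Ψ (waveAmplitude M (ε ^ (γ - 1 / 2)) φ) p := by
  obtain ⟨a, b, ha, hb, hab⟩ := hΨ.exists_band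
  obtain ⟨s, C, hC, hdec⟩ := exists_waveAmplitude_isDecaying M ha
  have hi : Integrable (fun p => roughPhase M v γ ε p *
        interfaceDensity M Ψ (waveAmplitude M (ε ^ (γ - 1 / 2)) φ) p) :=
    (integrable_interfaceDensity hΨ ha hab (hdec φ _)).bdd_mul (c := 1)
      (measurable_roughPhase M hv γ ε).aestronglyMeasurable
      (Eventually.of_forall fun p => (norm_roughPhase M v γ ε p).le)
  rw [wavePairing, show (volume : Measure (ℝ × Plane)) = (volume : Measure ℝ).prod volume from rfl,
    integral_prod _ hi]
  congr 2
  ext ω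
  rw [scatteringForm_eq M v γ hε]
  simp only [testAmplitude_eq_obsAmplitude M hε]
  refine (mul_assoc _ _ _).symm.trans ?_
  rw [← Complex.ofReal_mul, ← integral_const_mul]
  refine integral_congr_ae (Eventually.of_forall fun x => ?_)
  have h1 : planeWaves ω (fun q => obsAmplitude (ε ^ (γ - 1 / 2)) φ ω q * M.hatU₀ ω q M.zint) x =
      planeWaves ω (waveAmplitude M (ε ^ (γ - 1 / 2)) φ ω) x := rfl
  have h2 : planeWaves (-ω) (fun q' => M.hatU₀ ω q' M.zint * sourceHat Ψ ω q') x =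
      planeWaves (-ω) (incidentAmplitude M Ψ ω) x := rfl
  beta_reduce
  rw [interfaceDensity, h1, h2,
    show ω ^ 2 * (ω ^ 2 / (2 * Real.pi) ^ 2) = ω ^ 4 / (2 * Real.pi) ^ 2 by ring]
  ring

/-! ### Decorrelation of the phases of a mixing field -/

section Mixing

variable {Ω : Type*} [MeasurableSpace Ω] {μ : Measure Ω}

/-- If two finite measures differ by at most `c` on the superlevel sets of a function with values in
`[0, 1]`, then its integrals differ by at most `c`. -/
lemma abs_integral_sub_integral_le_of_superlevel {ν₁ ν₂ : Measure Ω} [IsFiniteMeasure ν₁]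
    [IsFiniteMeasure ν₂] {X : Ω → ℝ} (hX : Measurable X) (h0 : ∀ w, 0 ≤ X w) (h1 : ∀ w, X w ≤ 1)
    {c : ℝ} (hc : ∀ t, |ν₁.real {w | t ≤ X w} - ν₂.real {w | t ≤ X w}| ≤ c) :
    |∫ w, X w ∂ν₁ - ∫ w, X w ∂ν₂| ≤ c := by
  have hint : ∀ (ν : Measure Ω) [IsFiniteMeasure ν], Integrable X ν := fun ν _ =>
    Integrable.of_bound hX.aestronglyMeasurable 1
      (Eventually.of_forall fun w => by rw [Real.norm_of_nonneg (h0 w)]; exact h1 w)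
  have hlc : ∀ (ν : Measure Ω) [IsFiniteMeasure ν],
      ∫ w, X w ∂ν = ∫ t in Set.Ioc (0 : ℝ) 1, ν.real {w | t ≤ X w} := fun ν _ =>
    (hint ν).integral_eq_integral_Ioc_meas_le (Eventually.of_forall h0) (Eventually.of_forall h1)
  have hti : ∀ (ν : Measure Ω) [IsFiniteMeasure ν],
      IntegrableOn (fun t : ℝ => ν.real {w | t ≤ X w}) (Set.Ioc 0 1) := by
    intro ν _
    have hanti : Antitone (fun t : ℝ => ν.real {w | t ≤ X w}) := fun s t hst =>
      measureReal_mono fun w (hw : t ≤ X w) => hst.trans hw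
    exact (hanti.locallyIntegrable.integrableOn_isCompact isCompact_Icc).mono_set
      Set.Ioc_subset_Icc_self
  rw [hlc ν₁, hlc ν₂, ← integral_sub (hti ν₁) (hti ν₂), ← Real.norm_eq_abs]
  refine (norm_setIntegral_le_of_norm_le_const (C := c) measure_Ioc_lt_top
    fun t _ => hc t).trans_eq ?_
  simp

variable [IsProbabilityMeasure μ]

/-- Covariance inequality for functions with values in `[0, 1]`. -/
lemma abs_cov_le_of_forall_event {X Y : Ω → ℝ} (hX : Measurable X) (hY : Measurable Y)
    (hX0 : ∀ w, 0 ≤ X w) (hX1 : ∀ w, X w ≤ 1) (hY0 : ∀ w, 0 ≤ Y w) (hY1 : ∀ w, Y w ≤ 1) {c : ℝ}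
    (hc : ∀ s t, |μ.real ({w | s ≤ X w} ∩ {w | t ≤ Y w}) -
      μ.real {w | s ≤ X w} * μ.real {w | t ≤ Y w}| ≤ c) :
    |∫ w, X w * Y w ∂μ - (∫ w, X w ∂μ) * ∫ w, Y w ∂μ| ≤ c := by
  have hXi : Integrable X μ := Integrable.of_bound hX.aestronglyMeasurable 1
    (Eventually.of_forall fun w => by rw [Real.norm_of_nonneg (hX0 w)]; exact hX1 w)
  have hEX : 0 ≤ ∫ w, X w ∂μ := integral_nonneg hX0
  have hmX : ∀ s, MeasurableSet {w | s ≤ X w} := fun s => measurableSet_le measurable_const hX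
  have hmY : ∀ s, MeasurableSet {w | s ≤ Y w} := fun s => measurableSet_le measurable_const hY
  -- first replace only `X` by an average of indicators, with an event of `Y` fixed
  have step : ∀ t, |∫ w in {w | t ≤ Y w}, X w ∂μ - (∫ w, X w ∂μ) * μ.real {w | t ≤ Y w}| ≤ c := by
    intro t
    have h := abs_integral_sub_integral_le_of_superlevel (ν₁ := μ.restrict {w | t ≤ Y w})
      (ν₂ := (μ {w | t ≤ Y w}).toNNReal • μ) hX hX0 hX1 (c := c) ?_
    · rw [integral_smul_nnreal_measure] at h
      rw [mul_comm]
      exact h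
    · intro s
      rw [measureReal_restrict_apply (hmX s), measureReal_nnreal_smul_apply, mul_comm]
      exact hc s t
  have : IsFiniteMeasure (μ.withDensity fun w => ENNReal.ofReal (X w)) :=
    isFiniteMeasure_withDensity_ofReal hXi.2
  have hwd : ∀ t, (μ.withDensity fun w => ENNReal.ofReal (X w)).real {w | t ≤ Y w} =
      ∫ w in {w | t ≤ Y w}, X w ∂μ := by
    intro t
    rw [measureReal_def, withDensity_apply _ (hmY t),
      integral_eq_lintegral_of_nonneg_ae (Eventually.of_forall hX0) hX.aestronglyMeasurable]
  have h := abs_integral_sub_integral_le_of_superlevel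
    (ν₁ := μ.withDensity fun w => ENNReal.ofReal (X w))
    (ν₂ := (∫ w, X w ∂μ).toNNReal • μ) hY hY0 hY1 (c := c) ?_
  · rw [integral_smul_nnreal_measure, integral_withDensity_eq_integral_toReal_smul
      hX.ennreal_ofReal (Eventually.of_forall fun _ => ENNReal.ofReal_lt_top)] at h
    simp only [ENNReal.toReal_ofReal (hX0 _), smul_eq_mul, NNReal.smul_def,
      Real.coe_toNNReal _ hEX] at h
    exact h
  · intro t
    rw [hwd, measureReal_nnreal_smul_apply, Real.coe_toNNReal _ hEX]
    exact step t

/-- Covariance inequality for functions with values in `[-1, 1]`. -/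
lemma abs_cov_le_four_mul {X Y : Ω → ℝ} (hX : Measurable X) (hY : Measurable Y)
    (hX1 : ∀ w, |X w| ≤ 1) (hY1 : ∀ w, |Y w| ≤ 1) {c : ℝ}
    (hc : ∀ s t, |μ.real ({w | s ≤ X w} ∩ {w | t ≤ Y w}) -
      μ.real {w | s ≤ X w} * μ.real {w | t ≤ Y w}| ≤ c) :
    |∫ w, X w * Y w ∂μ - (∫ w, X w ∂μ) * ∫ w, Y w ∂μ| ≤ 4 * c := by
  have hXi : Integrable X μ := Integrable.of_bound hX.aestronglyMeasurable 1
    (Eventually.of_forall hX1)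
  have hYi : Integrable Y μ := Integrable.of_bound hY.aestronglyMeasurable 1
    (Eventually.of_forall hY1)
  have hXYi : Integrable (fun w => X w * Y w) μ :=
    hYi.bdd_mul (c := 1) hX.aestronglyMeasurable (Eventually.of_forall hX1)
  have hset : ∀ (Z : Ω → ℝ) (s : ℝ), {w | s ≤ (Z w + 1) / 2} = {w | 2 * s - 1 ≤ Z w} := by
    intro Z s
    ext w
    simp only [Set.mem_ofPred_eq]
    constructor <;> intro h <;> linarith
  have h := abs_cov_le_of_forall_event (μ := μ) (X := fun w => (X w + 1) / 2)
    (Y := fun w => (Y w + 1) / 2) (by fun_prop) (by fun_prop)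
    (fun w => by have := abs_le.mp (hX1 w); linarith)
    (fun w => by have := abs_le.mp (hX1 w); linarith)
    (fun w => by have := abs_le.mp (hY1 w); linarith)
    (fun w => by have := abs_le.mp (hY1 w); linarith) (c := c)
    (fun s t => by simp only [hset]; exact hc _ _)
  have e1 : ∫ w, (X w + 1) / 2 ∂μ = (∫ w, X w ∂μ + 1) / 2 := by
    rw [integral_div, integral_add hXi (integrable_const _)]; simp
  have e2 : ∫ w, (Y w + 1) / 2 ∂μ = (∫ w, Y w ∂μ + 1) / 2 := by
    rw [integral_div, integral_add hYi (integrable_const _)]; simp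
  have e3 : ∫ w, (X w + 1) / 2 * ((Y w + 1) / 2) ∂μ =
      (∫ w, X w * Y w ∂μ + ∫ w, X w ∂μ + ∫ w, Y w ∂μ + 1) / 4 := by
    have h1 : Integrable (fun w => X w * Y w + X w) μ := hXYi.add hXi
    have h2 : Integrable (fun w => X w * Y w + X w + Y w) μ := h1.add hYi
    rw [← integral_add hXYi hXi, ← integral_add h1 hYi]
    have : ∀ w, (X w + 1) / 2 * ((Y w + 1) / 2) = (X w * Y w + X w + Y w + 1) / 4 := fun w => by
      ring
    simp_rw [this]
    rw [integral_div, integral_add h2 (integrable_const _)]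
    simp
  rw [e1, e2, e3] at h
  rw [show ∫ w, X w * Y w ∂μ - (∫ w, X w ∂μ) * ∫ w, Y w ∂μ =
    4 * ((∫ w, X w * Y w ∂μ + ∫ w, X w ∂μ + ∫ w, Y w ∂μ + 1) / 4 -
      (∫ w, X w ∂μ + 1) / 2 * ((∫ w, Y w ∂μ + 1) / 2)) by ring, abs_mul]
  norm_num
  linarith

lemma setDist_singleton (x y : Plane) : setDist {x} {y} = dist x y := by
  simp [setDist]

/-- Two events generated by the values of the field at two points at distance more than `r` are
`alphaMix`-close to independent. -/
lemma abs_measureReal_inter_sub_le_alphaMix {V : Plane → Ω → ℝ} {x y : Plane} {r : ℝ}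
    (hr : r < dist x y) {S T : Set ℝ} (hS : MeasurableSet S) (hT : MeasurableSet T) :
    |μ.real (V x ⁻¹' S ∩ V y ⁻¹' T) - μ.real (V x ⁻¹' S) * μ.real (V y ⁻¹' T)| ≤
      alphaMix μ V r := by
  refine le_csSup ⟨1, ?_⟩ ⟨{x}, {y}, Set.singleton_nonempty _, Set.singleton_nonempty _, ?_,
    V x ⁻¹' S, V y ⁻¹' T, ?_, ?_, rfl⟩
  · rintro _ ⟨S, S', -, -, -, A, B, -, -, rfl⟩
    have h1 : μ.real (A ∩ B) ≤ 1 := measureReal_le_one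
    have h2 : μ.real A ≤ 1 := measureReal_le_one
    have h3 : μ.real B ≤ 1 := measureReal_le_one
    have h4 : 0 ≤ μ.real (A ∩ B) := measureReal_nonneg
    have h5 : 0 ≤ μ.real A := measureReal_nonneg
    have h6 : 0 ≤ μ.real B := measureReal_nonneg
    rw [abs_le]
    constructor <;> nlinarith
  · rwa [setDist_singleton]
  · rw [fieldSigma, iSup_singleton]
    exact ⟨S, by rwa [← BorelSpace.measurable_eq (α := ℝ)], rfl⟩
  · rw [fieldSigma, iSup_singleton]
    exact ⟨T, by rwa [← BorelSpace.measurable_eq (α := ℝ)], rfl⟩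

lemma abs_cov_field_le {V : Plane → Ω → ℝ} (hV : ∀ x, Measurable (V x)) {x y : Plane} {r : ℝ}
    (hr : r < dist x y) {f g : ℝ → ℝ} (hf : Measurable f) (hg : Measurable g)
    (hf1 : ∀ t, |f t| ≤ 1) (hg1 : ∀ t, |g t| ≤ 1) :
    |∫ w, f (V x w) * g (V y w) ∂μ - (∫ w, f (V x w) ∂μ) * ∫ w, g (V y w) ∂μ| ≤
      4 * alphaMix μ V r :=
  abs_cov_le_four_mul (hf.comp (hV x)) (hg.comp (hV y)) (fun _ => hf1 _) (fun _ => hg1 _)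
    fun s t => abs_measureReal_inter_sub_le_alphaMix hr (S := {u | s ≤ f u}) (T := {u | t ≤ g u})
      (measurableSet_le measurable_const hf) (measurableSet_le measurable_const hg)

open ComplexConjugate in
/-- Covariance inequality for the phases `e^{iuV(x)}` and `e^{iu'V(y)}`. -/
lemma norm_cov_phase_le {V : Plane → Ω → ℝ} (hV : ∀ x, Measurable (V x)) {x y : Plane} {r : ℝ}
    (hr : r < dist x y) (u u' : ℝ) :
    ‖∫ w, Complex.exp (Complex.I * ((u * V x w : ℝ) : ℂ)) *
        conj (Complex.exp (Complex.I * ((u' * V y w : ℝ) : ℂ))) ∂μ -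
      (∫ w, Complex.exp (Complex.I * ((u * V x w : ℝ) : ℂ)) ∂μ) *
        conj (∫ w, Complex.exp (Complex.I * ((u' * V y w : ℝ) : ℂ)) ∂μ)‖ ≤
      16 * alphaMix μ V r := by
  have hexp : ∀ t : ℝ, Complex.exp (Complex.I * (t : ℂ)) =
      (Real.cos t : ℂ) + (Real.sin t : ℂ) * Complex.I := by
    intro t
    rw [mul_comm, Complex.exp_mul_I, Complex.ofReal_cos, Complex.ofReal_sin]
  have hi : ∀ (f : ℝ → ℝ) (v : ℝ) (z : Plane), Measurable f → (∀ t, |f t| ≤ 1) →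
      Integrable (fun w => f (v * V z w)) μ := fun f v z hf hf1 =>
    Integrable.of_bound (hf.comp ((hV z).const_mul v)).aestronglyMeasurable 1
      (Eventually.of_forall fun _ => hf1 _)
  have hE : ∀ (v : ℝ) (z : Plane), ∫ w, Complex.exp (Complex.I * ((v * V z w : ℝ) : ℂ)) ∂μ =
      ((∫ w, Real.cos (v * V z w) ∂μ : ℝ) : ℂ) +
        ((∫ w, Real.sin (v * V z w) ∂μ : ℝ) : ℂ) * Complex.I := by
    intro v z
    simp_rw [hexp]
    rw [integral_add (hi _ v z Real.measurable_cos Real.abs_cos_le_one).ofReal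
      ((hi _ v z Real.measurable_sin Real.abs_sin_le_one).ofReal.mul_const _),
      integral_mul_const, integral_complex_ofReal, integral_complex_ofReal]
  have hp : ∀ (f g : ℝ → ℝ), Measurable f → Measurable g → (∀ t, |f t| ≤ 1) → (∀ t, |g t| ≤ 1) →
      Integrable (fun w => f (u * V x w) * g (u' * V y w)) μ := fun f g hf hg hf1 hg1 =>
    (hi g u' y hg hg1).bdd_mul (c := 1) (hf.comp ((hV x).const_mul u)).aestronglyMeasurable
      (Eventually.of_forall fun _ => hf1 _)
  have hcc := hp _ _ Real.measurable_cos Real.measurable_cos Real.abs_cos_le_one Real.abs_cos_le_one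
  have hss := hp _ _ Real.measurable_sin Real.measurable_sin Real.abs_sin_le_one Real.abs_sin_le_one
  have hsc := hp _ _ Real.measurable_sin Real.measurable_cos Real.abs_sin_le_one Real.abs_cos_le_one
  have hcs := hp _ _ Real.measurable_cos Real.measurable_sin Real.abs_cos_le_one Real.abs_sin_le_one
  have hprod : ∫ w, Complex.exp (Complex.I * ((u * V x w : ℝ) : ℂ)) *
        conj (Complex.exp (Complex.I * ((u' * V y w : ℝ) : ℂ))) ∂μ =
      ((∫ w, Real.cos (u * V x w) * Real.cos (u' * V y w) ∂μ +
        ∫ w, Real.sin (u * V x w) * Real.sin (u' * V y w) ∂μ : ℝ) : ℂ) +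
      ((∫ w, Real.sin (u * V x w) * Real.cos (u' * V y w) ∂μ -
        ∫ w, Real.cos (u * V x w) * Real.sin (u' * V y w) ∂μ : ℝ) : ℂ) * Complex.I := by
    rw [← integral_add hcc hss, ← integral_sub hsc hcs, ← integral_complex_ofReal,
      ← integral_complex_ofReal, ← integral_mul_const,
      ← integral_add (hcc.add hss).ofReal ((hsc.sub hcs).ofReal.mul_const _)]
    congr 1
    ext w
    simp only [hexp, map_add, map_mul, Complex.conj_ofReal, Complex.conj_I]
    simp only [Complex.ofReal_add, Complex.ofReal_sub, Complex.ofReal_mul]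
    linear_combination (-(Real.sin (u * V x w) : ℂ) * (Real.sin (u' * V y w) : ℂ)) * Complex.I_sq
  have hcov : ∀ (f g : ℝ → ℝ), Measurable f → Measurable g → (∀ t, |f t| ≤ 1) →
      (∀ t, |g t| ≤ 1) → |∫ w, f (u * V x w) * g (u' * V y w) ∂μ -
        (∫ w, f (u * V x w) ∂μ) * ∫ w, g (u' * V y w) ∂μ| ≤ 4 * alphaMix μ V r :=
    fun f g hf hg hf1 hg1 => abs_cov_field_le hV hr (f := fun t => f (u * t))
      (g := fun t => g (u' * t)) (by fun_prop) (by fun_prop) (fun _ => hf1 _) (fun _ => hg1 _)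
  have k1 := abs_le.mp <|
    hcov _ _ Real.measurable_cos Real.measurable_cos Real.abs_cos_le_one Real.abs_cos_le_one
  have k2 := abs_le.mp <|
    hcov _ _ Real.measurable_sin Real.measurable_sin Real.abs_sin_le_one Real.abs_sin_le_one
  have k3 := abs_le.mp <|
    hcov _ _ Real.measurable_sin Real.measurable_cos Real.abs_sin_le_one Real.abs_cos_le_one
  have k4 := abs_le.mp <|
    hcov _ _ Real.measurable_cos Real.measurable_sin Real.abs_cos_le_one Real.abs_sin_le_one
  rw [hprod, hE u x, hE u' y]
  refine (Complex.norm_le_abs_re_add_abs_im _).trans ?_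
  have hre : ∀ z : ℂ, |z.re| ≤ 8 * alphaMix μ V r → |z.im| ≤ 8 * alphaMix μ V r →
      |z.re| + |z.im| ≤ 16 * alphaMix μ V r := fun z h1 h2 => by linarith
  refine hre _ ?_ ?_
  · simp only [map_add, map_mul, Complex.conj_ofReal, Complex.conj_I, Complex.sub_re,
      Complex.add_re, Complex.mul_re, Complex.ofReal_re, Complex.ofReal_im, Complex.I_re,
      Complex.I_im, Complex.add_im, Complex.mul_im, Complex.neg_re, Complex.neg_im]
    rw [abs_le]
    constructor <;> linarith [k1.1, k1.2, k2.1, k2.2]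
  · simp only [map_add, map_mul, Complex.conj_ofReal, Complex.conj_I, Complex.sub_im,
      Complex.add_re, Complex.mul_re, Complex.ofReal_re, Complex.ofReal_im, Complex.I_re,
      Complex.I_im, Complex.add_im, Complex.mul_im, Complex.neg_re, Complex.neg_im]
    rw [abs_le]
    constructor <;> linarith [k3.1, k3.2, k4.1, k4.2]

end Mixing

/-! ### Averaging of rapidly varying phases -/

section Averaging

open ComplexConjugate

variable {Ω : Type*} [MeasurableSpace Ω] {μ : Measure Ω}

lemma IsInterfaceField.map_eq {V : Plane → Ω → ℝ} (hV : IsInterfaceField μ V) (x : Plane) :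
    μ.map (V x) = μ.map (V 0) := by
  have h := congrArg (fun ν => ν.map (fun f : Fin 1 → ℝ => f 0))
    (hV.stationary 1 (fun _ => 0) x)
  have hm : ∀ y, Measurable (fun (w : Ω) (_ : Fin 1) => V y w) := fun y =>
    measurable_pi_lambda _ fun _ => hV.measurable y
  simp only [zero_add] at h
  rw [Measure.map_map (measurable_pi_apply 0) (hm x),
    Measure.map_map (measurable_pi_apply 0) (hm 0)] at h
  exact h

lemma IsInterfaceField.integral_phase {V : Plane → Ω → ℝ} (hV : IsInterfaceField μ V) (u : ℝ)
    (x : Plane) :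
    ∫ w, Complex.exp (Complex.I * ((u * V x w : ℝ) : ℂ)) ∂μ = phiV μ V u := by
  have hm : ∀ y, ∫ w, Complex.exp (Complex.I * ((u * V y w : ℝ) : ℂ)) ∂μ =
      ∫ t, Complex.exp (Complex.I * ((u * t : ℝ) : ℂ)) ∂(μ.map (V y)) := fun y =>
    (integral_map (f := fun t : ℝ => Complex.exp (Complex.I * ((u * t : ℝ) : ℂ)))
      (hV.measurable y).aemeasurable (Continuous.aestronglyMeasurable (by fun_prop))).symm
  rw [phiV, hm, hm, hV.map_eq]

lemma IsInterfaceField.measurable_uncurry {V : Plane → Ω → ℝ} (hV : IsInterfaceField μ V) :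
    Measurable (fun p : Plane × Ω => V p.1 p.2) :=
  measurable_uncurry_of_continuous_of_measurable hV.continuous hV.measurable

lemma norm_phiV_le [IsProbabilityMeasure μ] (V : Plane → Ω → ℝ) (u : ℝ) : ‖phiV μ V u‖ ≤ 1 := by
  refine (norm_integral_le_integral_norm _).trans ?_
  simp_rw [Complex.norm_exp_I_mul_ofReal]
  simp

lemma continuous_phiV [IsProbabilityMeasure μ] {V : Plane → Ω → ℝ} (hV : Measurable (V 0)) :
    Continuous (phiV μ V) := by
  unfold phiV
  refine continuous_of_dominated (bound := fun _ => 1) ?_ ?_ (integrable_const _) ?_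
  · intro u
    exact (by fun_prop : Measurable fun w =>
      Complex.exp (Complex.I * ((u * V 0 w : ℝ) : ℂ))).aestronglyMeasurable
  · intro u
    filter_upwards with w
    rw [Complex.norm_exp_I_mul_ofReal]
  · filter_upwards with w
    fun_prop

variable [IsProbabilityMeasure μ]

/-- The centered phase `e^{iuV(x)} - φ_V(u)`. -/
noncomputable def centeredPhase (μ : Measure Ω) (V : Plane → Ω → ℝ) (u : ℝ) (x : Plane) (w : Ω) :
    ℂ :=
  Complex.exp (Complex.I * ((u * V x w : ℝ) : ℂ)) - phiV μ V u

lemma norm_centeredPhase_le (V : Plane → Ω → ℝ) (u : ℝ) (x : Plane) (w : Ω) :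
    ‖centeredPhase μ V u x w‖ ≤ 2 := by
  refine (norm_sub_le _ _).trans ?_
  rw [Complex.norm_exp_I_mul_ofReal]
  linarith [norm_phiV_le (μ := μ) V u]

lemma measurable_centeredPhase {V : Plane → Ω → ℝ} (hV : IsInterfaceField μ V) :
    Measurable (fun p : (ℝ × Plane) × Ω => centeredPhase μ V p.1.1 p.1.2 p.2) := by
  have h1 : Measurable (fun p : (ℝ × Plane) × Ω => V p.1.2 p.2) :=
    hV.measurable_uncurry.comp (by fun_prop : Measurable fun p : (ℝ × Plane) × Ω => (p.1.2, p.2))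
  have h2 : Measurable (fun p : (ℝ × Plane) × Ω => phiV μ V p.1.1) :=
    (continuous_phiV (hV.measurable 0)).measurable.comp (by fun_prop)
  exact (Complex.measurable_exp.comp
    (((measurable_fst.comp measurable_fst).mul h1).complex_ofReal.const_mul Complex.I)).sub h2

lemma integral_centeredPhase_mul_conj {V : Plane → Ω → ℝ} (hV : IsInterfaceField μ V) (u u' : ℝ)
    (x y : Plane) :
    ∫ w, centeredPhase μ V u x w * conj (centeredPhase μ V u' y w) ∂μ =
      ∫ w, Complex.exp (Complex.I * ((u * V x w : ℝ) : ℂ)) *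
        conj (Complex.exp (Complex.I * ((u' * V y w : ℝ) : ℂ))) ∂μ -
      (∫ w, Complex.exp (Complex.I * ((u * V x w : ℝ) : ℂ)) ∂μ) *
        conj (∫ w, Complex.exp (Complex.I * ((u' * V y w : ℝ) : ℂ)) ∂μ) := by
  rw [hV.integral_phase u x, hV.integral_phase u' y]
  set e : ℝ → Plane → Ω → ℂ := fun u x w => Complex.exp (Complex.I * ((u * V x w : ℝ) : ℂ)) with he
  have hem : ∀ u x, Measurable (e u x) := fun u x => by
    have := hV.measurable x
    fun_prop
  have hei : ∀ u x, Integrable (e u x) μ := fun u x =>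
    Integrable.of_bound (hem u x).aestronglyMeasurable 1
      (Eventually.of_forall fun w => (Complex.norm_exp_I_mul_ofReal _).le)
  have hci : ∀ u x, Integrable (fun w => conj (e u x w)) μ := fun u x =>
    Integrable.of_bound (Complex.continuous_conj.measurable.comp (hem u x)).aestronglyMeasurable 1
      (Eventually.of_forall fun w => by
        rw [RCLike.norm_conj]
        exact (Complex.norm_exp_I_mul_ofReal _).le)
  have hpi : Integrable (fun w => e u x w * conj (e u' y w)) μ :=
    (hci u' y).bdd_mul (c := 1) (hem u x).aestronglyMeasurable
      (Eventually.of_forall fun w => (Complex.norm_exp_I_mul_ofReal _).le)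
  have h : ∀ w, centeredPhase μ V u x w * conj (centeredPhase μ V u' y w) =
      e u x w * conj (e u' y w) - phiV μ V u * conj (e u' y w) - conj (phiV μ V u') * e u x w +
        phiV μ V u * conj (phiV μ V u') := by
    intro w
    simp only [centeredPhase, map_sub, he]
    ring
  simp_rw [h]
  have hi1 : Integrable (fun w => e u x w * conj (e u' y w) - phiV μ V u * conj (e u' y w)) μ :=
    hpi.sub ((hci u' y).const_mul _)
  have hi2 : Integrable (fun w => e u x w * conj (e u' y w) - phiV μ V u * conj (e u' y w) -
      conj (phiV μ V u') * e u x w) μ := hi1.sub ((hei u x).const_mul _)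
  rw [integral_add hi2 (integrable_const _), integral_sub hi1 ((hei u x).const_mul _),
    integral_sub hpi ((hci u' y).const_mul _), integral_const_mul, integral_const_mul,
    integral_conj, hV.integral_phase u x, hV.integral_phase u' y,
    integral_const, probReal_univ, one_smul]
  ring

/-- Ergodic averaging: rescaled centered phases of a stationary mixing field, integrated against an
integrable density of frequency and position, tend to `0` in `L²`. The second moment is a double
integral of covariances, which vanish in the limit off the diagonal `x = x'`. -/
theorem tendsto_integral_norm_sq_centeredPhase {V : Plane → Ω → ℝ} (hV : IsInterfaceField μ V)
    {H : ℝ × Plane → ℂ} (hH : Integrable H) (τ : ℝ) {ι : Type*} {l : Filter ι}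
    [l.IsCountablyGenerated] (x₀ : ι → Plane) {lam : ι → ℝ} (hlam : Tendsto lam l atTop) :
    Tendsto (fun n => ∫ w, ‖∫ p, centeredPhase μ V (p.1 * τ) (x₀ n + lam n • p.2) w * H p‖ ^ 2 ∂μ)
      l (𝓝 0) := by
  set X : ι → ℝ × Plane → Ω → ℂ := fun n p w =>
    centeredPhase μ V (p.1 * τ) (x₀ n + lam n • p.2) w with hX
  set c : ι → (ℝ × Plane) × (ℝ × Plane) → ℂ := fun n z => ∫ w, X n z.1 w * conj (X n z.2 w) ∂μ
    with hc
  have hXm : ∀ n, Measurable (fun z : (ℝ × Plane) × Ω => X n z.1 z.2) := fun n =>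
    (measurable_centeredPhase hV).comp (by fun_prop :
      Measurable fun z : (ℝ × Plane) × Ω => ((z.1.1 * τ, x₀ n + lam n • z.1.2), z.2))
  have hXXm : ∀ n, Measurable (fun z : Ω × (ℝ × Plane) × (ℝ × Plane) =>
      X n z.2.1 z.1 * conj (X n z.2.2 z.1)) := fun n =>
    ((hXm n).comp (by fun_prop : Measurable fun z : Ω × (ℝ × Plane) × (ℝ × Plane) =>
      (z.2.1, z.1))).mul (Complex.continuous_conj.measurable.comp ((hXm n).comp
        (by fun_prop : Measurable fun z : Ω × (ℝ × Plane) × (ℝ × Plane) => (z.2.2, z.1))))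
  have hXb : ∀ n p w, ‖X n p w‖ ≤ 2 := fun n p w => norm_centeredPhase_le V _ _ w
  have hXXb : ∀ n p p' w, ‖X n p w * conj (X n p' w)‖ ≤ 4 := fun n p p' w => by
    rw [norm_mul, RCLike.norm_conj]
    calc _ ≤ (2 : ℝ) * 2 := by gcongr <;> exact hXb _ _ _
      _ = 4 := by norm_num
  have hHc : Integrable (fun p => conj (H p)) :=
    Complex.conjLIE.toContinuousLinearEquiv.toContinuousLinearMap.integrable_comp hH
  have hHH : Integrable (fun z : (ℝ × Plane) × (ℝ × Plane) => H z.1 * conj (H z.2)) :=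
    hH.mul_prod hHc
  -- the second moment as a double integral of covariances
  have hmom : ∀ n, ((∫ w, ‖∫ p, X n p w * H p‖ ^ 2 ∂μ : ℝ) : ℂ) =
      ∫ z : (ℝ × Plane) × (ℝ × Plane), c n z * (H z.1 * conj (H z.2)) := by
    intro n
    rw [← integral_complex_ofReal]
    have h1 : ∀ w, ((‖∫ p, X n p w * H p‖ ^ 2 : ℝ) : ℂ) =
        ∫ z : (ℝ × Plane) × (ℝ × Plane),
          X n z.1 w * conj (X n z.2 w) * (H z.1 * conj (H z.2)) := by
      intro w
      rw [Complex.ofReal_pow, ← Complex.mul_conj', ← integral_conj,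
        ← integral_prod_mul (fun p => X n p w * H p) (fun p => conj (X n p w * H p))]
      congr 1
      ext z
      simp only [map_mul]
      ring
    simp_rw [h1]
    rw [integral_integral_swap]
    · simp only [hc, integral_mul_const]
    · have h2 : Integrable (fun z : Ω × (ℝ × Plane) × (ℝ × Plane) =>
          H z.2.1 * conj (H z.2.2)) (μ.prod volume) := hHH.comp_snd μ
      exact h2.bdd_mul (c := 4) (hXXm n).aestronglyMeasurable
        (Eventually.of_forall fun z => hXXb _ _ _ _)
  have hcm : ∀ n, AEStronglyMeasurable (c n) volume := by
    intro n
    have := (hXXm n).comp (measurable_swap (α := (ℝ × Plane) × (ℝ × Plane)) (β := Ω))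
    exact (this.stronglyMeasurable.integral_prod_right' (ν := μ)).aestronglyMeasurable
  have hcb : ∀ n z, ‖c n z‖ ≤ 4 := by
    intro n z
    refine (norm_integral_le_integral_norm _).trans ?_
    calc _ ≤ ∫ _, (4 : ℝ) ∂μ := integral_mono_of_nonneg
          (Eventually.of_forall fun _ => norm_nonneg _) (integrable_const _)
          (Eventually.of_forall fun w => hXXb _ _ _ w)
      _ = 4 := by simp
  have hoff : ∀ z : (ℝ × Plane) × (ℝ × Plane), z.1.2 ≠ z.2.2 →
      Tendsto (fun n => c n z) l (𝓝 0) := by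
    intro z hz
    set d := dist z.1.2 z.2.2 with hd
    have hd0 : 0 < d := dist_pos.mpr hz
    have hbound : ∀ᶠ n in l, ‖c n z‖ ≤ 16 * alphaMix μ V (lam n * (d / 2)) := by
      filter_upwards [hlam.eventually_gt_atTop 0] with n hn
      rw [hc]
      simp only [hX]
      rw [integral_centeredPhase_mul_conj hV]
      refine norm_cov_phase_le hV.measurable ?_ _ _
      rw [dist_add_left, dist_smul₀, Real.norm_of_nonneg hn.le]
      have : 0 < lam n * d := mul_pos hn hd0
      linarith
    have hα : Tendsto (fun n => 16 * alphaMix μ V (lam n * (d / 2))) l (𝓝 0) := by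
      have := (hV.mixing.comp (hlam.atTop_mul_const (by positivity : 0 < d / 2))).const_mul 16
      simpa using this
    exact squeeze_zero_norm' hbound hα
  have hdiag : ∀ᵐ z : (ℝ × Plane) × (ℝ × Plane), z.1.2 ≠ z.2.2 := by
    have hmeas : MeasurableSet {z : (ℝ × Plane) × (ℝ × Plane) | z.1.2 ≠ z.2.2} :=
      (measurableSet_eq_fun (by fun_prop) (by fun_prop)).compl
    have := (Measure.ae_prod_iff_ae_ae (μ := (volume : Measure (ℝ × Plane)))
      (ν := (volume : Measure (ℝ × Plane))) (p := fun z => z.1.2 ≠ z.2.2) hmeas).mpr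
    refine this (Eventually.of_forall fun p => ?_)
    have h1 : ∀ᵐ y : Plane, p.2 ≠ y := by
      have : ∀ᵐ y : Plane, y ≠ p.2 := by simp [ae_iff]
      filter_upwards [this] with y hy using hy.symm
    exact (Measure.quasiMeasurePreserving_snd (μ := (volume : Measure ℝ))
      (ν := (volume : Measure Plane))).ae h1
  have hlim : Tendsto (fun n => ∫ z : (ℝ × Plane) × (ℝ × Plane), c n z * (H z.1 * conj (H z.2)))
      l (𝓝 (∫ z : (ℝ × Plane) × (ℝ × Plane), (0 : ℂ))) := by
    refine tendsto_integral_filter_of_dominated_convergence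
      (fun z => 4 * ‖H z.1 * conj (H z.2)‖) ?_ ?_ (hHH.norm.const_mul 4) ?_
    · exact Eventually.of_forall fun n => (hcm n).mul hHH.1
    · refine Eventually.of_forall fun n => Eventually.of_forall fun z => ?_
      rw [norm_mul]
      gcongr
      exact hcb n z
    · filter_upwards [hdiag] with z hz
      simpa using (hoff z hz).mul_const (H z.1 * conj (H z.2))
  rw [integral_zero] at hlim
  have h2 : Tendsto (fun n => ((∫ w, ‖∫ p, X n p w * H p‖ ^ 2 ∂μ : ℝ) : ℂ)) l (𝓝 0) := by
    simp_rw [hmom]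
    exact hlim
  have h3 := (Complex.continuous_re.tendsto 0).comp h2
  simpa [Function.comp_def, hX] using h3

end Averaging

/-! ### Convergence of the reflected wave front -/

section WaveFront

variable {M : Medium} {Ψ : ℝ × Plane → ℝ}

lemma obsAmplitude_add (δ : ℝ) (φ ψ : 𝓢(ObsSpace, ℂ)) (ω : ℝ) (q : Plane) :
    obsAmplitude δ (φ + ψ : 𝓢(ObsSpace, ℂ)) ω q =
      obsAmplitude δ φ ω q + obsAmplitude δ ψ ω q := by
  have hi : ∀ f : 𝓢(ObsSpace, ℂ), Integrable (fun p : ObsSpace => f p *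
      Complex.exp (-Complex.I * ((ω * (p.1 - inner ℝ q (p.2.1 + δ • p.2.2)) : ℝ) : ℂ))) := by
    intro f
    refine f.integrable.mul_bdd (c := 1) (Continuous.aestronglyMeasurable (by fun_prop)) ?_
    filter_upwards with p
    rw [norm_exp_neg_I_mul_ofReal]
  rw [obsAmplitude, obsAmplitude, obsAmplitude, ← integral_add (hi φ) (hi ψ)]
  simp_rw [add_apply, add_mul]

lemma obsAmplitude_smul (δ : ℝ) (c : ℂ) (φ : 𝓢(ObsSpace, ℂ)) (ω : ℝ) (q : Plane) :
    obsAmplitude δ (c • φ : 𝓢(ObsSpace, ℂ)) ω q = c * obsAmplitude δ φ ω q := by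
  rw [obsAmplitude, obsAmplitude, ← integral_const_mul]
  simp_rw [smul_apply, smul_eq_mul, mul_assoc]

/-- The pairing of a test function with a reflector that imprints the bounded phase `m`. -/
noncomputable def reflectorPairing (M : Medium) (Ψ : ℝ × Plane → ℝ) (δ : ℝ) (m : ℝ × Plane → ℂ)
    (φ : ObsSpace → ℂ) : ℂ :=
  ((M.reflCoef / (2 * (2 * Real.pi) ^ 3) : ℝ) : ℂ) *
    ∫ p, m p * interfaceDensity M Ψ (waveAmplitude M δ φ) p

/-- Every bounded phase gives rise to a tempered distribution. -/
lemma exists_temperedDistribution_reflectorPairing (hΨ : IsSource Ψ) (δ : ℝ) {m : ℝ × Plane → ℂ}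
    (hm : Measurable m) (hm1 : ∀ p, ‖m p‖ ≤ 1) :
    ∃ T : 𝓢'(ObsSpace, ℂ), ∀ φ : 𝓢(ObsSpace, ℂ), T φ = reflectorPairing M Ψ δ m φ := by
  obtain ⟨a, b, ha, hb, hab⟩ := hΨ.exists_band
  obtain ⟨s, C, hC, hdec⟩ := exists_waveAmplitude_isDecaying M ha
  obtain ⟨C', hC', hnorm⟩ := exists_integral_norm_interfaceDensity_le M hΨ ha hab
  have hi : ∀ φ : 𝓢(ObsSpace, ℂ),
      Integrable (interfaceDensity M Ψ (waveAmplitude M δ φ)) := fun φ =>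
    integrable_interfaceDensity hΨ ha hab (hdec φ δ)
  have hmi : ∀ φ : 𝓢(ObsSpace, ℂ),
      Integrable (fun p => m p * interfaceDensity M Ψ (waveAmplitude M δ φ) p) := fun φ =>
    (hi φ).bdd_mul (c := 1) hm.aestronglyMeasurable (Eventually.of_forall hm1)
  set k : ℂ := ((M.reflCoef / (2 * (2 * Real.pi) ^ 3) : ℝ) : ℂ) with hk
  let L : 𝓢(ObsSpace, ℂ) →L[ℂ] ℂ := SchwartzMap.mkCLMtoNormedSpace (𝕜 := ℂ) (σ := RingHom.id ℂ)
    (fun φ : 𝓢(ObsSpace, ℂ) => reflectorPairing M Ψ δ m φ)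
    (by
      intro φ ψ
      have h : ∀ p, interfaceDensity M Ψ (waveAmplitude M δ (φ + ψ : 𝓢(ObsSpace, ℂ))) p =
          interfaceDensity M Ψ (waveAmplitude M δ φ) p +
            interfaceDensity M Ψ (waveAmplitude M δ ψ) p := by
        intro p
        have h1 := interfaceDensity_sub (M := M) ha hab (hdec (φ + ψ) δ) (hdec ψ δ) p
        have h2 : (fun ω q => waveAmplitude M δ (φ + ψ : 𝓢(ObsSpace, ℂ)) ω q -
            waveAmplitude M δ ψ ω q) = waveAmplitude M δ φ := by
          ext ω q
          rw [waveAmplitude, waveAmplitude, waveAmplitude, obsAmplitude_add]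
          ring
        rw [h2] at h1
        rw [h1, sub_add_cancel]
      simp only [reflectorPairing]
      rw [← mul_add, ← integral_add (hmi φ) (hmi ψ)]
      simp_rw [h, mul_add])
    (by
      intro c φ
      have h2 : waveAmplitude M δ (c • φ : 𝓢(ObsSpace, ℂ)) =
          fun ω q => c * waveAmplitude M δ φ ω q := by
        ext ω q
        rw [waveAmplitude, waveAmplitude, obsAmplitude_smul, mul_assoc]
      simp only [reflectorPairing, h2, interfaceDensity_const_mul, RingHom.id_apply, smul_eq_mul]
      simp_rw [mul_left_comm _ c]
      rw [integral_const_mul, mul_left_comm])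
    ⟨s, ‖k‖ * (C' * C), by positivity, fun φ => by
      simp only [reflectorPairing]
      rw [norm_mul, mul_assoc ‖k‖]
      refine mul_le_mul_of_nonneg_left ?_ (norm_nonneg _)
      refine (norm_integral_le_integral_norm _).trans ?_
      refine le_trans ?_ ((hnorm _ _ (hdec φ δ)).trans_eq (mul_assoc _ _ _).symm)
      refine integral_mono_of_nonneg (Eventually.of_forall fun _ => norm_nonneg _) (hi φ).norm
        (Eventually.of_forall fun p => ?_)
      beta_reduce
      rw [norm_mul]
      exact mul_le_of_le_one_left (norm_nonneg _) (hm1 p)⟩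
  exact ⟨ContinuousLinearMap.toPointwiseConvergenceCLM _ _ _ _ L, fun φ => rfl⟩

lemma Medium.hatU₀_mul_self (M : Medium) (ω : ℝ) (q : Plane) (z : ℝ) :
    M.hatU₀ ω q z * M.hatU₀ ω q z = M.hatU₀ ω q (2 * z) := by
  rw [Medium.hatU₀, Medium.hatU₀, ← Complex.exp_add]
  congr 1
  push_cast
  ring

variable {Ω : Type*} [MeasurableSpace Ω] {μ : Measure Ω}
  {V : Plane → Ω → ℝ}

/-- The integral that defines the profile converges absolutely, jointly with a test function. -/
lemma integrable_mul_profileIntegrand (M : Medium) (hΨ : IsSource Ψ) {φV : ℝ → ℂ}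
    (hφm : Measurable φV) (hφ1 : ∀ u, ‖φV u‖ ≤ 1) {E : Type*} [MeasurableSpace E]
    {ν : Measure E} [SFinite ν] {f : E → ℂ} (hf : Integrable f ν) {s : E → ℝ} {y : E → Plane}
    (hs : Measurable s) (hy : Measurable y) :
    Integrable (fun z : (ℝ × Plane) × E => f z.2 * profileIntegrand M Ψ φV (s z.2) (y z.2) z.1)
      ((volume : Measure (ℝ × Plane)).prod ν) := by
  have hc := continuous_sourceHat hΨ.integrable
  have hi : Integrable (fun p : ℝ × Plane => sourceHat Ψ p.1 p.2 * ((p.1 ^ 2 : ℝ) : ℂ)) :=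
    Continuous.integrable_of_hasCompactSupport (by fun_prop)
      (hΨ.compactSupport.mono fun p hp => left_ne_zero_of_mul hp)
  have h1 : Integrable (fun z : (ℝ × Plane) × E =>
      (sourceHat Ψ z.1.1 z.1.2 * ((z.1.1 ^ 2 : ℝ) : ℂ)) * f z.2)
      ((volume : Measure (ℝ × Plane)).prod ν) := hi.mul_prod hf
  have hU0 : Measurable (fun p : ℝ × Plane => M.hatU₀ p.1 p.2 (2 * M.zint)) :=
    (M.continuous_hatU₀.comp
      (by fun_prop : Continuous fun p : ℝ × Plane => (p.1, p.2, 2 * M.zint))).measurable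
  have hU : Measurable (fun z : (ℝ × Plane) × E => M.hatU₀ z.1.1 z.1.2 (2 * M.zint)) :=
    hU0.comp measurable_fst
  have hφ : Measurable (fun z : (ℝ × Plane) × E => φV (2 * z.1.1 * M.s₀)) :=
    hφm.comp ((measurable_fst.fst.const_mul 2).mul_const M.s₀)
  have hin : Measurable (fun z : (ℝ × Plane) × E => (inner ℝ z.1.2 (y z.2) : ℝ)) :=
    measurable_fst.snd.inner (hy.comp measurable_snd)
  have he : Measurable (fun z : (ℝ × Plane) × E =>
      Complex.exp (-Complex.I * ((z.1.1 * (s z.2 - inner ℝ z.1.2 (y z.2)) : ℝ) : ℂ)) *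
        M.hatU₀ z.1.1 z.1.2 (2 * M.zint) * φV (2 * z.1.1 * M.s₀)) := by
    refine Measurable.mul (Measurable.mul (Complex.measurable_exp.comp ?_) hU) hφ
    exact ((measurable_fst.fst.mul ((hs.comp measurable_snd).sub hin)).complex_ofReal).const_mul _
  have h2 := h1.bdd_mul (c := 1) he.aestronglyMeasurable (Eventually.of_forall fun z => by
    rw [norm_mul, norm_mul, norm_exp_neg_I_mul_ofReal, M.norm_hatU₀, one_mul, one_mul]
    exact hφ1 _)
  refine h2.congr (Eventually.of_forall fun z => ?_)
  simp only [profileIntegrand]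
  ring

lemma integrable_profileIntegrand (M : Medium) (hΨ : IsSource Ψ) {φV : ℝ → ℂ}
    (hφm : Measurable φV) (hφ1 : ∀ u, ‖φV u‖ ≤ 1) (s : ℝ) (y : Plane) :
    Integrable (profileIntegrand M Ψ φV s y) := by
  have h := integrable_mul_profileIntegrand M hΨ hφm hφ1 (E := Unit) (ν := Measure.dirac ())
    (f := fun _ => 1) (integrable_const _) (s := fun _ => s) (y := fun _ => y)
    measurable_const measurable_const
  simpa [integral_dirac] using h.integral_prod_left

lemma integrable_homogenizedProfile_mul (hΨ : IsSource Ψ) {φV : ℝ → ℂ}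
    (hφm : Measurable φV) (hφ1 : ∀ u, ‖φV u‖ ≤ 1) (φ : 𝓢(ObsSpace, ℂ)) :
    Integrable (fun p : ObsSpace => homogenizedProfile M Ψ φV p.1 p.2.1 * φ p) := by
  have h := (integrable_mul_profileIntegrand M hΨ hφm hφ1 (φ.integrable (μ := volume))
    (s := fun p : ObsSpace => p.1) (y := fun p : ObsSpace => p.2.1) (by fun_prop)
    (by fun_prop)).integral_prod_right.const_mul ((M.reflCoef / (2 * (2 * Real.pi) ^ 3) : ℝ) : ℂ)
  refine h.congr (Eventually.of_forall fun p => ?_)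
  simp only [homogenizedProfile, integral_const_mul]
  ring

/-- A reflector that imprints a phase which depends on the frequency only produces the homogenized
profile. -/
lemma reflectorPairing_eq_integral_homogenizedProfile (hΨ : IsSource Ψ) {φV : ℝ → ℂ}
    (hφm : Measurable φV) (hφ1 : ∀ u, ‖φV u‖ ≤ 1) (φ : 𝓢(ObsSpace, ℂ)) :
    reflectorPairing M Ψ 0 (fun p => φV (p.1 * (2 * M.s₀))) φ =
      ∫ p : ObsSpace, homogenizedProfile M Ψ φV p.1 p.2.1 * φ p := by
  obtain ⟨a, b, ha, hb, hab⟩ := hΨ.exists_band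
  obtain ⟨s, C, hC, hdec⟩ := exists_waveAmplitude_isDecaying M ha
  have h1 := integral_mul_interfaceDensity (M := M) hΨ ha hab (hdec φ 0)
    (m := fun ω => φV (ω * (2 * M.s₀))) (hφm.comp (by fun_prop)) (fun ω => hφ1 _)
  have hF := integrable_mul_profileIntegrand M hΨ hφm hφ1 (φ.integrable (μ := volume))
    (s := fun p : ObsSpace => p.1) (y := fun p : ObsSpace => p.2.1) (by fun_prop) (by fun_prop)
  have h2 : ∀ k : ℝ × Plane, φV (k.1 * (2 * M.s₀)) * ((k.1 ^ 2 : ℝ) : ℂ) *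
      (waveAmplitude M 0 φ k.1 k.2 * incidentAmplitude M Ψ k.1 k.2) =
      ∫ p : ObsSpace, φ p * profileIntegrand M Ψ φV p.1 p.2.1 k := by
    intro k
    have h3 : waveAmplitude M 0 φ k.1 k.2 * incidentAmplitude M Ψ k.1 k.2 =
        obsAmplitude 0 φ k.1 k.2 *
          (M.hatU₀ k.1 k.2 (2 * M.zint) * sourceHat Ψ k.1 k.2) := by
      rw [waveAmplitude, incidentAmplitude, ← M.hatU₀_mul_self]
      ring
    have h4 : ∀ p : ObsSpace, φ p * profileIntegrand M Ψ φV p.1 p.2.1 k =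
        (φV (k.1 * (2 * M.s₀)) * ((k.1 ^ 2 : ℝ) : ℂ) *
          (M.hatU₀ k.1 k.2 (2 * M.zint) * sourceHat Ψ k.1 k.2)) *
        (φ p * Complex.exp (-Complex.I *
          ((k.1 * (p.1 - inner ℝ k.2 (p.2.1 + (0 : ℝ) • p.2.2)) : ℝ) : ℂ))) := by
      intro p
      rw [zero_smul, add_zero, profileIntegrand, show 2 * k.1 * M.s₀ = k.1 * (2 * M.s₀) by ring]
      ring
    simp_rw [h4]
    rw [integral_const_mul, h3, obsAmplitude]
    ring
  rw [reflectorPairing, h1]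
  simp_rw [h2]
  rw [integral_integral_swap hF, ← integral_const_mul]
  congr 1
  ext p
  rw [integral_const_mul, homogenizedProfile]
  ring

lemma roughPhase_sub_phiV (M : Medium) (γ ε : ℝ) (p : ℝ × Plane) (w : Ω) :
    roughPhase M (fun x => V x w) γ ε p - phiV μ V (p.1 * (2 * M.s₀)) =
      centeredPhase μ V (p.1 * (2 * M.s₀))
        ((ε ^ γ)⁻¹ • M.xint + ((ε ^ γ)⁻¹ * √ε) • p.2) w := by
  rw [roughPhase, centeredPhase, smul_add, smul_smul]

lemma tendsto_rpow_nhdsGT_zero {r : ℝ} (hr : 0 < r) :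
    Tendsto (fun ε : ℝ => ε ^ r) (𝓝[>] 0) (𝓝[>] 0) := by
  refine tendsto_nhdsWithin_iff.mpr ⟨?_, ?_⟩
  · have := (Real.continuousAt_rpow_const 0 r (Or.inr hr.le)).tendsto
    rw [Real.zero_rpow hr.ne'] at this
    exact this.mono_left nhdsWithin_le_nhds
  · filter_upwards [self_mem_nhdsWithin] with ε hε using Real.rpow_pos_of_pos hε r

/-- On the scale `√ε` of the beam the interface fluctuations, of correlation length `ε^γ`, oscillate
infinitely fast. -/
lemma tendsto_inv_rpow_mul_sqrt {γ : ℝ} (hγ : 1 / 2 < γ) :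
    Tendsto (fun ε : ℝ => (ε ^ γ)⁻¹ * √ε) (𝓝[>] 0) atTop := by
  have h := tendsto_inv_nhdsGT_zero.comp (tendsto_rpow_nhdsGT_zero (sub_pos.mpr hγ))
  refine h.congr' ?_
  filter_upwards [self_mem_nhdsWithin] with ε hε
  have hε' : 0 < ε := hε
  rw [Function.comp_apply, Real.rpow_sub hε', inv_div, Real.sqrt_eq_rpow]
  field_simp

/-- For each test function, the pairings with the reflected wave front converge in probability. -/
lemma tendsto_measure_wavePairing [IsProbabilityMeasure μ] (hΨ : IsSource Ψ)
    (hV : IsInterfaceField μ V) {γ : ℝ} (hγ : 1 / 2 < γ) (φ : 𝓢(ObsSpace, ℂ)) {r : ℝ} (hr : 0 < r) :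
    Tendsto (fun ε => μ {w | r ≤ ‖wavePairing M Ψ (fun x => V x w) γ ε φ -
      reflectorPairing M Ψ 0 (fun p => phiV μ V (p.1 * (2 * M.s₀))) φ‖}) (𝓝[>] 0) (𝓝 0) := by
  obtain ⟨a, b, ha, hb, hab⟩ := hΨ.exists_band
  obtain ⟨s, C, hC, hdec⟩ := exists_waveAmplitude_isDecaying M ha
  set k : ℂ := ((M.reflCoef / (2 * (2 * Real.pi) ^ 3) : ℝ) : ℂ) with hk
  set H : ℝ → ℝ × Plane → ℂ := fun δ => interfaceDensity M Ψ (waveAmplitude M δ φ) with hH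
  have hHi : ∀ δ, Integrable (H δ) := fun δ => integrable_interfaceDensity hΨ ha hab (hdec φ δ)
  set Z : ℝ → Ω → ℂ := fun ε w => ∫ p, centeredPhase μ V (p.1 * (2 * M.s₀))
    ((ε ^ γ)⁻¹ • M.xint + ((ε ^ γ)⁻¹ * √ε) • p.2) w * H 0 p with hZ
  set D : ℝ → ℝ := fun ε => ∫ p, ‖H (ε ^ (γ - 1 / 2)) p - H 0 p‖ with hD
  have hZm : ∀ ε, Measurable (Z ε) := by
    intro ε
    have h1 : Measurable (fun z : Ω × (ℝ × Plane) => centeredPhase μ V (z.2.1 * (2 * M.s₀))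
        ((ε ^ γ)⁻¹ • M.xint + ((ε ^ γ)⁻¹ * √ε) • z.2.2) z.1) :=
      (measurable_centeredPhase hV).comp (by fun_prop : Measurable fun z : Ω × (ℝ × Plane) =>
        ((z.2.1 * (2 * M.s₀), (ε ^ γ)⁻¹ • M.xint + ((ε ^ γ)⁻¹ * √ε) • z.2.2), z.1))
    have h2 : Measurable (fun z : Ω × (ℝ × Plane) => H 0 z.2) :=
      (measurable_interfaceDensity M hΨ (hdec φ 0)).comp measurable_snd
    exact (h1.mul h2).stronglyMeasurable.integral_prod_right'.measurable
  have hZb : ∀ ε w, ‖Z ε w‖ ≤ ∫ p, 2 * ‖H 0 p‖ := by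
    intro ε w
    refine (norm_integral_le_integral_norm _).trans ?_
    refine integral_mono_of_nonneg (Eventually.of_forall fun _ => norm_nonneg _)
      ((hHi 0).norm.const_mul 2) (Eventually.of_forall fun p => ?_)
    beta_reduce
    rw [norm_mul]
    gcongr
    exact norm_centeredPhase_le V _ _ w
  have hZi : ∀ ε, Integrable (fun w => ‖Z ε w‖ ^ 2) μ := fun ε =>
    Integrable.of_bound ((hZm ε).norm.pow_const 2).aestronglyMeasurable
      ((∫ p, 2 * ‖H 0 p‖) ^ 2) (Eventually.of_forall fun w => by
        rw [Real.norm_of_nonneg (by positivity)]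
        gcongr
        exact hZb ε w)
  have hD0 : Tendsto D (𝓝[>] 0) (𝓝 0) :=
    tendsto_integral_norm_interfaceDensity_sub hΨ ha hab
      (fun ε : ℝ => hdec φ (ε ^ (γ - 1 / 2))) (hdec φ 0)
      (fun ω q => tendsto_waveAmplitude M φ ω q
        ((tendsto_rpow_nhdsGT_zero (sub_pos.mpr hγ)).mono_right nhdsWithin_le_nhds))
  have hZ0 : Tendsto (fun ε => ∫ w, ‖Z ε w‖ ^ 2 ∂μ) (𝓝[>] 0) (𝓝 0) :=
    tendsto_integral_norm_sq_centeredPhase hV (hHi 0) (2 * M.s₀)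
      (fun ε : ℝ => (ε ^ γ)⁻¹ • M.xint) (tendsto_inv_rpow_mul_sqrt hγ)
  -- the error splits into the change of the density and the fluctuations of the phase
  have hsplit : ∀ ε > 0, ∀ w, ‖wavePairing M Ψ (fun x => V x w) γ ε φ -
      reflectorPairing M Ψ 0 (fun p => phiV μ V (p.1 * (2 * M.s₀))) φ‖ ≤
        ‖k‖ * (D ε + ‖Z ε w‖) := by
    intro ε hε w
    have hRm := measurable_roughPhase M (hV.continuous w) γ ε
    have hRb := norm_roughPhase M (fun x => V x w) γ ε
    have hRi : ∀ {f : ℝ × Plane → ℂ}, Integrable f →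
        Integrable (fun p => roughPhase M (fun x => V x w) γ ε p * f p) := fun hf =>
      hf.bdd_mul (c := 1) hRm.aestronglyMeasurable (Eventually.of_forall fun p => (hRb p).le)
    have hPi : Integrable (fun p : ℝ × Plane => phiV μ V (p.1 * (2 * M.s₀)) * H 0 p) :=
      (hHi 0).bdd_mul (c := 1) ((continuous_phiV (hV.measurable 0)).comp
        (by fun_prop : Continuous fun p : ℝ × Plane =>
          p.1 * (2 * M.s₀))).aestronglyMeasurable (Eventually.of_forall fun p => norm_phiV_le V _)
    have e1 : Z ε w = (∫ p, roughPhase M (fun x => V x w) γ ε p * H 0 p) -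
        ∫ p : ℝ × Plane, phiV μ V (p.1 * (2 * M.s₀)) * H 0 p := by
      rw [← integral_sub (hRi (hHi 0)) hPi]
      simp only [hZ]
      congr 1
      ext p
      rw [← roughPhase_sub_phiV, sub_mul]
    have e2 : ∫ p, roughPhase M (fun x => V x w) γ ε p * (H (ε ^ (γ - 1 / 2)) p - H 0 p) =
        (∫ p, roughPhase M (fun x => V x w) γ ε p * H (ε ^ (γ - 1 / 2)) p) -
          ∫ p, roughPhase M (fun x => V x w) γ ε p * H 0 p := by
      rw [← integral_sub (hRi (hHi _)) (hRi (hHi 0))]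
      simp_rw [mul_sub]
    have e3 : ‖∫ p, roughPhase M (fun x => V x w) γ ε p *
        (H (ε ^ (γ - 1 / 2)) p - H 0 p)‖ ≤ D ε := by
      refine (norm_integral_le_integral_norm _).trans_eq ?_
      simp_rw [norm_mul, hRb, one_mul]
      rfl
    rw [wavePairing_eq M hΨ (hV.continuous w) γ hε, reflectorPairing, ← mul_sub, norm_mul]
    refine mul_le_mul_of_nonneg_left ?_ (norm_nonneg _)
    rw [show (∫ p, roughPhase M (fun x => V x w) γ ε p * H (ε ^ (γ - 1 / 2)) p) -
        ∫ p : ℝ × Plane, phiV μ V (p.1 * (2 * M.s₀)) * H 0 p =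
      (∫ p, roughPhase M (fun x => V x w) γ ε p * (H (ε ^ (γ - 1 / 2)) p - H 0 p)) + Z ε w by
        rw [e1, e2]; ring]
    exact (norm_add_le _ _).trans (by gcongr)
  -- once `D ε` is below the threshold `t`, only the fluctuations can make the error exceed `r`, and
  -- Chebyshev bounds their probability
  set t : ℝ := r / (2 * (‖k‖ + 1)) with ht
  have ht0 : 0 < t := by positivity
  have hle : ∀ᶠ ε in 𝓝[>] (0 : ℝ), μ {w | r ≤ ‖wavePairing M Ψ (fun x => V x w) γ ε φ -
      reflectorPairing M Ψ 0 (fun p => phiV μ V (p.1 * (2 * M.s₀))) φ‖} ≤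
        ENNReal.ofReal ((∫ w, ‖Z ε w‖ ^ 2 ∂μ) / t ^ 2) := by
    filter_upwards [self_mem_nhdsWithin, hD0.eventually (gt_mem_nhds ht0)] with ε hε hDε
    have hsub : {w | r ≤ ‖wavePairing M Ψ (fun x => V x w) γ ε φ -
        reflectorPairing M Ψ 0 (fun p => phiV μ V (p.1 * (2 * M.s₀))) φ‖} ⊆
        {w | t ^ 2 ≤ ‖Z ε w‖ ^ 2} := by
      intro w hw
      have h1 : r ≤ ‖k‖ * (D ε + ‖Z ε w‖) := le_trans hw (hsplit ε hε w)
      have hD0' : 0 ≤ D ε := integral_nonneg fun _ => norm_nonneg _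
      have h2 : r ≤ (‖k‖ + 1) * (D ε + ‖Z ε w‖) := by
        have : 0 ≤ D ε + ‖Z ε w‖ := by positivity
        linarith
      have h3 : (‖k‖ + 1) * (2 * t) = r := by rw [ht]; field_simp
      have h4 : 2 * t ≤ D ε + ‖Z ε w‖ :=
        le_of_mul_le_mul_left (h3.trans_le h2) (by positivity)
      have h5 : t ≤ ‖Z ε w‖ := by linarith
      exact pow_le_pow_left₀ ht0.le h5 2
    refine (measure_mono hsub).trans ?_
    have hmk := mul_meas_ge_le_integral_of_nonneg (μ := μ)
      (Eventually.of_forall fun w => by positivity) (hZi ε) (t ^ 2)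
    rw [← ofReal_measureReal]
    refine ENNReal.ofReal_le_ofReal ?_
    rw [le_div_iff₀ (by positivity), mul_comm]
    exact hmk
  have hlim : Tendsto (fun ε => ENNReal.ofReal ((∫ w, ‖Z ε w‖ ^ 2 ∂μ) / t ^ 2)) (𝓝[>] 0)
      (𝓝 0) := by
    have := (ENNReal.continuous_ofReal.tendsto 0).comp
      (by simpa using hZ0.div_const (t ^ 2) : Tendsto (fun ε => (∫ w, ‖Z ε w‖ ^ 2 ∂μ) / t ^ 2)
        (𝓝[>] 0) (𝓝 0))
    simpa [Function.comp_def] using this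
  exact tendsto_of_tendsto_of_tendsto_of_le_of_le' tendsto_const_nhds hlim
    (Eventually.of_forall fun _ => zero_le) hle

/-- Convergence in probability of random tempered distributions follows from convergence in
probability of their pairings with each test function. -/
lemma tendstoInProbability_of_forall {T : ℝ → Ω → 𝓢'(ObsSpace, ℂ)} {T₀ : 𝓢'(ObsSpace, ℂ)}
    (h : ∀ (φ : 𝓢(ObsSpace, ℂ)) (r : ℝ), 0 < r →
      Tendsto (fun ε => μ {w | r ≤ ‖T ε w φ - T₀ φ‖}) (𝓝[>] 0) (𝓝 0)) :
    TendstoInProbability μ T T₀ := by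
  intro N hN
  obtain ⟨⟨S, W⟩, ⟨hS, hW⟩, hSW⟩ := PointwiseConvergenceCLM.hasBasis_nhds_zero.mem_iff.mp hN
  obtain ⟨r, hr, hrW⟩ := Metric.mem_nhds_iff.mp hW
  have hSf : S.Finite := hS
  have hsum : Tendsto (fun ε => ∑ φ ∈ hSf.toFinset, μ {w | r ≤ ‖T ε w φ - T₀ φ‖}) (𝓝[>] 0)
      (𝓝 0) := by
    have := tendsto_finsetSum hSf.toFinset fun φ _ => h φ r hr
    simpa using this
  refine tendsto_of_tendsto_of_tendsto_of_le_of_le tendsto_const_nhds hsum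
    (fun _ => zero_le) fun ε => ?_
  refine le_trans (measure_mono ?_) (measure_biUnion_finset_le hSf.toFinset _)
  intro w hw
  by_contra hcon
  simp only [Set.mem_iUnion, not_exists, Set.Finite.mem_toFinset] at hcon
  refine hw (hSW fun φ hφ => hrW ?_)
  have := hcon φ hφ
  rw [mem_ball_zero_iff]
  exact not_le.mp this

/-- The reflected wave front is a random tempered distribution which converges in probability to
the homogenized profile. -/
theorem exists_waveFront_tendsto [IsProbabilityMeasure μ] (M : Medium) (hΨ : IsSource Ψ)
    (hV : IsInterfaceField μ V) {γ : ℝ} (hγ : 1 / 2 < γ) :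
    ∃ (Uε : ℝ → Ω → 𝓢'(ObsSpace, ℂ)) (U : 𝓢'(ObsSpace, ℂ)),
      (∀ ε > 0, ∀ w (φ : 𝓢(ObsSpace, ℂ)),
        Uε ε w φ = wavePairing M Ψ (fun x => V x w) γ ε φ) ∧
      (∀ ε > 0, ∀ φ : 𝓢(ObsSpace, ℂ), Measurable (fun w => Uε ε w φ)) ∧
      (∀ φ : 𝓢(ObsSpace, ℂ),
        Integrable (fun p : ObsSpace =>
          homogenizedProfile M Ψ (phiV μ V) p.1 p.2.1 * φ p) ∧
        U φ = ∫ p : ObsSpace,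
          homogenizedProfile M Ψ (phiV μ V) p.1 p.2.1 * φ p) ∧
      TendstoInProbability μ Uε U := by
  have hφm := (continuous_phiV (μ := μ) (hV.measurable 0)).measurable
  have hφ1 := norm_phiV_le (μ := μ) V
  have hex : ∀ (ε : ℝ) (w : Ω), ∃ T : 𝓢'(ObsSpace, ℂ), ∀ φ : 𝓢(ObsSpace, ℂ),
      T φ = reflectorPairing M Ψ (ε ^ (γ - 1 / 2)) (roughPhase M (fun x => V x w) γ ε) φ :=
    fun ε w => exists_temperedDistribution_reflectorPairing hΨ _
      (measurable_roughPhase M (hV.continuous w) γ ε)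
      fun p => (norm_roughPhase M (fun x => V x w) γ ε p).le
  choose Uε hUε using hex
  obtain ⟨U, hU⟩ := exists_temperedDistribution_reflectorPairing (M := M) hΨ 0
    (m := fun p => phiV μ V (p.1 * (2 * M.s₀))) (hφm.comp (by fun_prop)) (fun p => hφ1 _)
  have hpair : ∀ ε > 0, ∀ w (φ : 𝓢(ObsSpace, ℂ)),
      Uε ε w φ = wavePairing M Ψ (fun x => V x w) γ ε φ := fun ε hε w φ => by
    rw [hUε, wavePairing_eq M hΨ (hV.continuous w) γ hε, reflectorPairing]
  refine ⟨Uε, U, hpair, ?_, ?_, ?_⟩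
  · intro ε _ φ
    obtain ⟨a, b, ha, hb, hab⟩ := hΨ.exists_band
    obtain ⟨s, C, hC, hdec⟩ := exists_waveAmplitude_isDecaying M ha
    simp_rw [hUε, reflectorPairing]
    refine Measurable.const_mul ?_ _
    have h1 : Measurable (fun z : Ω × (ℝ × Plane) =>
        V ((ε ^ γ)⁻¹ • (M.xint + √ε • z.2.2)) z.1) :=
      hV.measurable_uncurry.comp (by fun_prop : Measurable fun z : Ω × (ℝ × Plane) =>
        ((ε ^ γ)⁻¹ • (M.xint + √ε • z.2.2), z.1))
    have h2 : Measurable (fun z : Ω × (ℝ × Plane) =>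
        roughPhase M (fun x => V x z.1) γ ε z.2) :=
      Complex.measurable_exp.comp
        (((measurable_snd.fst.mul_const (2 * M.s₀)).mul h1).complex_ofReal.const_mul Complex.I)
    have h3 : Measurable (fun z : Ω × (ℝ × Plane) =>
        interfaceDensity M Ψ (waveAmplitude M (ε ^ (γ - 1 / 2)) φ) z.2) :=
      (measurable_interfaceDensity M hΨ (hdec φ _)).comp measurable_snd
    exact (h2.mul h3).stronglyMeasurable.integral_prod_right'.measurable
  · intro φ
    refine ⟨integrable_homogenizedProfile_mul hΨ hφm hφ1 φ, ?_⟩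
    rw [hU, reflectorPairing_eq_integral_homogenizedProfile hΨ hφm hφ1]
  · refine tendstoInProbability_of_forall fun φ r hr => ?_
    refine (tendsto_measure_wavePairing (M := M) hΨ hV hγ φ hr).congr' ?_
    filter_upwards [self_mem_nhdsWithin] with ε hε
    simp_rw [hpair ε hε, hU]

end WaveFront

instance isAddHaarMeasure_volume_real_prod_plane :
    (volume : Measure (ℝ × Plane)).IsAddHaarMeasure :=
  Measure.prod.instIsAddHaarMeasure (volume : Measure ℝ) (volume : Measure Plane)

/-! ### Fourier inversion for sources -/

section Inversion

open FourierTransform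

/-- The source as a function on the Euclidean space `ℝ ×₂ ℝ²`, on which Fourier inversion is
available. -/
noncomputable def euclideanSource (Ξ : ℝ × Plane → ℝ) (v : WithLp 2 (ℝ × Plane)) : ℂ :=
  (Ξ (WithLp.ofLp v) : ℂ)

variable {Ξ : ℝ × Plane → ℝ}

lemma integral_withLp_eq (f : WithLp 2 (ℝ × Plane) → ℂ) :
    ∫ v, f v = ∫ p : ℝ × Plane, f (WithLp.toLp 2 p) :=
  ((WithLp.volume_preserving_toLp ℝ Plane).integral_comp
    (MeasurableEquiv.toLp 2 (ℝ × Plane)).measurableEmbedding f).symm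

lemma integrable_withLp_iff {f : WithLp 2 (ℝ × Plane) → ℂ} :
    Integrable (fun p : ℝ × Plane => f (WithLp.toLp 2 p)) ↔ Integrable f :=
  (WithLp.volume_preserving_toLp ℝ Plane).integrable_comp_emb
    (MeasurableEquiv.toLp 2 (ℝ × Plane)).measurableEmbedding

lemma integrable_euclideanSource (hΞ : Integrable Ξ) : Integrable (euclideanSource Ξ) :=
  integrable_withLp_iff.mp hΞ.ofReal

lemma fourier_euclideanSource (Ξ : ℝ × Plane → ℝ) (ω : ℝ) (k : Plane) :
    𝓕 (euclideanSource Ξ) (WithLp.toLp 2 (-(2 * Real.pi)⁻¹ * ω, (ω / (2 * Real.pi)) • k)) =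
      sourceHat Ξ ω k := by
  rw [Real.fourier_eq', integral_withLp_eq, sourceHat]
  congr 1
  ext p
  rw [smul_eq_mul, mul_comm, euclideanSource, WithLp.prod_inner_apply]
  congr 2
  have h : -2 * Real.pi * (inner ℝ p.1 (-(2 * Real.pi)⁻¹ * ω) +
      inner ℝ p.2 ((ω / (2 * Real.pi)) • k)) = ω * (p.1 - inner ℝ k p.2) := by
    rw [inner_smul_right, real_inner_comm k p.2]
    simp only [RCLike.inner_apply, conj_trivial]
    field_simp
    ring
  rw [mul_comm Complex.I]
  exact congrArg (fun t : ℝ => (t : ℂ) * Complex.I) h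

/-- The spectrum of a source is compact also in the wave vector `ωk`; this uses that the low
frequencies are absent. -/
lemma IsSource.hasCompactSupport_fourier (hΞ : IsSource Ξ) :
    HasCompactSupport (𝓕 (euclideanSource Ξ)) := by
  obtain ⟨a, b, ha, hb, hab⟩ := hΞ.exists_band
  have hc : Continuous (𝓕 (euclideanSource Ξ)) :=
    continuous_fourier_of_integrable (integrable_euclideanSource hΞ.integrable)
  -- away from frequency zero, the two parametrizations of the spectrum are equivalent
  have hne : ∀ (η : ℝ) (κ : Plane), η ≠ 0 → 𝓕 (euclideanSource Ξ) (WithLp.toLp 2 (η, κ)) ≠ 0 →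
      a ≤ 2 * Real.pi * |η| ∧ 2 * Real.pi * |η| ≤ b ∧ ‖κ‖ ≤ b ^ 2 := by
    intro η κ hη h
    set ω := -(2 * Real.pi) * η with hω
    have hω0 : ω ≠ 0 := by
      rw [hω]
      exact mul_ne_zero (by simp [Real.pi_ne_zero]) hη
    have h1 := fourier_euclideanSource Ξ ω ((2 * Real.pi / ω) • κ)
    have e1 : -(2 * Real.pi)⁻¹ * ω = η := by rw [hω]; field_simp
    have e2 : (ω / (2 * Real.pi)) • (2 * Real.pi / ω) • κ = κ := by
      rw [smul_smul, div_mul_div_cancel₀ (by positivity), div_self hω0, one_smul]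
    rw [e1, e2] at h1
    rw [h1] at h
    obtain ⟨h2, h3, h4⟩ := hab _ _ h
    have e3 : |ω| = 2 * Real.pi * |η| := by
      rw [hω, abs_mul, abs_neg, abs_of_pos (by positivity)]
    rw [← e3]
    refine ⟨h2, h3, ?_⟩
    rw [norm_smul, norm_div, Real.norm_of_nonneg (by positivity : 0 ≤ 2 * Real.pi),
      Real.norm_eq_abs, div_mul_eq_mul_div, div_le_iff₀ (abs_pos.mpr hω0)] at h4
    have h5 : (1 : ℝ) ≤ 2 * Real.pi := by linarith [Real.pi_gt_three]
    have h6 := norm_nonneg κ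
    nlinarith
  have hzero : ∀ κ : Plane, 𝓕 (euclideanSource Ξ) (WithLp.toLp 2 ((0 : ℝ), κ)) = 0 := by
    intro κ
    have hcont : Continuous (fun η : ℝ => 𝓕 (euclideanSource Ξ) (WithLp.toLp 2 (η, κ))) :=
      hc.comp ((WithLp.prod_continuous_toLp 2 ℝ Plane).comp (by fun_prop))
    have hlim := (hcont.tendsto 0).mono_left (nhdsWithin_le_nhds (s := {0}ᶜ))
    refine tendsto_nhds_unique hlim (tendsto_const_nhds.congr' ?_)
    have hsmall : ∀ᶠ η : ℝ in 𝓝[≠] 0, 2 * Real.pi * |η| < a := by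
      have : Tendsto (fun η : ℝ => 2 * Real.pi * |η|) (𝓝 0) (𝓝 0) := by
        have h : Continuous (fun η : ℝ => 2 * Real.pi * |η|) := by fun_prop
        simpa using h.tendsto 0
      exact (this.eventually (gt_mem_nhds ha)).filter_mono nhdsWithin_le_nhds
    filter_upwards [hsmall, self_mem_nhdsWithin] with η h1 h2
    by_contra h
    exact absurd (hne η κ h2 (Ne.symm h)).1 (not_le.mpr h1)
  refine HasCompactSupport.of_support_subset_isCompact (isCompact_closedBall 0 (b + b ^ 2)) ?_
  intro v hv
  have hv' : 𝓕 (euclideanSource Ξ) (WithLp.toLp 2 (v.fst, v.snd)) ≠ 0 := hv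
  have hη : v.fst ≠ 0 := by
    intro h
    rw [h] at hv'
    exact hv' (hzero _)
  obtain ⟨-, h1, h2⟩ := hne _ _ hη hv'
  have h3 : (1 : ℝ) ≤ 2 * Real.pi := by linarith [Real.pi_gt_three]
  have h4 : |v.fst| ≤ b := by nlinarith [abs_nonneg v.fst]
  rw [mem_closedBall_zero_iff, WithLp.prod_norm_eq_of_L2, Real.sqrt_le_left (by positivity)]
  rw [Real.norm_eq_abs]
  nlinarith [abs_nonneg v.fst, norm_nonneg v.snd]

lemma IsSource.integrable_fourier (hΞ : IsSource Ξ) : Integrable (𝓕 (euclideanSource Ξ)) :=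
  (continuous_fourier_of_integrable (integrable_euclideanSource
    hΞ.integrable)).integrable_of_hasCompactSupport hΞ.hasCompactSupport_fourier

lemma IsSource.fourierInv_fourier (hΞ : IsSource Ξ) (p : ℝ × Plane) :
    𝓕⁻ (𝓕 (euclideanSource Ξ)) (WithLp.toLp 2 p) = (Ξ p : ℂ) := by
  have hc : Continuous (euclideanSource Ξ) :=
    Complex.continuous_ofReal.comp (hΞ.continuous.comp (WithLp.prod_continuous_ofLp 2 ℝ Plane))
  rw [hc.fourierInv_fourier_eq (integrable_euclideanSource hΞ.integrable) hΞ.integrable_fourier]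
  rfl

/-- Sources are bounded: their spectra are integrable. -/
lemma IsSource.exists_bound (hΞ : IsSource Ξ) : ∃ C, ∀ p, |Ξ p| ≤ C := by
  refine ⟨∫ w, ‖𝓕 (euclideanSource Ξ) w‖, fun p => ?_⟩
  rw [← Real.norm_eq_abs, ← Complex.norm_real, ← hΞ.fourierInv_fourier p, Real.fourierInv_eq]
  refine (norm_integral_le_integral_norm _).trans_eq ?_
  simp

/-- Fourier inversion in the variables frequency and slowness; the Jacobian is `ω²/(2π)³`. -/
lemma IsSource.inversion (hΞ : IsSource Ξ) (s : ℝ) (y : Plane) :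
    ((1 / (2 * Real.pi) ^ 3 : ℝ) : ℂ) * ∫ p : ℝ × Plane,
      Complex.exp (-Complex.I * ((p.1 * (s - inner ℝ y p.2) : ℝ) : ℂ)) *
        sourceHat Ξ p.1 p.2 * ((p.1 ^ 2 : ℝ) : ℂ) = (Ξ (s, y) : ℂ) := by
  set F : ℝ × Plane → ℂ := fun p =>
    Complex.exp (((2 * Real.pi * (p.1 * s + inner ℝ p.2 y) : ℝ) : ℂ) * Complex.I) *
      𝓕 (euclideanSource Ξ) (WithLp.toLp 2 p) with hF
  set G : ℝ × Plane → ℂ := fun p =>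
    Complex.exp (-Complex.I * ((p.1 * (s - inner ℝ y p.2) : ℝ) : ℂ)) *
        sourceHat Ξ p.1 p.2 * ((p.1 ^ 2 : ℝ) : ℂ) with hG
  have hGi : Integrable G := by
    have hc := continuous_sourceHat hΞ.integrable
    refine Continuous.integrable_of_hasCompactSupport (by fun_prop) ?_
    exact hΞ.compactSupport.mono fun p hp => right_ne_zero_of_mul (left_ne_zero_of_mul hp)
  have hFi : Integrable F := by
    refine (integrable_withLp_iff.mpr hΞ.integrable_fourier).bdd_mul (c := 1)
      (Continuous.aestronglyMeasurable (by fun_prop)) (Eventually.of_forall fun p => ?_)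
    rw [Complex.norm_exp_ofReal_mul_I]
  have h1 : (Ξ (s, y) : ℂ) = ∫ p, F p := by
    rw [← hΞ.fourierInv_fourier (s, y), Real.fourierInv_eq', integral_withLp_eq]
    congr 1
    ext p
    rw [smul_eq_mul, WithLp.prod_inner_apply]
    simp only [hF, RCLike.inner_apply, conj_trivial]
    rw [mul_comm s p.1]
  -- substitute the wave vector for the slowness, and the angular frequency for the frequency
  have h2 : ∀ ω : ℝ, ω ≠ 0 → ∫ κ, F (-(2 * Real.pi)⁻¹ * ω, κ) =
      ((1 / (2 * Real.pi) ^ 2 : ℝ) : ℂ) * ∫ q, G (ω, q) := by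
    intro ω hω
    have hc : ω / (2 * Real.pi) ≠ 0 := div_ne_zero hω (by positivity)
    have h3 := Measure.integral_comp_smul (volume : Measure Plane)
      (fun κ => F (-(2 * Real.pi)⁻¹ * ω, κ)) (ω / (2 * Real.pi))
    rw [finrank_euclideanSpace_fin, abs_of_nonneg (by positivity)] at h3
    have h4 : ∀ q : Plane, F (-(2 * Real.pi)⁻¹ * ω, (ω / (2 * Real.pi)) • q) =
        Complex.exp (-Complex.I * ((ω * (s - inner ℝ y q) : ℝ) : ℂ)) * sourceHat Ξ ω q := by
      intro q
      simp only [hF, fourier_euclideanSource]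
      congr 2
      have h6 : 2 * Real.pi * (-(2 * Real.pi)⁻¹ * ω * s + inner ℝ ((ω / (2 * Real.pi)) • q) y) =
          -(ω * (s - inner ℝ y q)) := by
        rw [real_inner_smul_left, real_inner_comm y q]
        field_simp
        ring
      rw [h6, Complex.ofReal_neg]
      ring
    simp_rw [h4] at h3
    rw [inv_smul_eq_iff₀ (pow_ne_zero 2 hc) |>.mp h3.symm]
    simp only [hG]
    rw [integral_mul_const, Complex.real_smul]
    push_cast
    ring
  have h5 : ∫ p, F p =
      ((1 / (2 * Real.pi) : ℝ) : ℂ) * ∫ ω : ℝ, ∫ κ, F (-(2 * Real.pi)⁻¹ * ω, κ) := by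
    have h6 := Measure.integral_comp_mul_left (fun η : ℝ => ∫ κ, F (η, κ)) (-(2 * Real.pi)⁻¹)
    rw [h6, show (volume : Measure (ℝ × Plane)) = (volume : Measure ℝ).prod volume from rfl,
      integral_prod _ hFi, Complex.real_smul, ← mul_assoc, ← Complex.ofReal_mul]
    have : 1 / (2 * Real.pi) * |(-(2 * Real.pi)⁻¹)⁻¹| = 1 := by
      rw [inv_neg, inv_inv, abs_neg, abs_of_pos (by positivity)]
      field_simp
    rw [this, Complex.ofReal_one, one_mul]
  have h7 : ∫ ω : ℝ, ∫ κ, F (-(2 * Real.pi)⁻¹ * ω, κ) =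
      ((1 / (2 * Real.pi) ^ 2 : ℝ) : ℂ) * ∫ p, G p := by
    rw [show (volume : Measure (ℝ × Plane)) = (volume : Measure ℝ).prod volume from rfl,
      integral_prod _ hGi, ← integral_const_mul]
    have hne : ∀ᵐ ω : ℝ, ω ≠ 0 := by simp [ae_iff]
    refine integral_congr_ae ?_
    filter_upwards [hne] with ω hω using h2 ω hω
  rw [h1, h5, h7, ← mul_assoc, ← Complex.ofReal_mul]
  congr 2
  field_simp

end Inversion

/-! ### The time convolution of the source with the height density -/

section Convolution

lemma integrable_density {Ω : Type*} [MeasurableSpace Ω] {μ : Measure Ω} [IsProbabilityMeasure μ]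
    {X : Ω → ℝ} (hX : Measurable X) {fV : ℝ → ℝ} (hf : Measurable fV) (hf0 : ∀ x, 0 ≤ fV x)
    (h : μ.map X = volume.withDensity (fun x => ENNReal.ofReal (fV x))) : Integrable fV := by
  refine ⟨hf.aestronglyMeasurable, ?_⟩
  rw [hasFiniteIntegral_iff_ofReal (Eventually.of_forall hf0)]
  have h1 := congrArg (fun ν => ν Set.univ) h
  simp only [withDensity_apply _ MeasurableSet.univ, Measure.restrict_univ,
    Measure.map_apply hX MeasurableSet.univ, Set.preimage_univ, measure_univ] at h1
  rw [← h1]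
  exact ENNReal.one_lt_top

variable {M : Medium} {fV : ℝ → ℝ} {Ψ : ℝ × Plane → ℝ}

lemma integrable_scaledDensity (hf : Integrable fV) : Integrable (scaledDensity M fV) := by
  unfold scaledDensity
  have hs := M.s₀_pos
  exact ((hf.comp_div (by positivity : 2 * M.s₀ ≠ 0))).const_mul _

/-- The Fourier transform of the scaled density is the characteristic function of the phase. -/
lemma integral_scaledDensity_mul_exp {Ω : Type*} [MeasurableSpace Ω] {μ : Measure Ω}
    {V : Plane → Ω → ℝ} (hV : Measurable (V 0)) (hf : Measurable fV) (hf0 : ∀ x, 0 ≤ fV x)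
    (h : μ.map (V 0) = volume.withDensity (fun x => ENNReal.ofReal (fV x))) (ω : ℝ) :
    ∫ s : ℝ, (scaledDensity M fV s : ℂ) * Complex.exp (Complex.I * ((ω * s : ℝ) : ℂ)) =
      phiV μ V (2 * ω * M.s₀) := by
  have hs := M.s₀_pos
  have h1 : phiV μ V (2 * ω * M.s₀) =
      ∫ t : ℝ, (fV t : ℂ) * Complex.exp (Complex.I * ((2 * ω * M.s₀ * t : ℝ) : ℂ)) := by
    have h2 : phiV μ V (2 * ω * M.s₀) =
        ∫ t : ℝ, Complex.exp (Complex.I * ((2 * ω * M.s₀ * t : ℝ) : ℂ)) ∂(μ.map (V 0)) :=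
      (integral_map (f := fun t : ℝ => Complex.exp (Complex.I * ((2 * ω * M.s₀ * t : ℝ) : ℂ)))
        hV.aemeasurable (Continuous.aestronglyMeasurable (by fun_prop))).symm
    rw [h2, h, integral_withDensity_eq_integral_toReal_smul hf.ennreal_ofReal
      (Eventually.of_forall fun _ => ENNReal.ofReal_lt_top)]
    simp only [ENNReal.toReal_ofReal (hf0 _), Complex.real_smul]
  rw [h1]
  have h3 := Measure.integral_comp_div (fun t : ℝ =>
    ((1 / (2 * M.s₀) : ℝ) : ℂ) * ((fV t : ℂ) *
      Complex.exp (Complex.I * ((2 * ω * M.s₀ * t : ℝ) : ℂ)))) (2 * M.s₀)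
  have h4 : ((2 * M.s₀ : ℝ) : ℂ) * ((1 / (2 * M.s₀) : ℝ) : ℂ) = 1 := by
    rw [← Complex.ofReal_mul, mul_one_div_cancel (by positivity), Complex.ofReal_one]
  rw [integral_const_mul (μ := volume) _ (fun t : ℝ => (fV t : ℂ) *
    Complex.exp (Complex.I * ((2 * ω * M.s₀ * t : ℝ) : ℂ))), abs_of_pos (by positivity),
    Complex.real_smul, ← mul_assoc, h4, one_mul] at h3
  rw [← h3]
  congr 1
  ext s
  rw [scaledDensity, Complex.ofReal_mul, mul_assoc]
  congr 4
  field_simp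

lemma integrable_mul_shift {Φ : ℝ → ℝ} (hΦ : Integrable Φ) (hΨ : IsSource Ψ) (s : ℝ) (y : Plane) :
    Integrable (fun s' : ℝ => Φ s' * Ψ (s - s', y)) := by
  obtain ⟨C, hC⟩ := hΨ.exists_bound
  have := hΨ.continuous
  exact hΦ.mul_bdd (c := C) (Continuous.aestronglyMeasurable (by fun_prop))
    (Eventually.of_forall fun s' => hC _)

lemma integrable_timeConv_integrand {Φ : ℝ → ℝ} (hΦ : Integrable Φ) (hΨ : Integrable Ψ) :
    Integrable (fun z : (ℝ × Plane) × ℝ => Φ z.2 * Ψ (z.1.1 - z.2, z.1.2)) := by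
  have h1 : Integrable (fun z : ℝ × (ℝ × Plane) => Φ z.1 * Ψ z.2) := hΦ.mul_prod hΨ
  have hmp : MeasurePreserving (fun z : ℝ × (ℝ × Plane) => (z.1, z.2 + (-z.1, (0 : Plane))))
      ((volume : Measure ℝ).prod (volume : Measure (ℝ × Plane)))
      ((volume : Measure ℝ).prod (volume : Measure (ℝ × Plane))) := by
    refine (MeasurePreserving.id volume).skew_product (g := fun t p => p + (-t, (0 : Plane)))
      (by fun_prop) (Eventually.of_forall fun t => ?_)
    exact map_add_right_eq_self _ _
  have h2 := hmp.integrable_comp_of_integrable h1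
  have h3 := h2.swap
  refine h3.congr (Eventually.of_forall fun z => ?_)
  have h4 : z.1 + (-z.2, (0 : Plane)) = (z.1.1 - z.2, z.1.2) :=
    Prod.ext (sub_eq_add_neg _ _).symm (add_zero _)
  simp only [Function.comp_apply, Prod.fst_swap, Prod.snd_swap, h4]

lemma integrable_timeConv {Φ : ℝ → ℝ} (hΦ : Integrable Φ) (hΨ : Integrable Ψ) :
    Integrable (timeConv Φ Ψ) :=
  (integrable_timeConv_integrand hΦ hΨ).integral_prod_left

/-- The convolution theorem, in the time variable only. -/
lemma sourceHat_timeConv {Φ : ℝ → ℝ} (hΦ : Integrable Φ) (hΨ : Integrable Ψ) (ω : ℝ) (k : Plane) :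
    sourceHat (timeConv Φ Ψ) ω k =
      (∫ s : ℝ, (Φ s : ℂ) * Complex.exp (Complex.I * ((ω * s : ℝ) : ℂ))) * sourceHat Ψ ω k := by
  have hint : Integrable (fun z : (ℝ × Plane) × ℝ =>
      ((Φ z.2 * Ψ (z.1.1 - z.2, z.1.2) : ℝ) : ℂ) *
        Complex.exp (Complex.I * ((ω * (z.1.1 - inner ℝ k z.1.2) : ℝ) : ℂ)))
      ((volume : Measure (ℝ × Plane)).prod volume) :=
    (integrable_timeConv_integrand hΦ hΨ).ofReal.mul_bdd (c := 1)
      (Continuous.aestronglyMeasurable (by fun_prop))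
      (Eventually.of_forall fun z => (Complex.norm_exp_I_mul_ofReal _).le)
  have h1 : sourceHat (timeConv Φ Ψ) ω k = ∫ p : ℝ × Plane, ∫ s : ℝ,
      ((Φ s * Ψ (p.1 - s, p.2) : ℝ) : ℂ) *
        Complex.exp (Complex.I * ((ω * (p.1 - inner ℝ k p.2) : ℝ) : ℂ)) := by
    rw [sourceHat]
    congr 1
    ext p
    rw [integral_mul_const, integral_complex_ofReal, timeConv]
  rw [h1, integral_integral_swap hint, ← integral_mul_const]
  congr 1
  ext s
  have h2 := integral_add_right_eq_self (μ := (volume : Measure (ℝ × Plane)))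
    (fun p : ℝ × Plane => ((Φ s * Ψ (p.1 - s, p.2) : ℝ) : ℂ) *
        Complex.exp (Complex.I * ((ω * (p.1 - inner ℝ k p.2) : ℝ) : ℂ))) (s, 0)
  rw [← h2, sourceHat, ← integral_const_mul]
  congr 1
  ext p
  simp only [Prod.fst_add, Prod.snd_add, add_zero, add_sub_cancel_right]
  rw [show ω * (p.1 + s - inner ℝ k p.2) = ω * s + ω * (p.1 - inner ℝ k p.2) by ring,
    Complex.ofReal_add, mul_add, Complex.exp_add, Complex.ofReal_mul]
  ring

/-- The convolution of a source with an integrable function of time is again a source. -/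
lemma IsSource.timeConv {Φ : ℝ → ℝ} (hΨ : IsSource Ψ) (hΦ : Integrable Φ) :
    IsSource (timeConv Φ Ψ) where
  continuous := by
    obtain ⟨C, hC⟩ := hΨ.exists_bound
    have hc := hΨ.continuous
    unfold RoughInterface.timeConv
    refine continuous_of_dominated (bound := fun s => ‖Φ s‖ * C) (fun p => ?_) (fun p => ?_)
      (hΦ.norm.mul_const C) ?_
    · exact (integrable_mul_shift hΦ hΨ p.1 p.2).1
    · filter_upwards with s
      rw [norm_mul]
      gcongr
      exact hC _
    · filter_upwards with s
      fun_prop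
  integrable := integrable_timeConv hΦ hΨ.integrable
  compactSupport := by
    refine hΨ.compactSupport.mono fun p hp => ?_
    rw [Function.mem_support, sourceHat_timeConv hΦ hΨ.integrable] at hp
    exact right_ne_zero_of_mul hp
  noLowFreq := by
    obtain ⟨a, ha, h⟩ := hΨ.noLowFreq
    refine ⟨a, ha, fun ω k hω => ?_⟩
    rw [sourceHat_timeConv hΦ hΨ.integrable, h ω k hω, mul_zero]

end Convolution

/-! ### The paraxial wave equation -/

section Oscillatory

variable {P : Type*} [NormedAddCommGroup P] [MeasurableSpace P] [BorelSpace P]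
  {ν : Measure P} [IsFiniteMeasureOnCompacts ν] {h : P → ℂ}

/-- Superpositions of plane waves with compactly supported amplitude are smooth: such an integral
is the Fourier transform of a measure on the graph of `b`. -/
lemma contDiff_integral_exp [NormedSpace ℝ P] [SecondCountableTopology P] {W : Type*}
    [NormedAddCommGroup W] [NormedSpace ℝ W] [FiniteDimensional ℝ W] {b : P → W →L[ℝ] ℝ}
    (hb : Continuous b) (hh : Continuous h) (hs : HasCompactSupport h) :
    ContDiff ℝ (⊤ : ℕ∞) (fun w => ∫ p, Complex.exp (Complex.I * ((b p w : ℝ) : ℂ)) * h p ∂ν) := by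
  set j : P → (W →L[ℝ] ℝ) × P := fun p => (b p, p) with hj
  have hjc : Continuous j := by fun_prop
  set L : (W →L[ℝ] ℝ) × P →L[ℝ] W →L[ℝ] ℝ :=
    (-(2 * Real.pi)⁻¹) • ContinuousLinearMap.fst ℝ (W →L[ℝ] ℝ) P with hL
  have hmain := VectorFourier.contDiff_fourierIntegral (N := (⊤ : ℕ∞))
    (f := fun v : (W →L[ℝ] ℝ) × P => h v.2) L (μ := ν.map j) (by
      intro n _
      rw [integrable_map_measure (Continuous.aestronglyMeasurable (by fun_prop))
        hjc.measurable.aemeasurable]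
      refine Continuous.integrable_of_hasCompactSupport (by fun_prop) ?_
      exact hs.mono fun p hp => norm_ne_zero_iff.mp (right_ne_zero_of_mul hp))
  suffices heq : (fun w => ∫ p, Complex.exp (Complex.I * ((b p w : ℝ) : ℂ)) * h p ∂ν) = _ from
    heq ▸ hmain
  ext w
  have hLc : Continuous fun v : (W →L[ℝ] ℝ) × P => L v w := by fun_prop
  have hj2 : ∀ p, 2 * Real.pi * -(L (j p) w) = b p w := fun p => by
    simp only [hL, hj, smul_apply, ContinuousLinearMap.coe_fst', smul_eq_mul]
    field_simp
  have h1 := integral_map (μ := ν) hjc.measurable.aemeasurable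
    (f := fun v => Complex.exp (Complex.I * ((2 * Real.pi * -(L v w) : ℝ) : ℂ)) * h v.2)
    (Continuous.aestronglyMeasurable (by fun_prop))
  simp only [hj2] at h1
  refine h1.symm.trans (integral_congr_ae (Eventually.of_forall fun v => ?_))
  simp only [Circle.smul_def, smul_eq_mul, Real.fourierChar_apply]
  rw [mul_comm Complex.I]
  rfl

lemma hasDerivAt_integral_exp {α β : P → ℝ} (hα : Continuous α) (hβ : Continuous β)
    (hh : Continuous h) (hs : HasCompactSupport h) (t : ℝ) :
    HasDerivAt (fun t => ∫ p, Complex.exp (Complex.I * ((α p + t * β p : ℝ) : ℂ)) * h p ∂ν)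
      (∫ p, Complex.exp (Complex.I * ((α p + t * β p : ℝ) : ℂ)) *
        (Complex.I * (β p : ℂ) * h p) ∂ν) t := by
  have hI : ∀ t : ℝ, Continuous
      fun p => Complex.exp (Complex.I * ((α p + t * β p : ℝ) : ℂ)) * h p := by
    intro t; fun_prop
  refine (hasDerivAt_integral_of_dominated_loc_of_deriv_le (bound := fun p => ‖β p‖ * ‖h p‖)
    (F := fun t p => Complex.exp (Complex.I * ((α p + t * β p : ℝ) : ℂ)) * h p)
    (F' := fun t p => Complex.exp (Complex.I * ((α p + t * β p : ℝ) : ℂ)) *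
      (Complex.I * (β p : ℂ) * h p)) (s := Set.univ) univ_mem
    (Eventually.of_forall fun t => (hI t).aestronglyMeasurable)
    ((hI t).integrable_of_hasCompactSupport (hs.mono fun p hp => right_ne_zero_of_mul hp))
    (Continuous.aestronglyMeasurable (by fun_prop)) ?_ ?_ ?_).2
  · refine Eventually.of_forall fun p t _ => ?_
    rw [norm_mul, Complex.norm_exp_I_mul_ofReal, one_mul, norm_mul, norm_mul, Complex.norm_I,
      one_mul, Complex.norm_real]
  · refine Continuous.integrable_of_hasCompactSupport (by fun_prop) ?_
    exact hs.mono fun p hp => norm_ne_zero_iff.mp (right_ne_zero_of_mul hp)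
  · refine Eventually.of_forall fun p t _ => ?_
    have h1 : HasDerivAt (fun t : ℝ => α p + t * β p) (β p) t := by
      simpa using ((hasDerivAt_id t).mul_const (β p)).const_add (α p)
    have h2 := ((h1.ofReal_comp.const_mul Complex.I).cexp).mul_const (h p)
    exact h2.congr_deriv (by ring)

end Oscillatory

section Paraxial

variable {M : Medium} {Ξ : ℝ × Plane → ℝ} {h : ℝ × Plane → ℂ}

/-- The phase `-ω(s - y·q) - ω z c₀ qᵀA₀q/2` of a paraxial plane wave. -/
noncomputable def paraxialPhase (M : Medium) (s : ℝ) (y : Plane) (z : ℝ) (p : ℝ × Plane) : ℝ :=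
  p.1 * (inner ℝ y p.2 - s - z * M.c₀ * M.quadForm p.2 / 2)

/-- Superposition of paraxial plane waves with amplitude `h`. -/
noncomputable def paraxialWave (M : Medium) (h : ℝ × Plane → ℂ) (s : ℝ) (y : Plane) (z : ℝ) : ℂ :=
  ∫ p, Complex.exp (Complex.I * (paraxialPhase M s y z p : ℂ)) * h p

lemma paraxialPulse_eq_paraxialWave (s : ℝ) (y : Plane) (z : ℝ) :
    paraxialPulse M Ξ s y z = paraxialWave M (fun p => ((1 / (2 * (2 * Real.pi) ^ 3) : ℝ) : ℂ) *
      (sourceHat Ξ p.1 p.2 * ((p.1 ^ 2 : ℝ) : ℂ))) s y z := by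
  rw [paraxialPulse, paraxialWave, ← integral_const_mul]
  congr 1
  ext p
  rw [Medium.hatU₀, ← Complex.exp_add]
  have : Complex.I * (paraxialPhase M s y z p : ℂ) =
      -Complex.I * ((p.1 * (s - inner ℝ y p.2) : ℝ) : ℂ) +
        -Complex.I * ((p.1 * z * M.c₀ * M.quadForm p.2 / 2 : ℝ) : ℂ) := by
    rw [paraxialPhase]
    push_cast
    ring
  rw [this]
  ring

lemma hasDerivAt_paraxialWave_s (hh : Continuous h) (hs : HasCompactSupport h) (s : ℝ) (y : Plane)
    (z : ℝ) : HasDerivAt (fun s => paraxialWave M h s y z)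
      (paraxialWave M (fun p => Complex.I * ((-p.1 : ℝ) : ℂ) * h p) s y z) s := by
  have hQ := M.continuous_quadForm
  have := hasDerivAt_integral_exp (ν := volume) (h := h)
    (α := fun p : ℝ × Plane => paraxialPhase M 0 y z p) (β := fun p => -p.1)
    (by unfold paraxialPhase; fun_prop) (by fun_prop) hh hs s
  have e : ∀ (s : ℝ) (p : ℝ × Plane),
      paraxialPhase M s y z p = paraxialPhase M 0 y z p + s * -p.1 := by
    intro s p; simp only [paraxialPhase]; ring
  simp only [← e] at this
  exact this

lemma hasDerivAt_paraxialWave_z (hh : Continuous h) (hs : HasCompactSupport h) (s : ℝ) (y : Plane)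
    (z : ℝ) : HasDerivAt (fun z => paraxialWave M h s y z)
      (paraxialWave M (fun p => Complex.I * ((-(p.1 * M.c₀ * M.quadForm p.2 / 2) : ℝ) : ℂ) * h p)
        s y z) z := by
  have hQ := M.continuous_quadForm
  have := hasDerivAt_integral_exp (ν := volume) (h := h)
    (α := fun p : ℝ × Plane => paraxialPhase M s y 0 p)
    (β := fun p => -(p.1 * M.c₀ * M.quadForm p.2 / 2))
    (by unfold paraxialPhase; fun_prop) (by fun_prop) hh hs z
  have e : ∀ (z : ℝ) (p : ℝ × Plane), paraxialPhase M s y z p =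
      paraxialPhase M s y 0 p + z * -(p.1 * M.c₀ * M.quadForm p.2 / 2) := by
    intro z p; simp only [paraxialPhase]; ring
  simp only [← e] at this
  exact this

lemma partialY_paraxialWave (hh : Continuous h) (hs : HasCompactSupport h) (i : Fin 2) (s : ℝ)
    (y : Plane) (z : ℝ) : partialY i (fun y => paraxialWave M h s y z) y =
      paraxialWave M (fun p => Complex.I * ((p.1 * p.2 i : ℝ) : ℂ) * h p) s y z := by
  have hQ := M.continuous_quadForm
  have := hasDerivAt_integral_exp (ν := volume) (h := h)
    (α := fun p : ℝ × Plane => paraxialPhase M s y z p) (β := fun p => p.1 * p.2 i)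
    (by unfold paraxialPhase; fun_prop) (by fun_prop) hh hs 0
  have e : ∀ (t : ℝ) (p : ℝ × Plane),
      paraxialPhase M s (y + t • EuclideanSpace.single i (1 : ℝ)) z p =
        paraxialPhase M s y z p + t * (p.1 * p.2 i) := by
    intro t p
    have : inner ℝ (EuclideanSpace.single i (1 : ℝ)) p.2 = p.2 i := by
      simp [EuclideanSpace.inner_single_left]
    simp only [paraxialPhase]
    rw [inner_add_left, real_inner_smul_left, this]
    ring
  rw [partialY, lineDeriv]
  unfold paraxialWave
  simp_rw [e]
  rw [this.deriv]
  simp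

lemma integrable_paraxialWave (hh : Continuous h) (hs : HasCompactSupport h) (s : ℝ) (y : Plane)
    (z : ℝ) :
    Integrable (fun p => Complex.exp (Complex.I * (paraxialPhase M s y z p : ℂ)) * h p) := by
  have hQ := M.continuous_quadForm
  refine Continuous.integrable_of_hasCompactSupport ?_ (hs.mono fun p hp => right_ne_zero_of_mul hp)
  unfold paraxialPhase
  fun_prop

lemma contDiff_paraxialWave (hh : Continuous h) (hs : HasCompactSupport h) :
    ContDiff ℝ (⊤ : ℕ∞) (fun p : ℝ × Plane × ℝ => paraxialWave M h p.1 p.2.1 p.2.2) := by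
  have hQ := M.continuous_quadForm
  -- the phase as a linear functional of `(s, y, z)`
  set b : ℝ × Plane → (ℝ × Plane × ℝ) →L[ℝ] ℝ := fun p =>
    (-p.1) • ContinuousLinearMap.fst ℝ ℝ (Plane × ℝ) +
    p.1 • (innerSL ℝ p.2).comp ((ContinuousLinearMap.fst ℝ Plane ℝ).comp
      (ContinuousLinearMap.snd ℝ ℝ (Plane × ℝ))) +
    (-(p.1 * M.c₀ * M.quadForm p.2 / 2)) • (ContinuousLinearMap.snd ℝ Plane ℝ).comp
      (ContinuousLinearMap.snd ℝ ℝ (Plane × ℝ)) with hb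
  have hbc : Continuous b := by fun_prop
  convert contDiff_integral_exp (ν := volume) hbc hh hs using 1
  ext w
  rw [paraxialWave]
  congr 1
  ext p
  congr 4
  simp only [hb, paraxialPhase, add_apply, smul_apply, ContinuousLinearMap.comp_apply,
    ContinuousLinearMap.coe_fst', ContinuousLinearMap.coe_snd', innerSL_apply_apply, smul_eq_mul]
  rw [real_inner_comm w.2.1 p.2]
  ring

/-- The paraxial wave equation holds for each plane wave: its symbol is
`(-iω)(-iω c₀ qᵀA₀q/2) - (c₀/2) ∑ᵢⱼ (iω qᵢ) A₀ᵢⱼ (iω qⱼ) = 0`. -/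
lemma paraxialWave_equation (hh : Continuous h) (hs : HasCompactSupport h) (s : ℝ) (y : Plane)
    (z : ℝ) :
    deriv (fun s' => deriv (fun z' => paraxialWave M h s' y z') z) s
      - ((M.c₀ / 2 : ℝ) : ℂ) * ∑ i, partialY i (fun y' =>
          ∑ j, (M.A₀ i j : ℂ) * partialY j (fun y'' => paraxialWave M h s y'' z) y') y = 0 := by
  have hQ := M.continuous_quadForm
  have hmul : ∀ f : ℝ × Plane → ℂ, HasCompactSupport (fun p => f p * h p) := fun f =>
    hs.mono fun p hp => right_ne_zero_of_mul hp
  simp_rw [(hasDerivAt_paraxialWave_z hh hs _ _ _).deriv]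
  rw [(hasDerivAt_paraxialWave_s (by fun_prop) (hmul _) _ _ _).deriv]
  simp_rw [partialY_paraxialWave hh hs]
  have hsum : ∀ i : Fin 2, (fun y' => ∑ j, (M.A₀ i j : ℂ) *
      paraxialWave M (fun p => Complex.I * ((p.1 * p.2 j : ℝ) : ℂ) * h p) s y' z) =
      fun y' => paraxialWave M
        (fun p => (∑ j, (M.A₀ i j : ℂ) * (Complex.I * ((p.1 * p.2 j : ℝ) : ℂ))) * h p) s y' z := by
    intro i
    ext y'
    simp_rw [paraxialWave, ← integral_const_mul]
    rw [← integral_finsetSum]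
    · congr 1
      ext p
      rw [Finset.sum_mul, Finset.mul_sum]
      exact Finset.sum_congr rfl fun j _ => by ring
    · intro j _
      exact (integrable_paraxialWave (by fun_prop) (hmul _) s y' z).const_mul _
  simp_rw [hsum]
  simp_rw [fun i => partialY_paraxialWave (M := M) (h := fun p =>
    (∑ j, (M.A₀ i j : ℂ) * (Complex.I * ((p.1 * p.2 j : ℝ) : ℂ))) * h p) (by fun_prop) (hmul _) i
    s y z]
  simp_rw [paraxialWave]
  rw [← integral_finsetSum, ← integral_const_mul, ← integral_sub, integral_eq_zero_of_ae]
  · refine Eventually.of_forall fun p => ?_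
    simp only [Medium.quadForm, Fin.sum_univ_two, Pi.zero_apply]
    push_cast
    ring
  · exact integrable_paraxialWave (by fun_prop) ((hmul _).mono fun p hp => right_ne_zero_of_mul hp)
      s y z
  · refine (integrable_finsetSum _ fun i _ => ?_).const_mul _
    exact integrable_paraxialWave (by fun_prop) ((hmul _).mono fun p hp => right_ne_zero_of_mul hp)
      s y z
  · intro i _
    exact integrable_paraxialWave (by fun_prop) ((hmul _).mono fun p hp => right_ne_zero_of_mul hp)
      s y z

lemma IsSource.solvesParaxial (hΞ : IsSource Ξ) :
    SolvesParaxial M (paraxialPulse M Ξ) (fun s y => ((1 / 2 * Ξ (s, y) : ℝ) : ℂ)) := by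
  have hc := continuous_sourceHat hΞ.integrable
  set h : ℝ × Plane → ℂ := fun p => ((1 / (2 * (2 * Real.pi) ^ 3) : ℝ) : ℂ) *
      (sourceHat Ξ p.1 p.2 * ((p.1 ^ 2 : ℝ) : ℂ)) with hh
  have hhc : Continuous h := by fun_prop
  have hhs : HasCompactSupport h :=
    hΞ.compactSupport.mono fun p hp => left_ne_zero_of_mul (right_ne_zero_of_mul hp)
  have heq : paraxialPulse M Ξ = paraxialWave M h := by
    ext s y z
    exact paraxialPulse_eq_paraxialWave s y z
  refine ⟨?_, ?_, ?_⟩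
  · rw [heq]
    exact contDiff_paraxialWave hhc hhs
  · rw [heq]
    exact paraxialWave_equation hhc hhs
  · intro s y
    have h0 : ∀ (ω : ℝ) (q : Plane), M.hatU₀ ω q 0 = 1 := by intro ω q; simp [Medium.hatU₀]
    simp only [paraxialPulse, h0, mul_one]
    rw [Complex.ofReal_mul, ← hΞ.inversion, ← mul_assoc, ← Complex.ofReal_mul]
    congr 2
    field_simp

/-- The homogenized profile is the paraxial pulse of the convolved source: multiplication by the
characteristic function is a convolution in time. -/
lemma homogenizedProfile_eq_paraxialPulse {Ω : Type*} [MeasurableSpace Ω] {μ : Measure Ω}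
    {V : Plane → Ω → ℝ} (hV : Measurable (V 0)) {fV : ℝ → ℝ} (hf : Measurable fV)
    (hf0 : ∀ x, 0 ≤ fV x) (hfi : Integrable fV)
    (hd : μ.map (V 0) = volume.withDensity (fun x => ENNReal.ofReal (fV x)))
    (hΨ : Integrable Ξ) (s : ℝ) (y : Plane) :
    homogenizedProfile M Ξ (phiV μ V) s y = (M.reflCoef : ℂ) *
      paraxialPulse M (timeConv (scaledDensity M fV) Ξ) s y (2 * M.zint) := by
  rw [homogenizedProfile, paraxialPulse, ← mul_assoc, ← Complex.ofReal_mul, mul_one_div]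
  congr 2
  ext p
  rw [profileIntegrand, sourceHat_timeConv (integrable_scaledDensity hfi) hΨ,
    integral_scaledDensity_mul_exp hV hf hf0 hd, real_inner_comm y p.2]
  ring

end Paraxial

/-! ### The height density as an inverse Fourier transform of the characteristic function -/

section Density

open FourierTransform

lemma integral_exp_mul_schwartz (χ : 𝓢(ℝ, ℂ)) (ω : ℝ) :
    ∫ s : ℝ, Complex.exp (-Complex.I * ((ω * s : ℝ) : ℂ)) * χ s = 𝓕 χ (ω / (2 * Real.pi)) := by
  rw [SchwartzMap.fourier_coe, Real.fourier_real_eq_integral_exp_smul]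
  congr 1
  ext s
  rw [smul_eq_mul]
  congr 2
  push_cast
  field_simp

lemma integrable_integral_exp_mul_schwartz (χ : 𝓢(ℝ, ℂ)) :
    Integrable fun ω : ℝ => ∫ s : ℝ, Complex.exp (-Complex.I * ((ω * s : ℝ) : ℂ)) * χ s := by
  simp_rw [integral_exp_mul_schwartz]
  exact (𝓕 χ).integrable.comp_div (by positivity)

/-- Fourier inversion of test functions, in the angular frequency. -/
lemma schwartz_inversion (χ : 𝓢(ℝ, ℂ)) (s : ℝ) :
    ((1 / (2 * Real.pi) : ℝ) : ℂ) * ∫ ω : ℝ, Complex.exp (Complex.I * ((ω * s : ℝ) : ℂ)) *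
      ∫ t : ℝ, Complex.exp (-Complex.I * ((ω * t : ℝ) : ℂ)) * χ t = χ s := by
  simp_rw [integral_exp_mul_schwartz]
  have h1 := Measure.integral_comp_div (fun η : ℝ =>
    Complex.exp (Complex.I * ((2 * Real.pi * η * s : ℝ) : ℂ)) * 𝓕 χ η) (2 * Real.pi)
  have h2 : ∀ ω : ℝ, 2 * Real.pi * (ω / (2 * Real.pi)) * s = ω * s := fun ω => by field_simp
  simp_rw [h2] at h1
  rw [h1, Complex.real_smul, ← mul_assoc, ← Complex.ofReal_mul, abs_of_pos (by positivity),
    one_div_mul_cancel (by positivity), Complex.ofReal_one, one_mul]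
  have h3 : 𝓕⁻ (𝓕 χ) s = χ s := by rw [FourierTransform.fourierInv_fourier_eq]
  rw [← h3, SchwartzMap.fourierInv_coe, Real.fourierInv_eq']
  congr 1
  ext η
  rw [smul_eq_mul, mul_comm Complex.I]
  congr 4
  simp only [RCLike.inner_apply, conj_trivial]
  ring

/-- The inverse Fourier transform of `∫ Φ(s) e^{iωs} ds` is `Φ`, tested against Schwartz
functions. -/
lemma integral_mul_schwartz_eq {Φ : ℝ → ℝ} (hΦ : Integrable Φ) (χ : 𝓢(ℝ, ℂ)) :
    ∫ s : ℝ, (Φ s : ℂ) * χ s = ((1 / (2 * Real.pi) : ℝ) : ℂ) * ∫ ω : ℝ,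
      (∫ s : ℝ, (Φ s : ℂ) * Complex.exp (Complex.I * ((ω * s : ℝ) : ℂ))) *
        ∫ s : ℝ, Complex.exp (-Complex.I * ((ω * s : ℝ) : ℂ)) * χ s := by
  set X : ℝ → ℂ := fun ω => ∫ s : ℝ, Complex.exp (-Complex.I * ((ω * s : ℝ) : ℂ)) * χ s with hX
  have hXi : Integrable X := integrable_integral_exp_mul_schwartz χ
  have hint : Integrable (fun p : ℝ × ℝ => (Φ p.1 : ℂ) * X p.2 *
      Complex.exp (Complex.I * ((p.2 * p.1 : ℝ) : ℂ))) (volume.prod volume) :=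
    (Integrable.mul_prod (hΦ.ofReal (𝕜 := ℂ)) hXi).mul_bdd (c := 1)
      (Continuous.aestronglyMeasurable (by fun_prop))
      (Eventually.of_forall fun p => (Complex.norm_exp_I_mul_ofReal _).le)
  have h1 : ∀ s : ℝ, (Φ s : ℂ) * χ s = ((1 / (2 * Real.pi) : ℝ) : ℂ) *
      ∫ ω : ℝ, (Φ s : ℂ) * X ω * Complex.exp (Complex.I * ((ω * s : ℝ) : ℂ)) := by
    intro s
    rw [← schwartz_inversion χ s, mul_left_comm, ← integral_const_mul]
    congr 2
    ext ω
    ring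
  simp_rw [h1]
  rw [integral_const_mul, integral_integral_swap hint]
  congr 2
  ext ω
  rw [← integral_mul_const]
  congr 1
  ext s
  ring

/-- If the Fourier transform `φ` of `Φ` is integrable, inversion holds almost everywhere. -/
lemma ae_eq_integral_of_integrable {Φ : ℝ → ℝ} (hΦ : Integrable Φ) {φ : ℝ → ℂ}
    (hφ : ∀ ω : ℝ, ∫ s : ℝ, (Φ s : ℂ) * Complex.exp (Complex.I * ((ω * s : ℝ) : ℂ)) = φ ω)
    (hφi : Integrable φ) :
    ∀ᵐ s : ℝ, (Φ s : ℂ) = ((1 / (2 * Real.pi) : ℝ) : ℂ) * ∫ ω : ℝ,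
      Complex.exp (-Complex.I * ((ω * s : ℝ) : ℂ)) * φ ω := by
  have hcont : Continuous fun s : ℝ => ((1 / (2 * Real.pi) : ℝ) : ℂ) * ∫ ω : ℝ,
      Complex.exp (-Complex.I * ((ω * s : ℝ) : ℂ)) * φ ω := by
    refine Continuous.const_mul ?_ _
    refine continuous_of_dominated (bound := fun ω => ‖φ ω‖) (fun s => ?_) (fun s => ?_) hφi.norm ?_
    · exact (Continuous.aestronglyMeasurable (by fun_prop)).mul hφi.1
    · refine Eventually.of_forall fun ω => ?_
      rw [norm_mul, norm_exp_neg_I_mul_ofReal, one_mul]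
    · exact Eventually.of_forall fun ω => by fun_prop
  -- both sides agree as distributions
  refine ae_eq_of_integral_contDiff_smul_eq (hΦ.ofReal (𝕜 := ℂ)).locallyIntegrable
    hcont.locallyIntegrable fun g hg hgs => ?_
  have hgc : HasCompactSupport fun s => (g s : ℂ) := hgs.comp_left Complex.ofReal_zero
  set χ : 𝓢(ℝ, ℂ) := hgc.toSchwartzMap (Complex.ofRealCLM.contDiff.comp hg) with hχdef
  have hχ : ∀ s, χ s = (g s : ℂ) := fun s => rfl
  have hint : Integrable (fun p : ℝ × ℝ => φ p.1 * χ p.2 *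
      Complex.exp (-Complex.I * ((p.1 * p.2 : ℝ) : ℂ))) (volume.prod volume) :=
    (Integrable.mul_prod hφi χ.integrable).mul_bdd (c := 1)
      (Continuous.aestronglyMeasurable (by fun_prop))
      (Eventually.of_forall fun p => (norm_exp_neg_I_mul_ofReal _).le)
  have h1 := integral_mul_schwartz_eq hΦ χ
  simp_rw [hφ, ← integral_const_mul] at h1
  have h2 : ∀ ω s : ℝ, φ ω * (Complex.exp (-Complex.I * ((ω * s : ℝ) : ℂ)) * χ s) =
      φ ω * χ s * Complex.exp (-Complex.I * ((ω * s : ℝ) : ℂ)) := fun ω s => by ring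
  simp_rw [h2] at h1
  have h3 := integral_integral_swap (f := fun ω s => φ ω * χ s *
    Complex.exp (-Complex.I * ((ω * s : ℝ) : ℂ))) hint
  simp only [Complex.real_smul]
  simp_rw [integral_const_mul] at h1
  simp_rw [← hχ, mul_comm (χ _)]
  rw [h1]
  simp_rw [mul_assoc]
  rw [integral_const_mul]
  congr 1
  simp_rw [← integral_mul_const]
  simp_rw [mul_assoc] at h3
  rw [h3]
  congr 1
  ext s
  congr 1
  ext ω
  ring

end Density

end RoughInterface

theorem mainTheorem4 {Ω : Type*} [MeasurableSpace Ω] (μ : Measure Ω) [IsProbabilityMeasure μ]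
    (M : Medium)
    (Ψ : ℝ × Plane → ℝ) (hΨ : IsSource Ψ)
    (V : Plane → Ω → ℝ) (hV : IsInterfaceField μ V)
    (fV : ℝ → ℝ) (hfV_meas : Measurable fV) (hfV_nonneg : ∀ x, 0 ≤ fV x)
    (hfV : μ.map (V 0) = volume.withDensity (fun x => ENNReal.ofReal (fV x)))
    (γ : ℝ) (hγ : 1 / 2 < γ) :
    -- convergence in probability of the reflected wave front, as a random tempered distribution
    (∃ (Uε : ℝ → Ω → 𝓢'(ObsSpace, ℂ)) (U : 𝓢'(ObsSpace, ℂ)),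
      (∀ ε > 0, ∀ w (φ : 𝓢(ObsSpace, ℂ)),
        Uε ε w φ = wavePairing M Ψ (fun x => V x w) γ ε φ) ∧
      (∀ ε > 0, ∀ φ : 𝓢(ObsSpace, ℂ), Measurable (fun w => Uε ε w φ)) ∧
      (∀ φ : 𝓢(ObsSpace, ℂ),
        Integrable (fun p : ObsSpace =>
          homogenizedProfile M Ψ (phiV μ V) p.1 p.2.1 * φ p) ∧
        U φ = ∫ p : ObsSpace,
          homogenizedProfile M Ψ (phiV μ V) p.1 p.2.1 * φ p) ∧
      TendstoInProbability μ Uε U) ∧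
    -- the integral that defines the limit profile converges absolutely
    (∀ s y, Integrable
      (profileIntegrand M Ψ (phiV μ V) s y)) ∧
    -- the limit profile is the paraxial pulse of the time-convolved source, times `R`
    (∀ s y, homogenizedProfile M Ψ (phiV μ V) s y =
      (M.reflCoef : ℂ) * paraxialPulse M
        (timeConv (scaledDensity M fV) Ψ) s y (2 * M.zint)) ∧
    -- this pulse solves the paraxial wave equation with initial condition `(1/2) Φ *ₛ Ψ`
    (∀ s y, Integrable (fun s' : ℝ => scaledDensity M fV s' * Ψ (s - s', y))) ∧
    Integrable (timeConv (scaledDensity M fV) Ψ) ∧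
    SolvesParaxial M
      (paraxialPulse M
        (timeConv (scaledDensity M fV) Ψ))
      (fun s y => ((1 / 2 *
        timeConv (scaledDensity M fV) Ψ (s, y) : ℝ) : ℂ)) ∧
    -- `Φ(s) = (1/2π) ∫ exp(-iωs) φ_V(2ωs₀) dω` in the sense of tempered distributions
    (∀ χ : 𝓢(ℝ, ℂ),
      ∫ s : ℝ, (scaledDensity M fV s : ℂ) * χ s =
        ((1 / (2 * Real.pi) : ℝ) : ℂ) * ∫ ω : ℝ, phiV μ V (2 * ω * M.s₀) *
          ∫ s : ℝ, Complex.exp (-Complex.I * ((ω * s : ℝ) : ℂ)) * χ s) ∧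
    -- and almost everywhere if `φ_V` is integrable
    (Integrable (phiV μ V) →
      ∀ᵐ s : ℝ, (scaledDensity M fV s : ℂ) =
        ((1 / (2 * Real.pi) : ℝ) : ℂ) * ∫ ω : ℝ,
          Complex.exp (-Complex.I * ((ω * s : ℝ) : ℂ)) *
            phiV μ V (2 * ω * M.s₀)) := by
  have hf := integrable_density (hV.measurable 0) hfV_meas hfV_nonneg hfV
  have hΦ := integrable_scaledDensity (M := M) hf
  have hΦhat := integral_scaledDensity_mul_exp (M := M) (hV.measurable 0) hfV_meas hfV_nonneg hfV
  refine ⟨exists_waveFront_tendsto M hΨ hV hγ,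
    integrable_profileIntegrand M hΨ
      (continuous_phiV (μ := μ) (hV.measurable 0)).measurable (norm_phiV_le (μ := μ) V),
    homogenizedProfile_eq_paraxialPulse (hV.measurable 0) hfV_meas hfV_nonneg hf hfV hΨ.integrable,
    integrable_mul_shift hΦ hΨ, integrable_timeConv hΦ hΨ.integrable,
    (hΨ.timeConv hΦ).solvesParaxial, fun χ => ?_, fun hφ => ?_⟩
  · rw [integral_mul_schwartz_eq hΦ χ]
    simp_rw [hΦhat]
  · have hs := M.s₀_pos
    refine ae_eq_integral_of_integrable hΦ hΦhat ?_
    simp_rw [mul_right_comm (2 : ℝ) _ M.s₀]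
    exact hφ.comp_mul_left' (by positivity)
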